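/- **Setting.** Let $T\in(0,\infty]$, $\mathscr T=[0,T]$ if $T<\infty$ and $\mathscr T=[0,\infty)$ if $T=\infty$, and let $(\Omega,\mathcal F,(\mathcal F_t)_{t\in\mathscr T},P)$ be a filtered probability space. Let $\delta\ge 0$, with $\delta>0$ if $T=\infty$. A progressively measurable $\mathbb R^d$-valued process $X$ belongs to $\mathscr L^2_\delta$ if $E[\int_0^T e^{-\delta t}\|X_t\|^2dt]<\infty$. Let $\sigma\in\mathbb R^{d\times d}$ with $\Sigma=\sigma\sigma^\top$ nonsingular, let $\Lambda\in\mathbb R^{d\times d}$ be diagonal with positive diagonal entries $\lambda^1,\dots,\lambda^d$, let $\gamma>0$ (the agent's risk aversion), and let $\mu,\zeta\in\mathscr L^2_\delta$ (the given expected return and the agent's hedgeable endowment exposure). Let $A$ be a real adapted process with right-continuous paths of locally finite variation and $E[\int_0^Te^{-\delta s}d|A|_s]<\infty$, and let $M^\perp$ be a real martingale with predictable quadratic variation $\langle M^\perp\rangle$ and $E[\int_0^T e^{-\delta s}d\langle M^\perp\rangle_s]<\infty$. A trading rate $\dot\varphi\in\mathscr L^2_\delta$ is admissible if the position $\varphi_t=\int_0^t\dot\varphi_sds$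 also belongs to $\mathscr L^2_\delta$. The agent maximizes over admissible rates $$J(\dot\varphi)=E\Big[\int_0^Te^{-\delta t}\Big(\varphi_t^\top\mu_t-\frac{\gamma}{2}(\varphi_t+\zeta_t)^\top\Sigma(\varphi_t+\zeta_t)-\dot\varphi_t^\top\Lambda\dot\varphi_t\Big)dt\Big]+E\Big[\int_0^Te^{-\delta t}\Big(dA_t-\frac{\gamma}{2}d\langle M^\perp\rangle_t\Big)\Big].$$ Put $\xi_t=\frac1\gamma\Sigma^{-1}\mu_t-\zeta_t$ (the frictionless optimizer), $B=\frac{\gamma}{2}\Lambda^{-1}\Sigma$ and $\Delta=B+\frac{\delta^2}{4}I_d$. A solution of the FBSDE $$d\varphi_t=\dot\varphi_tdt,\quad\varphi_0=0,\qquad d\dot\varphi_t=dM_t+B(\varphi_t-\xi_t)dt+\delta\dot\varphi_tdt \qquad (1)$$ is a triple $(\varphi,\dot\varphi,M)$ with $\varphi,\dot\varphi\in\mathscr L^2_\delta$ and $M$ an $\mathbb R^d$-valued martingale on $\mathscr T$ with finite second moments, such that almost surely the integrated form of (1) holds for all $t\in\mathscr T$ and, if $T<\infty$, $\dot\varphi_T=0$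 a.s. (If $T=\infty$ the terminal condition is replaced by the transversality conditions implicit in $\varphi,\dot\varphi\in\mathscr L^2_\delta$.) **Lemma 4.1.** 1. There is an admissible rate maximizing $J$; it is unique up to $dt\otimes P$-null sets, and the corresponding position is unique up to indistinguishability. 2. The FBSDE (1) has a solution; $\varphi$ is unique up to indistinguishability, and $\dot\varphi$ and $M-M_0$ are unique up to modification. 3. An admissible rate is optimal if and only if it coincides $dt\otimes P$-a.e. with the component $\dot\varphi$ of a solution of (1). 4. Let $T=\infty$. Then $\Delta$ has a unique real square root $\sqrt\Delta$ all of whose eigenvalues are real and positive, the process $$\bar\xi_t=\Big(\sqrt\Delta-\frac\delta2I_d\Big)E\Big[\int_t^\infty\Big(\sqrt\Delta+\frac\delta2I_d\Big)e^{-(\sqrt\Delta+\frac\delta2I_d)(s-t)}\xi_sds\,\Big|\,\mathcal F_t\Big]$$ has a progressively measurable version in $\mathscr L^2_\delta$, and for every progressively measurable version the optimal position (equivalently, the component $\varphi$ of the solution of (1)) and its rate satisfy $$\varphi_t=\int_0^te^{-(\sqrt\Delta-\frac\delta2I_d)(t-s)}\bar\xi_sds,\qquad\dot\varphi_t=\bar\xi_t-\Big(\sqrt\Delta-\frac\delta2I_d\Big)\varphi_t.$$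 5. Let $T<\infty$ and set $G(t)=\sum_{n\ge0}\frac{1}{(2n)!}\Delta^n(T-t)^{2n}$, with derivative $\dot G$. Then $\Delta G(t)-\frac\delta2\dot G(t)$ is invertible for all $t\in[0,T]$. With $F(t)=-\big(\Delta G(t)-\frac\delta2\dot G(t)\big)^{-1}B\,\dot G(t)$, the process $$\bar\xi_t=\Big(\Delta G(t)-\frac\delta2\dot G(t)\Big)^{-1}E\Big[\int_t^T\Big(\Delta G(s)-\frac\delta2\dot G(s)\Big)Be^{-\frac\delta2(s-t)}\xi_sds\,\Big|\,\mathcal F_t\Big]$$ has a progressively measurable version in $\mathscr L^2_\delta$, and for every progressively measurable version the optimal position (equivalently, the component $\varphi$ of the solution of (1)) and its rate satisfy $$\varphi_t=\int_0^te^{-\int_s^tF(u)du}\,\bar\xi_sds,\qquad\dot\varphi_t=\bar\xi_t-F(t)\varphi_t.$$ In 4 and 5, the formula for $\varphi$ holds almost surely for all $t\in\mathscr T$; the formula for the rate holds $dt\otimes P$-a.e. for an optimal rate, and almost surely for each $t\in\mathscr T$ for the component $\dot\varphi$ of a solution of (1). -/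

import Mathlib

open MeasureTheory Set Matrix
open scoped ENNReal

noncomputable section

namespace QuadCost

/-- The time set of a model with horizon `T ∈ [0, ∞]`: it is `[0, T]` for `T < ∞` and `[0, ∞)` for
`T = ∞`. As a subtype of `ℝ` it carries the usual order, topology, Borel sets and Lebesgue measure
(`volume`). -/
abbrev Horizon (T : ℝ≥0∞) : Type := {t : ℝ // 0 ≤ t ∧ ENNReal.ofReal t ≤ T}

/-- Time zero is the least element of the time set. -/
instance (T : ℝ≥0∞) : OrderBot (Horizon T) where
  bot := ⟨0, le_rfl, by simp⟩
  bot_le t := t.2.1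

/-- Lebesgue measure `dt` on the time set. -/
instance (T : ℝ≥0∞) : MeasureSpace (Horizon T) where
  volume := Measure.comap Subtype.val volume

/-- `ℝ^d`-valued processes; coordinates are indexed by `Fin d`. -/
abbrev VecProcess (T : ℝ≥0∞) (Ω : Type*) (d : ℕ) := Horizon T → Ω → (Fin d → ℝ)

section Spaces

variable {Ω : Type*} [mΩ : MeasurableSpace Ω] {T : ℝ≥0∞} {d : ℕ}

/-- The space `L²_δ`: progressively measurable processes `X` with
`E[∫_0^T e^{-δ t} ‖X_t‖² dt] < ∞` (all norms on `ℝ^d` give the same space). -/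
structure MemL2 (P : Measure Ω) (𝓕 : Filtration (Horizon T) mΩ) (δ : ℝ)
    (X : VecProcess T Ω d) : Prop where
  progressive : IsStronglyProgressive 𝓕 X
  finite : ∫⁻ ω, (∫⁻ t : Horizon T, ENNReal.ofReal (Real.exp (-δ * t) * ‖X t ω‖ ^ 2)) ∂P < ∞

/-- The position `φ_t = ∫_0^t r_s ds` reached from zero with trading rate `r`. -/
def position (r : VecProcess T Ω d) : VecProcess T Ω d :=
  fun t ω => ∫ s in Iic t, r s ω

/-- Admissible trading rates: the rate and the position it generates belong to `L²_δ`. -/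
def Admissible (P : Measure Ω) (𝓕 : Filtration (Horizon T) mΩ) (δ : ℝ)
    (r : VecProcess T Ω d) : Prop :=
  MemL2 P 𝓕 δ r ∧ MemL2 P 𝓕 δ (position r)

end Spaces

/-! ### Pathwise Stieltjes integrals, the endowment -/

section Endowment

variable {T : ℝ≥0∞}

/-- The point of the time set closest to the real number `x`. -/
def clamp (T : ℝ≥0∞) (x : ℝ) : Horizon T :=
  if h : 0 ≤ x then
    if h' : ENNReal.ofReal x ≤ T then ⟨x, h, h'⟩
    else ⟨T.toReal, ENNReal.toReal_nonneg, ENNReal.ofReal_toReal_le⟩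
  else ⊥

open Classical in
/-- The Lebesgue-Stieltjes measure `da` on `(0, T]` (on `(0, ∞)` if `T = ∞`) of a nondecreasing
right-continuous path `a`. -/
def stieltjesMeasure (a : Horizon T → ℝ) : Measure ℝ :=
  if h : Monotone (fun x => a (clamp T x)) then h.stieltjesFunction.measure.restrict (Ioi 0) else 0

/-- The variation `|a|_t` of a path on `[0, t]`. -/
def pathVariation (a : Horizon T → ℝ) (t : Horizon T) : ℝ := (eVariationOn a (Iic t)).toReal

/-- The Stieltjes integral `∫_0^T f(t) da_t` for a right-continuous path `a` of locally bounded
variation, through the decomposition `a = (|a| + a) / 2 - (|a| - a) / 2` into nondecreasing paths. -/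
def stieltjesIntegral (f : ℝ → ℝ) (a : Horizon T → ℝ) : ℝ :=
  (1 / 2) * ∫ t, f t ∂(stieltjesMeasure (fun t => pathVariation a t + a t))
    - (1 / 2) * ∫ t, f t ∂(stieltjesMeasure (fun t => pathVariation a t - a t))

variable {Ω : Type*} [mΩ : MeasurableSpace Ω]

/-- Finite variation part `A` of an endowment: adapted, with right-continuous paths of finite
variation on compacts, and `E[∫_0^T e^{-δ s} d|A|_s] < ∞`. -/
structure IsFiniteVariationPart (P : Measure Ω) (𝓕 : Filtration (Horizon T) mΩ) (δ : ℝ)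
    (A : Horizon T → Ω → ℝ) : Prop where
  adapted : StronglyAdapted 𝓕 A
  paths : ∀ᵐ ω ∂P, LocallyBoundedVariationOn (fun t => A t ω) univ ∧
    ∀ t, ContinuousWithinAt (fun s => A s ω) (Ici t) t
  finite : ∫⁻ ω, (∫⁻ s, ENNReal.ofReal (Real.exp (-δ * s))
    ∂(stieltjesMeasure (pathVariation (fun t => A t ω)))) ∂P < ∞

/-- `Q = ⟨M⟩` for a martingale `M` with square-integrable increments: `Q` is the predictable
nondecreasing right-continuous process started at zero for which `(M - M_0)² - Q` is a
martingale. -/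
structure IsAngleBracket (P : Measure Ω) (𝓕 : Filtration (Horizon T) mΩ)
    (M Q : Horizon T → Ω → ℝ) : Prop where
  predictable : IsStronglyPredictable 𝓕 Q
  paths : ∀ᵐ ω ∂P, Q ⊥ ω = 0 ∧ Monotone (fun t => Q t ω) ∧
    ∀ t, ContinuousWithinAt (fun s => Q s ω) (Ici t) t
  compensates : Martingale (fun t ω => (M t ω - M ⊥ ω) ^ 2 - Q t ω) 𝓕 P

/-- Unhedgeable part of an endowment: a martingale `M` with `Q = ⟨M⟩` and
`E[∫_0^T e^{-δ s} d⟨M⟩_s] < ∞`. By compensation this expectation is the same for `[M]`, so the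
condition says `M ∈ 𝓜²_{δ/2}`. -/
structure IsUnhedgeablePart (P : Measure Ω) (𝓕 : Filtration (Horizon T) mΩ) (δ : ℝ)
    (M Q : Horizon T → Ω → ℝ) : Prop where
  martingale : Martingale M 𝓕 P
  bracket : IsAngleBracket P 𝓕 M Q
  finite : ∫⁻ ω, (∫⁻ s, ENNReal.ofReal (Real.exp (-δ * s))
    ∂(stieltjesMeasure (fun t => Q t ω))) ∂P < ∞

end Endowment

/-! ### The optimization problem -/

section Problem

variable {Ω : Type*} [mΩ : MeasurableSpace Ω] {T : ℝ≥0∞} {d : ℕ}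

/-- The goal functional `J` of an agent with risk aversion `γ`, discount rate `δ`, covariance matrix
`S`, cost matrix `L`, expected return `μ` and endowment data `ζ`, `A`, `Q = ⟨M^⊥⟩`, at the trading
rate `r`. -/
def goal (P : Measure Ω) (δ γ : ℝ) (S L : Matrix (Fin d) (Fin d) ℝ) (μ ζ : VecProcess T Ω d)
    (A Q : Horizon T → Ω → ℝ) (r : VecProcess T Ω d) : ℝ :=
  (∫ ω, (∫ t : Horizon T, Real.exp (-δ * t) *
      (position r t ω ⬝ᵥ μ t ω
        - γ / 2 * ((position r t ω + ζ t ω) ⬝ᵥ (S *ᵥ (position r t ω + ζ t ω)))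
        - r t ω ⬝ᵥ (L *ᵥ r t ω))) ∂P)
  + ∫ ω, (stieltjesIntegral (fun t => Real.exp (-δ * t)) (fun t => A t ω)
      - γ / 2 * ∫ t, Real.exp (-δ * t) ∂(stieltjesMeasure (fun t => Q t ω))) ∂P

/-- `r` maximizes the goal functional over all admissible trading rates. -/
def IsOptimal (P : Measure Ω) (𝓕 : Filtration (Horizon T) mΩ) (δ γ : ℝ)
    (S L : Matrix (Fin d) (Fin d) ℝ) (μ ζ : VecProcess T Ω d) (A Q : Horizon T → Ω → ℝ)
    (r : VecProcess T Ω d) : Prop :=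
  Admissible P 𝓕 δ r ∧
    ∀ r', Admissible P 𝓕 δ r' → goal P δ γ S L μ ζ A Q r' ≤ goal P δ γ S L μ ζ A Q r

/-- The frictionless optimizer `S⁻¹ μ_t / γ - ζ_t`. -/
def frictionless (γ : ℝ) (S : Matrix (Fin d) (Fin d) ℝ) (μ ζ : VecProcess T Ω d) : VecProcess T Ω d :=
  fun t ω => γ⁻¹ • (S⁻¹ *ᵥ μ t ω) - ζ t ω

/-- The coefficient `γ Λ⁻¹ Σ / 2`, with `L = Λ` and `S = Σ`. -/
def coeff (γ : ℝ) (S L : Matrix (Fin d) (Fin d) ℝ) : Matrix (Fin d) (Fin d) ℝ :=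
  (γ / 2) • (L⁻¹ * S)

/-- `(φ, φ', M)` solves the linear FBSDE
`dφ_t = φ'_t dt`, `φ_0 = 0`, `dφ'_t = dM_t + B (φ_t - ξ_t) dt + δ φ'_t dt`,
with `φ, φ' ∈ L²_δ`, `M` a martingale with finite second moments, and with `φ'_T = 0` when
`T < ∞` (for `T = ∞` the last condition is void). -/
structure IsSolution (P : Measure Ω) (𝓕 : Filtration (Horizon T) mΩ) (δ : ℝ)
    (B : Matrix (Fin d) (Fin d) ℝ) (ξ φ φ' M : VecProcess T Ω d) : Prop where
  mem_position : MemL2 P 𝓕 δ φ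
  mem_rate : MemL2 P 𝓕 δ φ'
  martingale : Martingale M 𝓕 P
  moments : ∀ t, MemLp (M t) 2 P
  initial : ∀ᵐ ω ∂P, φ ⊥ ω = 0
  forward : ∀ᵐ ω ∂P, ∀ t, φ t ω = ∫ s in Iic t, φ' s ω
  backward : ∀ᵐ ω ∂P, ∀ t, φ' t ω = φ' ⊥ ω + (M t ω - M ⊥ ω)
    + ∫ s in Iic t, (B *ᵥ (φ s ω - ξ s ω) + δ • φ' s ω)
  terminal : ∀ t : Horizon T, ENNReal.ofReal t = T → ∀ᵐ ω ∂P, φ' t ω = 0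

end Problem

/-! ### The explicit formulas -/

section Formulas

variable {d : ℕ}

/-- `Δ = B + (δ² / 4) I`. -/
def shifted (δ : ℝ) (B : Matrix (Fin d) (Fin d) ℝ) : Matrix (Fin d) (Fin d) ℝ :=
  B + (δ ^ 2 / 4) • (1 : Matrix (Fin d) (Fin d) ℝ)

/-- `R` is a square root of `D` all of whose (complex) eigenvalues are real and positive, that is,
the principal square root of `D`. -/
def IsPrincipalSqrt (D R : Matrix (Fin d) (Fin d) ℝ) : Prop :=
  R * R = D ∧ ∀ z ∈ spectrum ℂ (R.map (algebraMap ℝ ℂ)), 0 < z.re ∧ z.im = 0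

/-- `G(t) = ∑ₙ Δⁿ (T - t)²ⁿ / (2n)!`. -/
def G (D : Matrix (Fin d) (Fin d) ℝ) (T t : ℝ) : Matrix (Fin d) (Fin d) ℝ :=
  ∑' n : ℕ, ((T - t) ^ (2 * n) / ((2 * n).factorial : ℝ)) • D ^ n

/-- The derivative of `G` in `t`, entry by entry. -/
def Gdot (D : Matrix (Fin d) (Fin d) ℝ) (T t : ℝ) : Matrix (Fin d) (Fin d) ℝ :=
  Matrix.of fun i j => deriv (fun u => G D T u i j) t

/-- `Δ G(t) - (δ / 2) G'(t)` with `Δ = B + (δ² / 4) I`. -/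
def weight (δ : ℝ) (B : Matrix (Fin d) (Fin d) ℝ) (T t : ℝ) : Matrix (Fin d) (Fin d) ℝ :=
  shifted δ B * G (shifted δ B) T t - (δ / 2) • Gdot (shifted δ B) T t

/-- `F(t) = -(Δ G(t) - (δ / 2) G'(t))⁻¹ B G'(t)`. -/
def F (δ : ℝ) (B : Matrix (Fin d) (Fin d) ℝ) (T t : ℝ) : Matrix (Fin d) (Fin d) ℝ :=
  -((weight δ B T t)⁻¹ * B * Gdot (shifted δ B) T t)

/-- `∫_s^t F(u) du`, entry by entry. -/
def intF (δ : ℝ) (B : Matrix (Fin d) (Fin d) ℝ) (T s t : ℝ) : Matrix (Fin d) (Fin d) ℝ :=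
  Matrix.of fun i j => ∫ u in s..t, F δ B T u i j

variable {Ω : Type*} [mΩ : MeasurableSpace Ω] {T : ℝ≥0∞}

/-- `x` is a progressively measurable version of the infinite-horizon signal
`(R - δ/2) E[∫_t^∞ (R + δ/2) e^{-(R + δ/2)(s - t)} ξ_s ds | 𝓕_t]`, where `R = √Δ`. -/
def IsSignalInfinite (P : Measure Ω) (𝓕 : Filtration (Horizon T) mΩ) (δ : ℝ)
    (R : Matrix (Fin d) (Fin d) ℝ) (ξ x : VecProcess T Ω d) : Prop :=
  IsStronglyProgressive 𝓕 x ∧ ∀ t : Horizon T, ∀ᵐ ω ∂P,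
    x t ω = (R - (δ / 2) • (1 : Matrix (Fin d) (Fin d) ℝ)) *ᵥ
      (P[fun ω' => ∫ s in Ici t,
        ((R + (δ / 2) • (1 : Matrix (Fin d) (Fin d) ℝ)) *
          NormedSpace.exp (-(((s : ℝ) - t) • (R + (δ / 2) • (1 : Matrix (Fin d) (Fin d) ℝ)))))
          *ᵥ ξ s ω' | 𝓕 t]) ω

/-- `x` is a progressively measurable version of the finite-horizon signal
`W(t)⁻¹ E[∫_t^T W(s) B e^{-(δ/2)(s - t)} ξ_s ds | 𝓕_t]`, where `W = Δ G - (δ / 2) G'`. -/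
def IsSignalFinite (P : Measure Ω) (𝓕 : Filtration (Horizon T) mΩ) (δ : ℝ)
    (B : Matrix (Fin d) (Fin d) ℝ) (ξ x : VecProcess T Ω d) : Prop :=
  IsStronglyProgressive 𝓕 x ∧ ∀ t : Horizon T, ∀ᵐ ω ∂P,
    x t ω = (weight δ B T.toReal t)⁻¹ *ᵥ
      (P[fun ω' => ∫ s in Ici t,
        Real.exp (-(δ / 2) * ((s : ℝ) - t)) • ((weight δ B T.toReal s * B) *ᵥ ξ s ω') | 𝓕 t]) ω

/-- `∫_0^t e^{-(R - δ/2)(t - s)} x_s ds`. -/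
def strategyInfinite (δ : ℝ) (R : Matrix (Fin d) (Fin d) ℝ) (x : VecProcess T Ω d) :
    VecProcess T Ω d :=
  fun t ω => ∫ s in Iic t,
    NormedSpace.exp (-(((t : ℝ) - s) • (R - (δ / 2) • (1 : Matrix (Fin d) (Fin d) ℝ)))) *ᵥ x s ω

/-- `∫_0^t e^{-∫_s^t F(u) du} x_s ds`. -/
def strategyFinite (δ : ℝ) (B : Matrix (Fin d) (Fin d) ℝ) (x : VecProcess T Ω d) :
    VecProcess T Ω d :=
  fun t ω => ∫ s in Iic t, NormedSpace.exp (-(intF δ B T.toReal s t)) *ᵥ x s ω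

end Formulas

end QuadCost

end

noncomputable section

namespace QuadCost

/-! ### The time set as a measure space -/

section Time

variable {T : ℝ≥0∞}

/-! The functional is a concave quadratic in the rate, so optimality rests on one identity. If `φ'`
is the rate of a solution of the FBSDE and `r` is admissible, then `J(r) = J(φ') - loss(r - φ')`,
where `loss(η)` is the discounted expectation of `(γ/2) ψᵀΣψ + ηᵀΛη` with `ψ = ∫ η`
(`IsSolution.goal_eq`). The square is completed pointwise in `goal_integrand_identity`. The linear
term drops out by `first_order_condition`: up to time `τ` it equals the boundary term `E[e^{-δτ} ψ_τ
φ'_τ]`, coordinate by coordinate. This is zero at a finite `T` by the terminal condition. For `T =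
∞` it converges as `τ → ∞` and is integrable in `τ`, so its limit is zero. Since `Λ` is definite,
zero loss forces `r = φ'` almost everywhere. Hence the optimizers are exactly the rates of
solutions, and any two solutions have almost everywhere equal rates. `IsSolution.unique_of_rate`
sharpens this to equality at each time.

For existence, `B` is similar to a symmetric positive definite matrix (`exists_diagonalization`), so
the system decouples into scalar equations with coefficients `b > 0`. Each is solved by the ansatz
`φ' = x - F φ`, where `F' = F² + δF - b`. With `m' = -F m`, the signal is `x_t = e^{δt} m_t⁻¹ E[∫_t
b e^{-δs} m_s ξ_s ds | 𝓕_t]` and the position is `φ_t = m_t ∫_0^t m_s⁻¹ x_s ds`. The backward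
equation then follows from the product rule and the Riccati equation
(`IsFeedback.martingale_solution`). Both horizons are instances of `IsFeedback`: `F` is constant for
`T = ∞` and a quotient of hyperbolic functions for `T < ∞`. Its decay bound dominates the two
integral operators by an exponential kernel, and Young's inequality puts signal and position into
`L²_δ`.

The filtration need not satisfy the usual conditions, so neither càdlàg versions nor stochastic
integrals are used. Integrals of deterministic functions against martingales are defined by partial
integration and handled by Fubini, and `exists_progressive_condExp` supplies progressive versions of
closed martingales. The closed formulas come back through the functional calculus `f ↦ V diag(f)
V⁻¹`, under which every matrix in the statement becomes a scalar function of the eigenvalues. -/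

lemma measurableSet_horizon (T : ℝ≥0∞) :
    MeasurableSet {t : ℝ | 0 ≤ t ∧ ENNReal.ofReal t ≤ T} :=
  (measurableSet_le measurable_const measurable_id).inter
    (measurableSet_le ENNReal.measurable_ofReal measurable_const)

lemma measurableEmbedding_val (T : ℝ≥0∞) :
    MeasurableEmbedding (Subtype.val : Horizon T → ℝ) :=
  MeasurableEmbedding.subtype_coe (measurableSet_horizon T)

lemma map_val_volume (T : ℝ≥0∞) :
    Measure.map Subtype.val (volume : Measure (Horizon T)) =
      volume.restrict {t : ℝ | 0 ≤ t ∧ ENNReal.ofReal t ≤ T} := by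
  have := (measurableEmbedding_val T).map_comap (volume : Measure ℝ)
  rw [Subtype.range_coe_subtype] at this
  exact this

lemma volume_horizon_eq (s : Set (Horizon T)) :
    volume s = volume (Subtype.val '' s : Set ℝ) :=
  (measurableEmbedding_val T).comap_apply _ _

lemma volume_Iic_lt_top (t : Horizon T) : volume (Iic t) < ∞ := by
  rw [volume_horizon_eq]
  refine (measure_mono (t := Icc (0 : ℝ) t) ?_).trans_lt (by simp)
  rintro _ ⟨s, hs, rfl⟩
  exact ⟨s.2.1, hs⟩

instance : NullSingletonClass (volume : Measure (Horizon T)) where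
  measure_singleton t := by rw [volume_horizon_eq]; simp

lemma val_clamp {x : ℝ} (h : 0 ≤ x) (h' : ENNReal.ofReal x ≤ T) : (clamp T x : ℝ) = x := by
  simp [clamp, h, h']

lemma clamp_val (t : Horizon T) : clamp T (t : ℝ) = t :=
  Subtype.ext (val_clamp t.2.1 t.2.2)

lemma clamp_mono : Monotone (clamp T) := by
  intro x y hxy
  unfold clamp
  split_ifs with h1 h2 h3 h4 h5 h6 h7
  · exact hxy
  · rw [Subtype.mk_le_mk]
    exact (ENNReal.ofReal_le_iff_le_toReal (by rintro rfl; simp at h4)).1 h2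
  · linarith
  · exfalso; exact h2 ((ENNReal.ofReal_le_ofReal hxy).trans h6)
  · exact le_rfl
  · linarith
  all_goals exact bot_le

/-- The times `clamp T n` exhaust both kinds of horizon: they are eventually `T` if `T < ∞`, and
equal to `n` if `T = ∞`. Localization therefore needs no case distinction. -/
lemma exists_le_clamp (t : Horizon T) : ∃ n : ℕ, t ≤ clamp T n := by
  obtain ⟨n, hn⟩ := exists_nat_ge (t : ℝ)
  exact ⟨n, (clamp_val t).symm.le.trans (clamp_mono hn)⟩

lemma iUnion_Iic_clamp : (⋃ n : ℕ, Iic (clamp T n)) = univ :=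
  eq_univ_of_forall fun t => mem_iUnion.2 (exists_le_clamp t)

instance : SigmaFinite (volume : Measure (Horizon T)) :=
  ⟨⟨{ set := fun n : ℕ => Iic (clamp T n)
      set_mem := fun _ => trivial
      finite := fun _ => volume_Iic_lt_top _
      spanning := iUnion_Iic_clamp }⟩⟩

instance (t : Horizon T) : IsFiniteMeasure ((volume : Measure (Horizon T)).restrict (Iic t)) :=
  ⟨by simpa using volume_Iic_lt_top t⟩

/-- A Lebesgue integral over an interval of the time set is one over an interval of reals. -/
lemma setIntegral_Ioc_horizon {s t : Horizon T} (hst : s ≤ t) (f : ℝ → ℝ) :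
    ∫ u in Ioc s t, f u = ∫ u in (s : ℝ)..t, f u := by
  have h1 : Ioc s t = Subtype.val ⁻¹' (Ioc (s : ℝ) t) := rfl
  rw [h1, ← (measurableEmbedding_val T).setIntegral_map, map_val_volume,
    Measure.restrict_restrict measurableSet_Ioc, intervalIntegral.integral_of_le hst]
  congr 2
  refine inter_eq_left.2 fun u hu => ⟨s.2.1.trans hu.1.le, ?_⟩
  exact (ENNReal.ofReal_le_ofReal hu.2).trans t.2.2

lemma integral_Ioc_deriv {s t : Horizon T} (hst : s ≤ t) {w w' : ℝ → ℝ}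
    (hw : ∀ u ∈ Icc (s : ℝ) t, HasDerivAt w (w' u) u) (hw' : ContinuousOn w' (Icc (s : ℝ) t)) :
    ∫ u in Ioc s t, w' u = w t - w s := by
  have h : (s : ℝ) ≤ t := hst
  rw [setIntegral_Ioc_horizon hst, intervalIntegral.integral_eq_sub_of_hasDerivAt]
  · rwa [uIcc_of_le h]
  · exact ContinuousOn.intervalIntegrable (by rwa [uIcc_of_le h])

lemma setIntegral_Iic_eq_add {E : Type*} [NormedAddCommGroup E] [NormedSpace ℝ E]
    {s t : Horizon T} (hst : s ≤ t) {q : Horizon T → E}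
    (hq : IntegrableOn q (Iic t)) :
    ∫ u in Iic t, q u = (∫ u in Iic s, q u) + ∫ u in Ioc s t, q u := by
  rw [← Iic_union_Ioc_eq_Iic hst, setIntegral_union (Iic_disjoint_Ioc le_rfl) measurableSet_Ioc
    (hq.mono_set (Iic_subset_Iic.2 hst)) (hq.mono_set Ioc_subset_Iic_self)]

lemma Iic_bot_horizon : Iic (⊥ : Horizon T) = {⊥} := by ext; simp

lemma setIntegral_Iic_bot {E : Type*} [NormedAddCommGroup E] [NormedSpace ℝ E]
    (q : Horizon T → E) : ∫ u in Iic (⊥ : Horizon T), q u = 0 := by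
  rw [Iic_bot_horizon]; simp

lemma integral_Iic_deriv (t : Horizon T) {w w' : ℝ → ℝ}
    (hw : ∀ u ∈ Icc (0 : ℝ) t, HasDerivAt w (w' u) u) (hw' : ContinuousOn w' (Icc (0 : ℝ) t)) :
    ∫ u in Iic t, w' u = w t - w 0 := by
  have h := integral_Ioc_deriv (s := ⊥) (t := t) bot_le (w := w) (w' := w') hw hw'
  have h2 : ∫ u in Iic t, w' u = ∫ u in Ioc ⊥ t, w' u := by
    refine setIntegral_congr_set ?_
    rw [← Iic_union_Ioc_eq_Iic (bot_le : ⊥ ≤ t), Iic_bot_horizon]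
    refine union_ae_eq_right_of_ae_eq_empty ?_
    exact ae_eq_empty.2 (measure_singleton _)
  rw [h2, h]
  rfl

lemma measurable_val : Measurable (Subtype.val : Horizon T → ℝ) := measurable_subtype_coe

/-- A deterministic continuous function is integrable up to any time. -/
lemma integrableOn_Iic_of_continuousOn (t : Horizon T) {w : ℝ → ℝ}
    (hw : ContinuousOn w (Icc (0 : ℝ) t)) :
    IntegrableOn (fun u : Horizon T => w u) (Iic t) := by
  have h0 : Subtype.val ⁻¹' (Icc (0 : ℝ) t) = Iic t := by
    ext u; exact ⟨fun h => h.2, fun h => ⟨u.2.1, h⟩⟩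
  have h : IntegrableOn w (Icc (0 : ℝ) t) (Measure.map Subtype.val (volume : Measure (Horizon T))) := by
    rw [map_val_volume]
    exact (hw.integrableOn_compact isCompact_Icc).mono_measure Measure.restrict_le_self
  rw [(measurableEmbedding_val T).integrableOn_map_iff, h0] at h
  exact h

/-! ### Product rule for primitives -/

/-- The product rule for two primitives, from Fubini's theorem. -/
lemma primitive_mul_primitive (t : Horizon T) {p q : Horizon T → ℝ}
    (hp : IntegrableOn p (Iic t)) (hq : IntegrableOn q (Iic t)) :
    (∫ s in Iic t, p s) * (∫ s in Iic t, q s) =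
      ∫ s in Iic t, (p s * (∫ u in Iic s, q u) + (∫ u in Iic s, p u) * q s) ∧
    IntegrableOn (fun s => p s * (∫ u in Iic s, q u) + (∫ u in Iic s, p u) * q s) (Iic t) := by
  set m := (volume : Measure (Horizon T)).restrict (Iic t) with hm
  have hpq : Integrable (fun z : Horizon T × Horizon T => p z.1 * q z.2) (m.prod m) :=
    Integrable.mul_prod hp hq
  -- The square `[0,t]²` is cut along the diagonal. The closed lower triangle yields one term of the
  -- product rule and the open upper triangle the other; the diagonal does not matter because points
  -- are null.
  have hA : MeasurableSet {z : Horizon T × Horizon T | z.2 ≤ z.1} :=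
    measurableSet_le measurable_snd measurable_fst
  have hfst : ∀ s ∈ Iic t, ∫ u, {z : Horizon T × Horizon T | z.2 ≤ z.1}.indicator
      (fun z => p z.1 * q z.2) (s, u) ∂m = p s * ∫ u in Iic s, q u := by
    intro s hs
    have : (fun u => {z : Horizon T × Horizon T | z.2 ≤ z.1}.indicator
        (fun z => p z.1 * q z.2) (s, u)) = (Iic s).indicator (fun u => p s * q u) := by
      ext u; simp [indicator]
    rw [this, integral_indicator measurableSet_Iic, hm, Measure.restrict_restrict measurableSet_Iic,
      Iic_inter_Iic, inf_eq_left.2 hs, integral_const_mul]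
  have hsnd : ∀ u ∈ Iic t, ∫ s, {z : Horizon T × Horizon T | z.2 ≤ z.1}ᶜ.indicator
      (fun z => p z.1 * q z.2) (s, u) ∂m = (∫ s in Iic u, p s) * q u := by
    intro u hu
    have : (fun s => {z : Horizon T × Horizon T | z.2 ≤ z.1}ᶜ.indicator
        (fun z => p z.1 * q z.2) (s, u)) = (Iio u).indicator (fun s => p s * q u) := by
      ext s; simp [indicator]
    rw [this, integral_indicator measurableSet_Iio, hm, Measure.restrict_restrict measurableSet_Iio,
      inter_eq_left.2 (Iio_subset_Iic_self.trans (Iic_subset_Iic.2 hu)), integral_mul_const,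
      integral_Iic_eq_integral_Iio]
  have h1 := hpq.indicator hA
  have h2 := hpq.indicator hA.compl
  have i1 : IntegrableOn (fun s => p s * (∫ u in Iic s, q u)) (Iic t) := by
    refine (h1.integral_prod_left).congr ?_
    filter_upwards [ae_restrict_mem measurableSet_Iic] with s hs using hfst s hs
  have i2 : IntegrableOn (fun s => (∫ u in Iic s, p u) * q s) (Iic t) := by
    refine (h2.integral_prod_right).congr ?_
    filter_upwards [ae_restrict_mem measurableSet_Iic] with s hs using hsnd s hs
  refine ⟨?_, i1.add i2⟩
  rw [integral_add i1 i2, ← integral_prod_mul, ← setIntegral_congr_fun measurableSet_Iic hfst,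
    ← setIntegral_congr_fun measurableSet_Iic hsnd, ← integral_prod _ h1,
    ← integral_prod_symm _ h2, ← integral_add h1 h2]
  congr 1
  ext z
  exact (congrFun (indicator_self_add_compl {z : Horizon T × Horizon T | z.2 ≤ z.1}
    (fun z => p z.1 * q z.2)) z).symm

/-- The product rule for absolutely continuous functions on the time set. -/
lemma absolutelyContinuous_mul (t : Horizon T) {p q f g : Horizon T → ℝ} {f0 g0 : ℝ}
    (hp : IntegrableOn p (Iic t)) (hq : IntegrableOn q (Iic t))
    (hf : ∀ s ≤ t, f s = f0 + ∫ u in Iic s, p u) (hg : ∀ s ≤ t, g s = g0 + ∫ u in Iic s, q u) :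
    f t * g t = f0 * g0 + ∫ s in Iic t, (p s * g s + f s * q s) ∧
    IntegrableOn (fun s => p s * g s + f s * q s) (Iic t) := by
  obtain ⟨h1, h2⟩ := primitive_mul_primitive t hp hq
  have e : ∀ s ∈ Iic t, p s * g s + f s * q s = (g0 * p s + f0 * q s) +
      (p s * (∫ u in Iic s, q u) + (∫ u in Iic s, p u) * q s) := by
    intro s hs; rw [hf s hs, hg s hs]; ring
  have i3 : IntegrableOn (fun s => g0 * p s + f0 * q s) (Iic t) :=
    (hp.const_mul g0).add (hq.const_mul f0)
  have i4 : IntegrableOn (fun s => (g0 * p s + f0 * q s) +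
      (p s * (∫ u in Iic s, q u) + (∫ u in Iic s, p u) * q s)) (Iic t) := i3.add h2
  refine ⟨?_, i4.congr_fun (fun s hs => (e s hs).symm) measurableSet_Iic⟩
  rw [setIntegral_congr_fun measurableSet_Iic e, integral_add i3 h2, ← h1]
  rw [show (∫ s in Iic t, (g0 * p s + f0 * q s)) = g0 * (∫ s in Iic t, p s)
      + f0 * ∫ s in Iic t, q s by
    rw [integral_add (hp.const_mul g0) (hq.const_mul f0), integral_const_mul, integral_const_mul]]
  rw [hf t le_rfl, hg t le_rfl]; ring

end Time

/-! ### Progressive processes -/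

section Progressive

variable {T : ℝ≥0∞} {Ω : Type*}

/-- The upper limit is moved into an indicator and the time variable is truncated to `min s i`. Only
values of `r` on `[0,i]` then enter, and measurability of parameter integrals applies. Used with `𝓕
i` as the sigma-algebra, this makes primitives progressive. -/
lemma stronglyMeasurable_primitive [MeasurableSpace Ω] {E : Type*} [NormedAddCommGroup E]
    [NormedSpace ℝ E] (i : Horizon T) {r : Horizon T → Ω → E}
    (hr : StronglyMeasurable fun p : Iic i × Ω => r p.1 p.2) :
    StronglyMeasurable fun p : Iic i × Ω => ∫ s in Iic (p.1 : Horizon T), r s p.2 := by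
  have hmeas : Measurable fun z : (Iic i × Ω) × Horizon T =>
      ((⟨min z.2 i, mem_Iic.2 (min_le_right _ _)⟩, z.1.2) : Iic i × Ω) :=
    ((measurable_snd.min measurable_const).subtype_mk).prodMk (measurable_snd.comp measurable_fst)
  have h1 := hr.comp_measurable hmeas
  have hA : MeasurableSet {z : (Iic i × Ω) × Horizon T | z.2 ≤ (z.1.1 : Horizon T)} :=
    measurableSet_le measurable_snd (measurable_subtype_coe.comp
      (measurable_fst.comp measurable_fst))
  have h2 := (h1.indicator hA).integral_prod_right' (ν := volume)
  convert h2 using 1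
  ext p
  rw [← integral_indicator measurableSet_Iic]
  congr 1
  ext s
  by_cases hs : s ≤ (p.1 : Horizon T)
  · have : min s i = s := min_eq_left (hs.trans p.1.2)
    simp [indicator, hs, this]
  · simp [indicator, hs]

variable [mΩ : MeasurableSpace Ω] {𝓕 : Filtration (Horizon T) mΩ}

lemma progressive_primitive {E : Type*} [NormedAddCommGroup E]
    [NormedSpace ℝ E] {r : Horizon T → Ω → E} (hr : IsStronglyProgressive 𝓕 r) :
    IsStronglyProgressive 𝓕 fun t ω => ∫ s in Iic t, r s ω :=
  fun i => @stronglyMeasurable_primitive T Ω (𝓕 i) E _ _ i r (hr i)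

/-- Joint measurability on the whole time set, needed for every use of Fubini: the process is the
pointwise limit of its stopped versions at the times `clamp T n`. -/
lemma progressive_stronglyMeasurable {E : Type*} [NormedAddCommGroup E]
    {X : Horizon T → Ω → E} (hX : IsStronglyProgressive 𝓕 X) :
    StronglyMeasurable fun p : Horizon T × Ω => X p.1 p.2 := by
  refine stronglyMeasurable_of_tendsto Filter.atTop
    (f := fun (n : ℕ) (p : Horizon T × Ω) => X (min p.1 (clamp T n)) p.2) (fun n => ?_) ?_
  · have h : StronglyMeasurable fun p : Iic (clamp T n) × Ω => X p.1 p.2 :=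
      (hX (clamp T n)).mono (sup_le_sup le_rfl (MeasurableSpace.comap_mono (𝓕.le _)))
    exact h.comp_measurable (g := fun p : Horizon T × Ω =>
      ((⟨min p.1 (clamp T n), mem_Iic.2 (min_le_right _ _)⟩, p.2) : Iic (clamp T n) × Ω))
      (((measurable_fst.min measurable_const).subtype_mk).prodMk measurable_snd)
  · rw [tendsto_pi_nhds]
    intro p
    obtain ⟨n, hn⟩ := exists_le_clamp p.1
    refine tendsto_atTop_of_eventually_const (i₀ := n) fun k hk => ?_
    rw [min_eq_left (hn.trans (clamp_mono (by exact_mod_cast hk)))]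

lemma progressive_time {w : ℝ → ℝ} (hw : Measurable w) :
    IsStronglyProgressive 𝓕 fun (t : Horizon T) (_ : Ω) => w t := by
  intro i
  refine Measurable.stronglyMeasurable ?_
  exact hw.comp (measurable_subtype_coe.comp (measurable_subtype_coe.comp measurable_fst))

lemma progressive_clm {E E' : Type*} [NormedAddCommGroup E] [NormedSpace ℝ E]
    [NormedAddCommGroup E'] [NormedSpace ℝ E'] (A : E →L[ℝ] E') {X : Horizon T → Ω → E}
    (hX : IsStronglyProgressive 𝓕 X) : IsStronglyProgressive 𝓕 fun t ω => A (X t ω) :=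
  fun i => A.continuous.comp_stronglyMeasurable (hX i)

lemma stronglyMeasurable_of_coordinates {α : Type*} [MeasurableSpace α] {d : ℕ}
    {f : α → Fin d → ℝ} (h : ∀ i, StronglyMeasurable fun a => f a i) : StronglyMeasurable f :=
  (measurable_pi_iff.2 fun i => (h i).measurable).stronglyMeasurable

lemma progressive_pi_iff {d : ℕ} {X : VecProcess T Ω d} :
    IsStronglyProgressive 𝓕 X ↔ ∀ i, IsStronglyProgressive 𝓕 fun t ω => X t ω i := by
  refine ⟨fun h i => progressive_clm (ContinuousLinearMap.proj (R := ℝ) i) h, fun h t => ?_⟩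
  exact @stronglyMeasurable_of_coordinates _ (Subtype.instMeasurableSpace.prod (𝓕 t)) _ _
    fun i => h i t

end Progressive

/-! ### Square integrability -/

section SquareIntegrable

variable {α : Type*} [MeasurableSpace α] {m : Measure α}

lemma lintegral_mul_sq_le {f g : α → ℝ≥0∞} (hf : AEMeasurable f m) (hg : AEMeasurable g m) :
    (∫⁻ a, f a * g a ∂m) ^ 2 ≤ (∫⁻ a, f a ^ 2 ∂m) * ∫⁻ a, g a ^ 2 ∂m := by
  have h := ENNReal.lintegral_mul_le_Lp_mul_Lq m Real.HolderConjugate.two_two hf hg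
  have e : ∀ x : ℝ≥0∞, x ^ (2 : ℝ) = x ^ 2 := fun x => by
    rw [← ENNReal.rpow_natCast]; norm_num
  simp only [e, Pi.mul_apply] at h
  calc _ ≤ _ := pow_le_pow_left₀ (zero_le) h 2
    _ = _ := by
      rw [mul_pow, ← ENNReal.rpow_natCast, ← ENNReal.rpow_natCast, ← ENNReal.rpow_mul,
        ← ENNReal.rpow_mul]
      norm_num

lemma memLp_two_iff_lintegral {f : α → ℝ} (hf : AEStronglyMeasurable f m) :
    MemLp f 2 m ↔ ∫⁻ a, ‖f a‖ₑ ^ 2 ∂m < ∞ := by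
  rw [MemLp, and_iff_right hf, eLpNorm_lt_top_iff_lintegral_rpow_enorm_lt_top two_ne_zero
    ENNReal.ofNat_ne_top]
  have e : ∀ x : ℝ≥0∞, x ^ (2 : ℝ) = x ^ 2 := fun x => by
    rw [← ENNReal.rpow_natCast]; norm_num
  simp [e]

lemma enorm_sq_eq_ofReal (x : ℝ) : ‖x‖ₑ ^ 2 = ENNReal.ofReal (x ^ 2) := by
  rw [Real.enorm_eq_ofReal_abs, ← ENNReal.ofReal_pow (abs_nonneg x), sq_abs]

lemma lintegral_enorm_sq_eq {f : α → ℝ} (hf : MemLp f 2 m) :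
    ∫⁻ a, ‖f a‖ₑ ^ 2 ∂m = ENNReal.ofReal (∫ a, f a ^ 2 ∂m) := by
  rw [ofReal_integral_eq_lintegral_ofReal hf.integrable_sq (.of_forall fun a => sq_nonneg _)]
  simp only [enorm_sq_eq_ofReal]

end SquareIntegrable

/-! ### Discounted square integrable scalar processes -/

section ScalarSpace

variable {T : ℝ≥0∞} {Ω : Type*} [mΩ : MeasurableSpace Ω]

/-- The scalar version of `L²_δ`, with integrability expressed on the product space. -/
structure ScalarL2 (P : Measure Ω) (𝓕 : Filtration (Horizon T) mΩ) (δ : ℝ)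
    (X : Horizon T → Ω → ℝ) : Prop where
  progressive : IsStronglyProgressive 𝓕 X
  memLp : MemLp (fun p : Horizon T × Ω => Real.exp (-(δ / 2) * p.1) * X p.1 p.2) 2
    ((volume : Measure (Horizon T)).prod P)

variable {P : Measure Ω} {𝓕 : Filtration (Horizon T) mΩ} {δ : ℝ} {X Y : Horizon T → Ω → ℝ}

lemma measurable_exp_time (c : ℝ) :
    Measurable fun p : Horizon T × Ω => Real.exp (c * (p.1 : ℝ)) := by fun_prop

lemma exp_half_sq (δ t x : ℝ) :
    (Real.exp (-(δ / 2) * t) * x) ^ 2 = Real.exp (-δ * t) * x ^ 2 := by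
  rw [mul_pow, ← Real.exp_nat_mul]; congr 2; push_cast; ring

lemma exp_half_mul (δ t x y : ℝ) :
    (Real.exp (-(δ / 2) * t) * x) * (Real.exp (-(δ / 2) * t) * y) =
      Real.exp (-δ * t) * (x * y) := by
  rw [mul_mul_mul_comm, ← Real.exp_add]; congr 2; ring

lemma discounted_aestronglyMeasurable (hX : IsStronglyProgressive 𝓕 X) :
    AEStronglyMeasurable (fun p : Horizon T × Ω => Real.exp (-(δ / 2) * p.1) * X p.1 p.2)
      ((volume : Measure (Horizon T)).prod P) :=
  ((measurable_exp_time _).stronglyMeasurable.mul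
    (progressive_stronglyMeasurable hX)).aestronglyMeasurable

lemma scalarL2_iff_lintegral [SFinite P] (hX : IsStronglyProgressive 𝓕 X) :
    ScalarL2 P 𝓕 δ X ↔
      ∫⁻ ω, (∫⁻ t : Horizon T, ENNReal.ofReal (Real.exp (-δ * t) * X t ω ^ 2)) ∂P < ∞ := by
  have hm : Measurable fun p : Horizon T × Ω =>
      ENNReal.ofReal (Real.exp (-δ * p.1) * X p.1 p.2 ^ 2) :=
    ENNReal.measurable_ofReal.comp
      ((measurable_exp_time _).mul ((progressive_stronglyMeasurable hX).measurable.pow_const 2))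
  have h := memLp_two_iff_lintegral (discounted_aestronglyMeasurable (P := P) (δ := δ) hX)
  simp only [enorm_sq_eq_ofReal, exp_half_sq] at h
  rw [lintegral_prod_symm' _ hm] at h
  exact ⟨fun H => h.1 H.2, fun H => ⟨hX, h.2 H⟩⟩

lemma ScalarL2.add (hX : ScalarL2 P 𝓕 δ X) (hY : ScalarL2 P 𝓕 δ Y) :
    ScalarL2 P 𝓕 δ fun t ω => X t ω + Y t ω := by
  refine ⟨hX.1.add hY.1, (hX.2.add hY.2).ae_eq (.of_forall fun p => ?_)⟩
  simp only [Pi.add_apply]; ring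

lemma ScalarL2.mul_bounded (hX : ScalarL2 P 𝓕 δ X) {w : ℝ → ℝ} (hw : Measurable w) {C : ℝ}
    (hC : ∀ t : Horizon T, |w t| ≤ C) : ScalarL2 P 𝓕 δ fun t ω => w t * X t ω := by
  refine ⟨(progressive_time hw).mul hX.1, ?_⟩
  refine (hX.2.const_mul C).mono
    (discounted_aestronglyMeasurable ((progressive_time hw).mul hX.1)) (.of_forall fun p => ?_)
  have h := hC p.1
  simp only [norm_mul, Real.norm_eq_abs]
  have hC' : |w p.1| ≤ |C| := h.trans (le_abs_self C)
  have : 0 ≤ |Real.exp (-(δ / 2) * p.1)| * |X p.1 p.2| := by positivity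
  nlinarith

lemma ScalarL2.const_mul (hX : ScalarL2 P 𝓕 δ X) (c : ℝ) :
    ScalarL2 P 𝓕 δ fun t ω => c * X t ω :=
  hX.mul_bounded (w := fun _ => c) measurable_const (C := |c|) fun _ => le_rfl

lemma ScalarL2.sub (hX : ScalarL2 P 𝓕 δ X) (hY : ScalarL2 P 𝓕 δ Y) :
    ScalarL2 P 𝓕 δ fun t ω => X t ω - Y t ω := by
  have := hX.add (hY.const_mul (-1))
  simpa [sub_eq_add_neg] using this

lemma scalarL2_zero : ScalarL2 P 𝓕 δ fun _ _ => 0 :=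
  ⟨isStronglyProgressive_const _ _, by simp⟩

lemma scalarL2_sum {ι : Type*} (s : Finset ι) {Z : ι → Horizon T → Ω → ℝ}
    (h : ∀ i ∈ s, ScalarL2 P 𝓕 δ (Z i)) : ScalarL2 P 𝓕 δ fun t ω => ∑ i ∈ s, Z i t ω := by
  classical
  induction s using Finset.induction_on with
  | empty => simpa using scalarL2_zero
  | insert a s ha ih =>
    simp only [Finset.sum_insert ha]
    exact (h a (by simp)).add (ih fun i hi => h i (by simp [hi]))

lemma ScalarL2.congr_ae (hX : ScalarL2 P 𝓕 δ X) (hY : IsStronglyProgressive 𝓕 Y)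
    (h : ∀ᵐ p ∂((volume : Measure (Horizon T)).prod P), X p.1 p.2 = Y p.1 p.2) :
    ScalarL2 P 𝓕 δ Y := by
  refine ⟨hY, hX.2.ae_eq ?_⟩
  filter_upwards [h] with p hp
  rw [hp]

lemma ScalarL2.integrable_mul (hX : ScalarL2 P 𝓕 δ X) (hY : ScalarL2 P 𝓕 δ Y) :
    Integrable (fun p : Horizon T × Ω => Real.exp (-δ * p.1) * (X p.1 p.2 * Y p.1 p.2))
      ((volume : Measure (Horizon T)).prod P) := by
  have := hX.2.integrable_mul hY.2
  refine this.congr (.of_forall fun p => ?_)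
  simp only [Pi.mul_apply, exp_half_mul]

lemma memL2_iff_scalar [SFinite P] {d : ℕ} {X : VecProcess T Ω d} :
    MemL2 P 𝓕 δ X ↔ ∀ i, ScalarL2 P 𝓕 δ fun t ω => X t ω i := by
  constructor
  · intro h i
    have hp := progressive_pi_iff.1 h.progressive i
    rw [scalarL2_iff_lintegral hp]
    refine lt_of_le_of_lt ?_ h.finite
    refine lintegral_mono fun ω => lintegral_mono fun t => ENNReal.ofReal_le_ofReal
      (mul_le_mul_of_nonneg_left ?_ (Real.exp_nonneg _))
    rw [← sq_abs]
    exact pow_le_pow_left₀ (abs_nonneg _) (norm_le_pi_norm (X t ω) i) 2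
  · intro h
    have hp : IsStronglyProgressive 𝓕 X := progressive_pi_iff.2 fun i => (h i).progressive
    refine ⟨hp, ?_⟩
    have hb : ∀ (t : Horizon T) (ω : Ω), ENNReal.ofReal (Real.exp (-δ * t) * ‖X t ω‖ ^ 2) ≤
        ∑ i, ENNReal.ofReal (Real.exp (-δ * t) * X t ω i ^ 2) := by
      intro t ω
      rw [← ENNReal.ofReal_sum_of_nonneg (fun i _ => by positivity), ← Finset.mul_sum]
      refine ENNReal.ofReal_le_ofReal (mul_le_mul_of_nonneg_left ?_ (Real.exp_nonneg _))
      have h0 : 0 ≤ ∑ i, X t ω i ^ 2 := Finset.sum_nonneg fun i _ => sq_nonneg _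
      have : ‖X t ω‖ ≤ √(∑ i, X t ω i ^ 2) := by
        refine (pi_norm_le_iff_of_nonneg (Real.sqrt_nonneg _)).2 fun i => ?_
        rw [Real.norm_eq_abs]
        refine Real.abs_le_sqrt (Finset.single_le_sum (f := fun i => X t ω i ^ 2)
          (fun i _ => sq_nonneg _) (Finset.mem_univ i))
      calc ‖X t ω‖ ^ 2 ≤ √(∑ i, X t ω i ^ 2) ^ 2 := pow_le_pow_left₀ (norm_nonneg _) this 2
        _ = _ := Real.sq_sqrt h0
    have hm : ∀ i, Measurable fun p : Horizon T × Ω =>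
        ENNReal.ofReal (Real.exp (-δ * p.1) * X p.1 p.2 i ^ 2) := fun i =>
      ENNReal.measurable_ofReal.comp ((measurable_exp_time _).mul
        ((progressive_stronglyMeasurable (h i).progressive).measurable.pow_const 2))
    calc _ ≤ ∫⁻ ω, (∫⁻ t : Horizon T, ∑ i, ENNReal.ofReal (Real.exp (-δ * t) * X t ω i ^ 2)) ∂P :=
          lintegral_mono fun ω => lintegral_mono fun t => hb t ω
      _ = ∑ i, ∫⁻ ω, (∫⁻ t : Horizon T, ENNReal.ofReal (Real.exp (-δ * t) * X t ω i ^ 2)) ∂P := by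
          rw [← lintegral_finsetSum _ (fun i _ => (hm i).lintegral_prod_left')]
          refine lintegral_congr fun ω => ?_
          exact lintegral_finsetSum _ (fun i _ => (hm i).comp measurable_prodMk_right)
      _ < ∞ := ENNReal.sum_lt_top.2 fun i _ =>
          (scalarL2_iff_lintegral (h i).progressive).1 (h i)

/-! ### Local integrability -/

/-- On `[0,t]` the discount factor is bounded below, so it can be removed at the price of the
constant `e^{|δ/2| t}`. -/
lemma ScalarL2.memLp_Iic [SFinite P] (hX : ScalarL2 P 𝓕 δ X) (t : Horizon T) :
    MemLp (fun p : Horizon T × Ω => X p.1 p.2) 2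
      (((volume : Measure (Horizon T)).restrict (Iic t)).prod P) := by
  have hr : ((volume : Measure (Horizon T)).restrict (Iic t)).prod P =
      ((volume : Measure (Horizon T)).prod P).restrict (Iic t ×ˢ univ) := by
    rw [← Measure.prod_restrict, Measure.restrict_univ]
  have h := (hX.2.restrict (Iic t ×ˢ univ)).const_mul (Real.exp (|δ / 2| * t))
  rw [hr]
  refine h.mono (progressive_stronglyMeasurable hX.1).aestronglyMeasurable ?_
  filter_upwards [ae_restrict_mem (measurableSet_Iic.prod MeasurableSet.univ)] with p hp
  have h1 : (p.1 : ℝ) ≤ t := hp.1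
  have h2 : 1 ≤ Real.exp (|δ / 2| * t) * Real.exp (-(δ / 2) * p.1) := by
    rw [← Real.exp_add]
    apply Real.one_le_exp
    have := abs_nonneg (δ / 2)
    have := le_abs_self (δ / 2)
    nlinarith [p.1.2.1]
  rw [← mul_assoc, norm_mul]
  exact le_mul_of_one_le_left (norm_nonneg _) (h2.trans (le_abs_self _))

lemma ScalarL2.integrable_Iic [IsFiniteMeasure P] (hX : ScalarL2 P 𝓕 δ X) (t : Horizon T) :
    Integrable (fun p : Horizon T × Ω => X p.1 p.2)
      (((volume : Measure (Horizon T)).restrict (Iic t)).prod P) :=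
  (hX.memLp_Iic t).integrable one_le_two

lemma ScalarL2.ae_integrableOn [IsFiniteMeasure P] (hX : ScalarL2 P 𝓕 δ X) :
    ∀ᵐ ω ∂P, ∀ t, IntegrableOn (fun s => X s ω) (Iic t) := by
  have h : ∀ᵐ ω ∂P, ∀ n : ℕ, IntegrableOn (fun s => X s ω) (Iic (clamp T n)) :=
    ae_all_iff.2 fun n => (hX.integrable_Iic _).prod_left_ae
  filter_upwards [h] with ω hω t
  obtain ⟨n, hn⟩ := exists_le_clamp t
  exact (hω n).mono_set (Iic_subset_Iic.2 hn)

/-- The exceptional set of paths is chosen before the set of integration. Rates that agree `dt ⊗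
P`-a.e. therefore have indistinguishable primitives. -/
lemma ae_forall_setIntegral_eq {E : Type*} [NormedAddCommGroup E] [NormedSpace ℝ E] [SFinite P]
    {X Y : Horizon T → Ω → E}
    (h : ∀ᵐ p ∂((volume : Measure (Horizon T)).prod P), X p.1 p.2 = Y p.1 p.2) :
    ∀ᵐ ω ∂P, ∀ s : Set (Horizon T), ∫ u in s, X u ω = ∫ u in s, Y u ω := by
  have h' : ∀ᵐ ω ∂P, ∀ᵐ t : Horizon T, X t ω = Y t ω := by
    have := (Measure.measurePreserving_swap (μ := P) (ν := (volume : Measure (Horizon T)))).quasiMeasurePreserving.ae h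
    exact Measure.ae_ae_of_ae_prod this
  filter_upwards [h'] with ω hω s
  exact integral_congr_ae (ae_restrict_of_ae hω)

lemma ScalarL2.ae_memLp [SFinite P] (hX : ScalarL2 P 𝓕 δ X) :
    ∀ᵐ t : Horizon T, MemLp (X t) 2 P := by
  have h := hX.2.integrable_sq.prod_right_ae
  filter_upwards [h] with t ht
  have hm : AEStronglyMeasurable (X t) P :=
    ((progressive_stronglyMeasurable hX.1).comp_measurable
      measurable_prodMk_left).aestronglyMeasurable
  rw [memLp_two_iff_integrable_sq hm]
  refine (ht.const_mul (Real.exp (δ * t))).congr (.of_forall fun ω => ?_)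
  simp only [exp_half_sq]
  rw [← mul_assoc, ← Real.exp_add]
  simp

/-- Cauchy-Schwarz on the finite interval `[0,t]`, path by path, followed by Tonelli. -/
lemma memLp_primitive [SFinite P] (hX : IsStronglyProgressive 𝓕 X) (t : Horizon T)
    (hX2 : MemLp (fun p : Horizon T × Ω => X p.1 p.2) 2
      (((volume : Measure (Horizon T)).restrict (Iic t)).prod P)) :
    MemLp (fun ω => ∫ s in Iic t, X s ω) 2 P := by
  have hm := progressive_stronglyMeasurable hX
  have hm2 := progressive_stronglyMeasurable (progressive_primitive hX)
  have hm' : AEStronglyMeasurable (fun ω => ∫ s in Iic t, X s ω) P :=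
    (hm2.comp_measurable measurable_prodMk_left).aestronglyMeasurable
  rw [memLp_two_iff_lintegral hm']
  have hb : ∀ ω, ‖∫ s in Iic t, X s ω‖ₑ ^ 2 ≤
      (∫⁻ s in Iic t, ‖X s ω‖ₑ ^ 2) * volume (Iic t) := by
    intro ω
    calc _ ≤ (∫⁻ s in Iic t, ‖X s ω‖ₑ * 1) ^ 2 := by
          simpa using pow_le_pow_left₀ (zero_le)
            (enorm_integral_le_lintegral_enorm (fun s => X s ω)) 2
      _ ≤ _ := lintegral_mul_sq_le
          ((hm.comp_measurable measurable_prodMk_right).measurable.enorm.aemeasurable)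
          aemeasurable_const
      _ = _ := by simp
  calc _ ≤ ∫⁻ ω, (∫⁻ s in Iic t, ‖X s ω‖ₑ ^ 2) * volume (Iic t) ∂P := lintegral_mono hb
    _ = (∫⁻ ω, (∫⁻ s in Iic t, ‖X s ω‖ₑ ^ 2) ∂P) * volume (Iic t) :=
        lintegral_mul_const _ (hm.measurable.enorm.pow_const 2).lintegral_prod_left'
    _ < ∞ := by
      refine ENNReal.mul_lt_top ?_ (volume_Iic_lt_top t)
      rw [← lintegral_prod_symm' _ (hm.measurable.enorm.pow_const 2)]
      exact (memLp_two_iff_lintegral hm.aestronglyMeasurable).1 hX2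

lemma ScalarL2.memLp_primitive [SFinite P] (hX : ScalarL2 P 𝓕 δ X) (t : Horizon T) :
    MemLp (fun ω => ∫ s in Iic t, X s ω) 2 P :=
  QuadCost.memLp_primitive hX.1 t (hX.memLp_Iic t)

end ScalarSpace

/-! ### Square integrable martingales -/

section Martingales

variable {T : ℝ≥0∞} {Ω : Type*} [mΩ : MeasurableSpace Ω] {P : Measure Ω} [IsProbabilityMeasure P]
  {𝓕 : Filtration (Horizon T) mΩ} {N : Horizon T → Ω → ℝ} {δ : ℝ}

lemma martingale_integral_mul (hN : Martingale N 𝓕 P) (hN2 : ∀ t, MemLp (N t) 2 P)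
    {s t : Horizon T} (hst : s ≤ t) {χ : Ω → ℝ} (hχ : StronglyMeasurable[𝓕 s] χ)
    (hχ2 : MemLp χ 2 P) : ∫ ω, χ ω * N t ω ∂P = ∫ ω, χ ω * N s ω ∂P := by
  have h := condExp_mul_of_stronglyMeasurable_left hχ (hχ2.integrable_mul (hN2 t))
    ((hN2 t).integrable one_le_two)
  have h2 : P[χ * N t | 𝓕 s] =ᵐ[P] χ * N s :=
    h.trans (Filter.EventuallyEq.rfl.mul (hN.2 s t hst))
  calc _ = ∫ ω, (P[χ * N t | 𝓕 s]) ω ∂P := (integral_condExp (𝓕.le s)).symm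
    _ = _ := integral_congr_ae h2

/-- Orthogonality of martingale increments. Consequently `t ↦ E[N_t²]` is monotone and controls how
far `N` moves in `L²`. -/
lemma martingale_integral_sub_sq (hN : Martingale N 𝓕 P) (hN2 : ∀ t, MemLp (N t) 2 P)
    {s t : Horizon T} (hst : s ≤ t) :
    ∫ ω, (N t ω - N s ω) ^ 2 ∂P = ∫ ω, N t ω ^ 2 ∂P - ∫ ω, N s ω ^ 2 ∂P := by
  have h := martingale_integral_mul hN hN2 hst (hN.1 s) (hN2 s)
  have i1 := (hN2 t).integrable_sq
  have i2 := (hN2 s).integrable_sq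
  have i3 : Integrable (fun ω => N s ω * N t ω) P := (hN2 s).integrable_mul (hN2 t)
  have e : ∀ ω, (N t ω - N s ω) ^ 2 = N t ω ^ 2 - 2 * (N s ω * N t ω) + N s ω ^ 2 :=
    fun ω => by ring
  simp only [e]
  have i4 : Integrable (fun ω => N t ω ^ 2 - 2 * (N s ω * N t ω)) P := i1.sub (i3.const_mul 2)
  rw [integral_add i4 i2, integral_sub i1 (i3.const_mul 2), integral_const_mul, h]
  simp only [← sq]; ring

lemma martingale_integral_sq_mono (hN : Martingale N 𝓕 P) (hN2 : ∀ t, MemLp (N t) 2 P)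
    {s t : Horizon T} (hst : s ≤ t) : ∫ ω, N s ω ^ 2 ∂P ≤ ∫ ω, N t ω ^ 2 ∂P := by
  have h := martingale_integral_sub_sq hN hN2 hst
  have : 0 ≤ ∫ ω, (N t ω - N s ω) ^ 2 ∂P := integral_nonneg fun ω => sq_nonneg _
  linarith

lemma martingale_memLp_Iic (hN : Martingale N 𝓕 P) (hN2 : ∀ t, MemLp (N t) 2 P)
    (hNp : IsStronglyProgressive 𝓕 N) (t : Horizon T) :
    MemLp (fun p : Horizon T × Ω => N p.1 p.2) 2
      (((volume : Measure (Horizon T)).restrict (Iic t)).prod P) := by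
  have hm := progressive_stronglyMeasurable hNp
  rw [memLp_two_iff_lintegral hm.aestronglyMeasurable,
    lintegral_prod _ (hm.measurable.enorm.pow_const 2).aemeasurable]
  calc _ ≤ ∫⁻ s in Iic t, ENNReal.ofReal (∫ ω, N t ω ^ 2 ∂P) := by
        refine setLIntegral_mono measurable_const fun s hs => ?_
        rw [lintegral_enorm_sq_eq (hN2 s)]
        exact ENNReal.ofReal_le_ofReal (martingale_integral_sq_mono hN hN2 hs)
    _ < ∞ := by
        rw [setLIntegral_const]
        exact ENNReal.mul_lt_top ENNReal.ofReal_lt_top (volume_Iic_lt_top t)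

/-- A martingale may be moved inside a primitive of an adapted process. -/
lemma martingale_integral_mul_primitive (hN : Martingale N 𝓕 P) (hN2 : ∀ t, MemLp (N t) 2 P)
    (hNp : IsStronglyProgressive 𝓕 N) {χ : Horizon T → Ω → ℝ} (hχ : ScalarL2 P 𝓕 δ χ)
    (t : Horizon T) :
    ∫ ω, N t ω * (∫ s in Iic t, χ s ω) ∂P = ∫ ω, (∫ s in Iic t, χ s ω * N s ω) ∂P := by
  have hχ2 := hχ.memLp_Iic t
  have i1 : Integrable (fun p : Horizon T × Ω => χ p.1 p.2 * N t p.2)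
      (((volume : Measure (Horizon T)).restrict (Iic t)).prod P) :=
    hχ2.integrable_mul ((hN2 t).comp_snd _)
  have i2 : Integrable (fun p : Horizon T × Ω => χ p.1 p.2 * N p.1 p.2)
      (((volume : Measure (Horizon T)).restrict (Iic t)).prod P) :=
    hχ2.integrable_mul (martingale_memLp_Iic hN hN2 hNp t)
  calc _ = ∫ ω, (∫ s in Iic t, χ s ω * N t ω) ∂P := by
        simp only [integral_mul_const]; simp only [mul_comm]
    _ = ∫ s in Iic t, (∫ ω, χ s ω * N t ω ∂P) := (integral_integral_swap i1).symm
    _ = ∫ s in Iic t, (∫ ω, χ s ω * N s ω ∂P) := by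
        refine integral_congr_ae ?_
        filter_upwards [ae_restrict_mem measurableSet_Iic, ae_restrict_of_ae hχ.ae_memLp]
          with s hs h2
        exact martingale_integral_mul hN hN2 hs (hχ.1.stronglyAdapted s) h2
    _ = _ := integral_integral_swap i2

lemma martingale_of_setIntegral_eq {M : Horizon T → Ω → ℝ} (hM : StronglyAdapted 𝓕 M)
    (hint : ∀ t, Integrable (M t) P)
    (h : ∀ s t, s ≤ t → ∀ A, MeasurableSet[𝓕 s] A → ∫ ω in A, M s ω ∂P = ∫ ω in A, M t ω ∂P) :
    Martingale M 𝓕 P := by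
  refine ⟨hM, fun s t hst => ?_⟩
  exact (ae_eq_condExp_of_forall_setIntegral_eq (𝓕.le s) (hint t)
    (fun A _ _ => (hint s).integrableOn) (fun A hA _ => h s t hst A hA)
    (hM s).aestronglyMeasurable).symm

/-- The stochastic integral of a smooth deterministic function with respect to a martingale,
defined by partial integration, is a martingale. -/
lemma martingale_deterministic_integral (hN : Martingale N 𝓕 P) (hN2 : ∀ t, MemLp (N t) 2 P)
    (hNp : IsStronglyProgressive 𝓕 N) {w w' : ℝ → ℝ}
    (hw : ∀ t : Horizon T, HasDerivAt w (w' t) t) (hwc : Continuous w') :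
    Martingale (fun (t : Horizon T) ω => w t * N t ω - ∫ s in Iic t, w' s * N s ω) 𝓕 P ∧
      ∀ t : Horizon T, MemLp (fun ω => w t * N t ω - ∫ s in Iic t, w' s * N s ω) 2 P := by
  have hprog : IsStronglyProgressive 𝓕 fun (t : Horizon T) ω => w' t * N t ω :=
    (progressive_time hwc.measurable).mul hNp
  have hi2 : ∀ t : Horizon T, MemLp (fun p : Horizon T × Ω => w' p.1 * N p.1 p.2) 2
      (((volume : Measure (Horizon T)).restrict (Iic t)).prod P) := by
    intro t
    obtain ⟨C, hC⟩ := (isCompact_Icc (a := (0 : ℝ)) (b := t)).exists_bound_of_continuousOn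
      hwc.continuousOn
    have hr : ((volume : Measure (Horizon T)).restrict (Iic t)).prod P =
        ((volume : Measure (Horizon T)).prod P).restrict (Iic t ×ˢ univ) := by
      rw [← Measure.prod_restrict, Measure.restrict_univ]
    refine ((martingale_memLp_Iic hN hN2 hNp t).const_mul C).mono
      (progressive_stronglyMeasurable hprog).aestronglyMeasurable ?_
    rw [hr]
    filter_upwards [ae_restrict_mem (measurableSet_Iic.prod MeasurableSet.univ)] with p hp
    rw [norm_mul, norm_mul]
    have := hC p.1 ⟨p.1.2.1, hp.1⟩
    gcongr
    exact this.trans (le_abs_self C)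
  have hi : ∀ t : Horizon T, Integrable (fun p : Horizon T × Ω => w' p.1 * N p.1 p.2)
      (((volume : Measure (Horizon T)).restrict (Iic t)).prod P) :=
    fun t => (hi2 t).integrable one_le_two
  have hprim : ∀ t : Horizon T, MemLp (fun ω => ∫ s in Iic t, w' s * N s ω) 2 P :=
    fun t => memLp_primitive hprog t (hi2 t)
  have hmem : ∀ t : Horizon T, MemLp (fun ω => w t * N t ω - ∫ s in Iic t, w' s * N s ω) 2 P :=
    fun t => ((hN2 t).const_mul _).sub (hprim t)
  refine ⟨martingale_of_setIntegral_eq (fun t => ?_) (fun t => (hmem t).integrable one_le_two) ?_,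
    hmem⟩
  · exact ((hN.1 t).const_mul _).sub ((progressive_primitive hprog).stronglyAdapted t)
  intro s t hst A hA
  have hNA : ∀ u, s ≤ u → ∫ ω in A, N u ω ∂P = ∫ ω in A, N s ω ∂P := fun u hu =>
    (hN.setIntegral_eq hu hA).symm
  have key : ∀ v : Horizon T, ∫ ω in A, (w v * N v ω - ∫ u in Iic v, w' u * N u ω) ∂P =
      w v * (∫ ω in A, N v ω ∂P) - ∫ u in Iic v, w' u * ∫ ω in A, N u ω ∂P := by
    intro v
    rw [integral_sub (((hN2 v).integrable one_le_two).const_mul _).integrableOn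
      ((hprim v).integrable one_le_two).integrableOn, integral_const_mul]
    congr 1
    have i4 : Integrable (fun p : Horizon T × Ω => w' p.1 * N p.1 p.2)
        (((volume : Measure (Horizon T)).restrict (Iic v)).prod (P.restrict A)) := by
      rw [← Measure.restrict_univ (μ := (volume : Measure (Horizon T)).restrict (Iic v)),
        Measure.prod_restrict]
      exact (hi v).mono_measure Measure.restrict_le_self
    rw [← integral_integral_swap i4]
    simp only [integral_const_mul]
  have i5 : IntegrableOn (fun u : Horizon T => w' u * ∫ ω in A, N u ω ∂P) (Iic t) := by
    have i4 : Integrable (fun p : Horizon T × Ω => w' p.1 * N p.1 p.2)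
        (((volume : Measure (Horizon T)).restrict (Iic t)).prod (P.restrict A)) := by
      rw [← Measure.restrict_univ (μ := (volume : Measure (Horizon T)).restrict (Iic t)),
        Measure.prod_restrict]
      exact (hi t).mono_measure Measure.restrict_le_self
    refine i4.integral_prod_left.congr (.of_forall fun u => ?_)
    simp only [integral_const_mul]
  rw [key, key, hNA t hst, setIntegral_Iic_eq_add hst i5]
  -- After Fubini only `u ↦ E[N_u; A]` is left. It is constant on `[s,t]` because `A` belongs to `𝓕
  -- s`, so the integral of `w'` telescopes against the change of the boundary term.
  have : ∫ u in Ioc s t, w' u * ∫ ω in A, N u ω ∂P = (w t - w s) * ∫ ω in A, N s ω ∂P := by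
    rw [← integral_Ioc_deriv hst (fun u hu => hw ⟨u, s.2.1.trans hu.1,
      (ENNReal.ofReal_le_ofReal hu.2).trans t.2.2⟩) hwc.continuousOn, ← integral_mul_const]
    refine setIntegral_congr_fun measurableSet_Ioc fun u hu => ?_
    simp only [hNA u hu.1.le]
  rw [this]; ring

end Martingales

/-! ### Progressive versions of martingales -/

section Versions

variable {T : ℝ≥0∞} {Ω : Type*}

/-- A time change with countably many values splits the process into countably many measurable
rectangles. The condition `ρ t ≤ t` ensures that on `[0,i]` only `N j` with `j ≤ i` occurs, which is
what progressive measurability requires. -/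
lemma measurable_comp_countable_range [MeasurableSpace Ω] {N : Horizon T → Ω → ℝ}
    {ρ : Horizon T → Horizon T} (hρ : Measurable ρ) (hc : (range ρ).Countable)
    (hle : ∀ t, ρ t ≤ t) (i : Horizon T) (hN : ∀ j ≤ i, Measurable (N j)) :
    Measurable fun p : Iic i × Ω => N (ρ p.1) p.2 := by
  intro B hB
  have : (fun p : Iic i × Ω => N (ρ p.1) p.2) ⁻¹' B =
      ⋃ c ∈ range ρ ∩ Iic i, {p : Iic i × Ω | ρ p.1 = c} ∩ Prod.snd ⁻¹' (N c ⁻¹' B) := by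
    ext p
    simp only [mem_preimage, mem_iUnion, mem_inter_iff, mem_ofPred_eq, exists_prop]
    constructor
    · intro h
      exact ⟨ρ p.1, ⟨mem_range_self _, (hle _).trans p.1.2⟩, rfl, h⟩
    · rintro ⟨c, -, h1, h2⟩
      rwa [h1]
  rw [this]
  refine MeasurableSet.biUnion (hc.mono inter_subset_left) fun c hc => ?_
  refine MeasurableSet.inter ?_ (measurable_snd (hN c hc.2 hB))
  exact (hρ.comp (measurable_subtype_coe.comp measurable_fst)) (measurableSet_singleton c)

/-- The largest dyadic time of level `n` before `t`. -/
def dyadicFloor (n : ℕ) (t : Horizon T) : Horizon T :=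
  ⟨⌊(t : ℝ) * 2 ^ n⌋₊ / 2 ^ n, by positivity, by
    refine (ENNReal.ofReal_le_ofReal ?_).trans t.2.2
    rw [div_le_iff₀ (by positivity)]
    exact Nat.floor_le (mul_nonneg t.2.1 (by positivity))⟩

lemma dyadicFloor_le (n : ℕ) (t : Horizon T) : dyadicFloor n t ≤ t := by
  rw [← Subtype.coe_le_coe]
  simp only [dyadicFloor]
  rw [div_le_iff₀ (by positivity)]
  exact Nat.floor_le (mul_nonneg t.2.1 (by positivity))

lemma dyadicFloor_mono (t : Horizon T) : Monotone fun n => dyadicFloor n t := by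
  refine monotone_nat_of_le_succ fun n => ?_
  rw [← Subtype.coe_le_coe]
  simp only [dyadicFloor]
  rw [div_le_div_iff₀ (by positivity) (by positivity), pow_succ, ← mul_assoc, mul_right_comm]
  refine mul_le_mul_of_nonneg_right ?_ (by positivity)
  have h := Nat.floor_le (mul_nonneg t.2.1 (by positivity) : 0 ≤ (t : ℝ) * 2 ^ n)
  have : ⌊(t : ℝ) * 2 ^ n⌋₊ * 2 ≤ ⌊(t : ℝ) * (2 ^ n * 2)⌋₊ := by
    refine Nat.le_floor ?_
    push_cast
    rw [← mul_assoc]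
    linarith
  exact_mod_cast this

lemma tendsto_dyadicFloor (t : Horizon T) :
    Filter.Tendsto (fun n => (dyadicFloor n t : ℝ)) Filter.atTop (nhds t) := by
  refine tendsto_of_tendsto_of_tendsto_of_le_of_le (g := fun n : ℕ => (t : ℝ) - (1 / 2) ^ n)
    (h := fun _ => (t : ℝ)) ?_ tendsto_const_nhds (fun n => ?_) fun n => dyadicFloor_le n t
  · have := tendsto_pow_atTop_nhds_zero_of_lt_one (r := (1 / 2 : ℝ)) (by norm_num) (by norm_num)
    simpa using tendsto_const_nhds.sub this
  · simp only [dyadicFloor, one_div, inv_pow]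
    rw [le_div_iff₀ (by positivity), sub_mul, inv_mul_cancel₀ (by positivity)]
    have := Nat.lt_floor_add_one ((t : ℝ) * 2 ^ n)
    linarith

lemma measurable_dyadicFloor (n : ℕ) : Measurable (dyadicFloor n : Horizon T → Horizon T) := by
  refine Measurable.subtype_mk ?_
  have h : Measurable fun t : Horizon T => ⌊(t : ℝ) * 2 ^ n⌋₊ :=
    Nat.measurable_floor.comp (measurable_subtype_coe.mul_const _)
  exact ((measurable_from_nat (f := fun k : ℕ => (k : ℝ))).comp h).div_const _

lemma countable_range_dyadicFloor (n : ℕ) :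
    (range (dyadicFloor n : Horizon T → Horizon T)).Countable := by
  have : range (dyadicFloor n : Horizon T → Horizon T) ⊆
      Subtype.val ⁻¹' (range fun k : ℕ => (k : ℝ) / 2 ^ n) := by
    rintro _ ⟨t, rfl⟩
    exact ⟨_, rfl⟩
  exact ((countable_range _).preimage Subtype.val_injective).mono this

variable [mΩ : MeasurableSpace Ω] {P : Measure Ω} [IsProbabilityMeasure P]
  {𝓕 : Filtration (Horizon T) mΩ}

/-- Lévy's upward theorem gives almost sure convergence along the dyadic times, but towards
conditioning on the sigma-algebra they generate, which may be smaller than `𝓕 t`. By Pythagoras the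
squared `L²` distance to the value at `t` is a difference of second moments. Its convergence to zero
and Fatou identify the two limits. -/
lemma condExp_eq_of_tendsto_sq {Z : Ω → ℝ} {t : Horizon T}
    (hN2 : ∀ t, MemLp (P[Z | 𝓕 t]) 2 P)
    (ht : Filter.Tendsto (fun n => ∫ ω, (P[Z | 𝓕 (dyadicFloor n t)]) ω ^ 2 ∂P) Filter.atTop
      (nhds (∫ ω, (P[Z | 𝓕 t]) ω ^ 2 ∂P))) :
    ∀ᵐ ω ∂P, Filter.Tendsto (fun n => (P[Z | 𝓕 (dyadicFloor n t)]) ω) Filter.atTop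
      (nhds ((P[Z | 𝓕 t]) ω)) := by
  have hN : Martingale (fun t => P[Z | 𝓕 t]) 𝓕 P := martingale_condExp Z 𝓕 P
  let 𝓖 : Filtration ℕ mΩ := ⟨fun n => 𝓕 (dyadicFloor n t),
    fun a b hab => 𝓕.mono (dyadicFloor_mono t hab), fun n => 𝓕.le _⟩
  have hl : ∀ᵐ ω ∂P, Filter.Tendsto (fun n => (P[Z | 𝓕 (dyadicFloor n t)]) ω) Filter.atTop
      (nhds ((P[Z | ⨆ n, 𝓖 n]) ω)) := tendsto_ae_condExp (ℱ := 𝓖) Z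
  have hzero : ∫⁻ ω, ‖(P[Z | 𝓕 t]) ω - (P[Z | ⨆ n, 𝓖 n]) ω‖ₑ ^ 2 ∂P = 0 := by
    refine le_antisymm ?_ (zero_le)
    have hseq : ∀ n, ∫⁻ ω, ‖(P[Z | 𝓕 t]) ω - (P[Z | 𝓕 (dyadicFloor n t)]) ω‖ₑ ^ 2 ∂P =
        ENNReal.ofReal (∫ ω, (P[Z | 𝓕 t]) ω ^ 2 ∂P
          - ∫ ω, (P[Z | 𝓕 (dyadicFloor n t)]) ω ^ 2 ∂P) := fun n => by
      rw [← martingale_integral_sub_sq hN hN2 (dyadicFloor_le n t), ← lintegral_enorm_sq_eq]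
      exact (hN2 t).sub (hN2 _)
    calc _ = ∫⁻ ω, Filter.liminf (fun n => ‖(P[Z | 𝓕 t]) ω
            - (P[Z | 𝓕 (dyadicFloor n t)]) ω‖ₑ ^ 2) Filter.atTop ∂P := by
          refine lintegral_congr_ae ?_
          filter_upwards [hl] with ω hω
          have := (((ENNReal.continuous_pow 2).comp continuous_enorm).tendsto _).comp
            (tendsto_const_nhds (x := (P[Z | 𝓕 t]) ω) |>.sub hω)
          exact this.liminf_eq.symm
      _ ≤ Filter.liminf (fun n => ∫⁻ ω, ‖(P[Z | 𝓕 t]) ω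
            - (P[Z | 𝓕 (dyadicFloor n t)]) ω‖ₑ ^ 2 ∂P) Filter.atTop := by
          refine lintegral_liminf_le' fun n => ?_
          exact (((hN2 t).sub (hN2 _)).1.enorm.pow_const 2)
      _ = 0 := by
          simp only [hseq]
          have := (ENNReal.continuous_ofReal.tendsto _).comp
            (tendsto_const_nhds (x := ∫ ω, (P[Z | 𝓕 t]) ω ^ 2 ∂P) |>.sub ht)
          rw [sub_self, ENNReal.ofReal_zero] at this
          exact this.liminf_eq
  have hm : AEMeasurable (fun ω => ‖(P[Z | 𝓕 t]) ω - (P[Z | ⨆ n, 𝓖 n]) ω‖ₑ ^ 2) P := by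
    have : AEStronglyMeasurable (P[Z | ⨆ n, 𝓖 n]) P := integrable_condExp.1
    exact (((hN2 t).1.sub this).enorm.pow_const 2)
  filter_upwards [hl, (lintegral_eq_zero_iff' hm).1 hzero] with ω h1 h2
  have h3 : (P[Z | 𝓕 t]) ω = (P[Z | ⨆ n, 𝓖 n]) ω := by
    simpa [sub_eq_zero] using h2
  rwa [h3]

/-- The martingale closed by a square integrable random variable has a progressively measurable
version; no usual conditions on the filtration are required. -/
lemma exists_progressive_condExp (𝓕 : Filtration (Horizon T) mΩ) {Z : Ω → ℝ} (hZ : MemLp Z 2 P) :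
    ∃ N : Horizon T → Ω → ℝ, IsStronglyProgressive 𝓕 N ∧ ∀ t, N t =ᵐ[P] P[Z | 𝓕 t] := by
  have hN : Martingale (fun t => P[Z | 𝓕 t]) 𝓕 P := martingale_condExp Z 𝓕 P
  have hN2 : ∀ t, MemLp (P[Z | 𝓕 t]) 2 P := fun t => hZ.condExp (by norm_num)
  -- The second moment is monotone in time, so it has only countably many discontinuities. At all
  -- other times dyadic approximation from the left recovers the martingale almost surely.
  set V : ℝ → ℝ := fun x => ∫ ω, (P[Z | 𝓕 (clamp T x)]) ω ^ 2 ∂P with hV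
  have hVm : Monotone V := fun x y hxy =>
    martingale_integral_sq_mono hN hN2 (clamp_mono hxy)
  have hD : {t : Horizon T | ¬ ContinuousAt V t}.Countable :=
    (hVm.countable_not_continuousAt).preimage Subtype.val_injective
  -- Adding `⊥` makes the exceptional set nonempty, so that it can be enumerated by a sequence.
  obtain ⟨e, he⟩ := (hD.insert ⊥).exists_eq_range (insert_nonempty _ _)
  let S : ℕ → Set (Horizon T) := fun n => e '' (Iio n)
  have hS : ∀ n, (S n).Finite := fun n => (finite_Iio n).image e
  classical
  -- The first `n` exceptional times are kept exactly and every other time is rounded down. Each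
  -- exceptional time is thus eventually fixed, the others are approximated, and the range stays
  -- countable. The limsup is defined everywhere and agrees with the limit wherever there is one.
  let ρ : ℕ → Horizon T → Horizon T := fun n => (S n).piecewise id (dyadicFloor n)
  have hρle : ∀ n t, ρ n t ≤ t := fun n t => by
    by_cases h : t ∈ S n
    · simp [ρ, h]
    · simpa [ρ, h] using dyadicFloor_le n t
  have hρm : ∀ n, Measurable (ρ n) := fun n =>
    measurable_id.piecewise (hS n).measurableSet (measurable_dyadicFloor n)
  have hρc : ∀ n, (range (ρ n)).Countable := fun n => by
    refine ((hS n).countable.union (countable_range_dyadicFloor n)).mono ?_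
    rintro _ ⟨t, rfl⟩
    by_cases h : t ∈ S n
    · left; simp [ρ, h]
    · right; simp [ρ, h]
  let Nn : ℕ → Horizon T → Ω → ℝ := fun n t ω => (P[Z | 𝓕 (ρ n t)]) ω
  have hNn : ∀ n i, Measurable[Subtype.instMeasurableSpace.prod (𝓕 i)]
      fun p : Iic i × Ω => Nn n p.1 p.2 := fun n i =>
    @measurable_comp_countable_range T Ω (𝓕 i) (fun t => P[Z | 𝓕 t]) (ρ n) (hρm n) (hρc n)
      (hρle n) i fun j hj => ((hN.1 j).mono (𝓕.mono hj)).measurable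
  refine ⟨fun t ω => Filter.limsup (fun n => Nn n t ω) Filter.atTop, fun i => ?_, fun t => ?_⟩
  · exact (Measurable.limsup (fun n => hNn n i)).stronglyMeasurable
  by_cases ht : t ∈ insert ⊥ {t : Horizon T | ¬ ContinuousAt V t}
  · rw [he] at ht
    obtain ⟨k, rfl⟩ := ht
    refine .of_forall fun ω => Filter.Tendsto.limsup_eq ?_
    refine tendsto_atTop_of_eventually_const (i₀ := k + 1) fun n hn => ?_
    have : e k ∈ S n := ⟨k, by simpa using hn, rfl⟩
    simp [Nn, ρ, this]
  · have hcont : ContinuousAt V t := by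
      by_contra h
      exact ht (mem_insert_of_mem _ h)
    have hρ : ∀ n, ρ n t = dyadicFloor n t := fun n => by
      have : t ∉ S n := by
        rintro ⟨k, -, rfl⟩
        exact ht (he ▸ mem_range_self k)
      simp [ρ, this]
    have hlim : Filter.Tendsto (fun n => ∫ ω, (P[Z | 𝓕 (dyadicFloor n t)]) ω ^ 2 ∂P) Filter.atTop
        (nhds (∫ ω, (P[Z | 𝓕 t]) ω ^ 2 ∂P)) := by
      have := hcont.tendsto.comp (tendsto_dyadicFloor t)
      simpa only [V, Function.comp_def, clamp_val] using this
    filter_upwards [condExp_eq_of_tendsto_sq hN2 hlim] with ω hω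
    refine Filter.Tendsto.limsup_eq ?_
    simpa only [Nn, hρ] using hω

end Versions

/-! ### The first-order condition -/

section FirstOrder

variable {T : ℝ≥0∞}

lemma volume_Ioc_horizon (s t : Horizon T) : volume (Ioc s t) = ENNReal.ofReal (t - s) := by
  rw [volume_horizon_eq, ← Real.volume_Ioc]
  congr 1
  ext x
  constructor
  · rintro ⟨u, hu, rfl⟩; exact hu
  · intro hx
    exact ⟨⟨x, s.2.1.trans hx.1.le, (ENNReal.ofReal_le_ofReal hx.2).trans t.2.2⟩, hx, rfl⟩

lemma exists_gt_of_lt {t : Horizon T} (ht : ENNReal.ofReal t < T) : ∃ s : Horizon T, t < s := by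
  obtain ⟨r, hr, hr'⟩ := ENNReal.lt_iff_exists_nnreal_btwn.1 ht
  have h : (t : ℝ) < r := by
    rw [← ENNReal.ofReal_coe_nnreal] at hr
    exact (ENNReal.ofReal_lt_ofReal_iff_of_nonneg t.2.1).1 hr
  exact ⟨⟨r, r.2, by rw [ENNReal.ofReal_coe_nnreal]; exact hr'.le⟩, h⟩

/-- A conull set of times meets every interval to the right of `t`. This lets information valid at
almost every time be carried back to `t` by conditioning. -/
lemma exists_gt_of_ae {p : Horizon T → Prop} (h : ∀ᵐ t, p t) {t : Horizon T}
    (ht : ENNReal.ofReal t < T) : ∃ s, t < s ∧ p s := by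
  obtain ⟨u, hu⟩ := exists_gt_of_lt ht
  by_contra! hcon
  have hsub : Ioc t u ⊆ {s | ¬ p s} := fun s hs => hcon s hs.1
  have h0 : volume (Ioc t u) = 0 := measure_mono_null hsub (ae_iff.1 h)
  rw [volume_Ioc_horizon, ENNReal.ofReal_eq_zero] at h0
  have : (t : ℝ) < u := hu
  linarith

lemma exists_of_ae (hT : 0 < T) {p : Horizon T → Prop} (h : ∀ᵐ t, p t) : ∃ s, p s := by
  have h0 : ENNReal.ofReal ((⊥ : Horizon T) : ℝ) < T := by
    change ENNReal.ofReal 0 < T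
    simpa using hT
  obtain ⟨s, -, hs⟩ := exists_gt_of_ae h h0
  exact ⟨s, hs⟩

lemma clamp_top (x : ℝ) (hx : 0 ≤ x) : (clamp ∞ x : ℝ) = x := val_clamp hx le_top

lemma tendsto_clamp_top : Filter.Tendsto (clamp ∞) Filter.atTop Filter.atTop :=
  clamp_mono.tendsto_atTop_atTop fun t => ⟨t, (clamp_val t).ge⟩

/-- If the primitive of an integrable function is itself integrable, its limit vanishes. -/
lemma integral_eq_zero_of_primitive {u v : Horizon ∞ → ℝ} (hu : Integrable u) (hv : Integrable v)
    (h : ∀ t, ∫ s in Iic t, u s = v t) : ∫ s, u s = 0 := by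
  have hlim : Filter.Tendsto (fun x : ℝ => v (clamp ∞ x)) Filter.atTop (nhds (∫ s, u s)) := by
    have := (aecover_Iic (μ := (volume : Measure (Horizon ∞)))
      tendsto_clamp_top).integral_tendsto_of_countably_generated hu
    simpa only [h] using this
  by_contra hL
  have hL' : 0 < |∫ s, u s| / 2 := by positivity
  have hev : ∀ᶠ x in Filter.atTop, |∫ s, u s| / 2 ≤ ‖v (clamp ∞ x)‖ :=
    (hlim.norm.eventually_const_le (by rw [Real.norm_eq_abs]; linarith))
  obtain ⟨x₀, hx₀⟩ := Filter.eventually_atTop.1 hev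
  have hfin := hv.measure_norm_ge_lt_top hL'
  -- A nonzero limit would keep `|v|` above half of it on a whole half-line, whose measure is
  -- infinite, whereas integrability of `v` makes this level set finite.
  have hbig : ∀ n : ℕ, (n : ℝ≥0∞) ≤ volume {t | |∫ s, u s| / 2 ≤ ‖v t‖} := by
    intro n
    set y := max x₀ 0
    have hy : 0 ≤ y := le_max_right _ _
    have hsub : Ioc (clamp ∞ y) (clamp ∞ (y + n)) ⊆ {t | |∫ s, u s| / 2 ≤ ‖v t‖} := by
      intro t ht
      have h1 : y < (t : ℝ) := by
        have : ((clamp ∞ y : Horizon ∞) : ℝ) < t := ht.1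
        rwa [clamp_top y hy] at this
      have := hx₀ t ((le_max_left _ _).trans h1.le)
      rwa [clamp_val] at this
    refine le_trans ?_ (measure_mono hsub)
    rw [volume_Ioc_horizon, clamp_top y hy, clamp_top _ (by positivity)]
    simp
  obtain ⟨n, hn⟩ := ENNReal.exists_nat_gt hfin.ne
  exact absurd (hbig n) (not_le.2 hn)

variable {Ω : Type*} [mΩ : MeasurableSpace Ω] {P : Measure Ω} [IsProbabilityMeasure P]
  {𝓕 : Filtration (Horizon T) mΩ} {δ : ℝ} {r g M η : Horizon T → Ω → ℝ}

/-- Subtracting the drift from a solution of the backward equation leaves a martingale. -/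
lemma martingale_of_backward (hT : 0 < T) (hr : ScalarL2 P 𝓕 δ r) {h : Horizon T → Ω → ℝ}
    (hh : ScalarL2 P 𝓕 δ h) (hM : Martingale M 𝓕 P) (hM2 : ∀ t, MemLp (M t) 2 P)
    (hback : ∀ᵐ ω ∂P, ∀ t, r t ω = r ⊥ ω + (M t ω - M ⊥ ω) + ∫ s in Iic t, h s ω) :
    Martingale (fun t ω => r t ω - ∫ s in Iic t, h s ω) 𝓕 P ∧
      (∀ t, MemLp (fun ω => r t ω - ∫ s in Iic t, h s ω) 2 P) ∧ ∀ t, MemLp (r t) 2 P := by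
  have hD : ∀ t, MemLp (fun ω => ∫ s in Iic t, h s ω) 2 P := hh.memLp_primitive
  -- Membership in `L²_δ` says nothing about the single time zero. Some time `t` with `r t` square
  -- integrable exists by Fubini, and the equation transfers this to time zero.
  have hr0 : MemLp (r ⊥) 2 P := by
    obtain ⟨t, ht⟩ := exists_of_ae hT hr.ae_memLp
    refine ((ht.sub ((hM2 t).sub (hM2 ⊥))).sub (hD t)).ae_eq ?_
    filter_upwards [hback] with ω hω
    simp only [Pi.sub_apply]
    rw [hω t]; ring
  have hN2 : ∀ t, MemLp (fun ω => r t ω - ∫ s in Iic t, h s ω) 2 P := by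
    intro t
    refine (hr0.add ((hM2 t).sub (hM2 ⊥))).ae_eq ?_
    filter_upwards [hback] with ω hω
    simp only [Pi.add_apply, Pi.sub_apply]
    rw [hω t]; ring
  refine ⟨martingale_of_setIntegral_eq (fun t => ?_) (fun t => (hN2 t).integrable one_le_two) ?_,
    hN2, fun t => ?_⟩
  · exact (hr.1.stronglyAdapted t).sub ((progressive_primitive hh.1).stronglyAdapted t)
  · intro s t hst A hA
    have key : ∀ v, ∫ ω in A, (r v ω - ∫ s in Iic v, h s ω) ∂P =
        ∫ ω in A, (r ⊥ ω - M ⊥ ω) ∂P + ∫ ω in A, M v ω ∂P := by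
      intro v
      have i1 : Integrable (fun ω => r ⊥ ω - M ⊥ ω) P :=
        (hr0.integrable one_le_two).sub ((hM2 ⊥).integrable one_le_two)
      rw [← integral_add i1.integrableOn ((hM2 v).integrable one_le_two).integrableOn]
      refine integral_congr_ae (ae_restrict_of_ae ?_)
      filter_upwards [hback] with ω hω
      rw [hω v]; ring
    rw [key, key, hM.setIntegral_eq hst hA]
  · refine ((hN2 t).add (hD t)).ae_eq (.of_forall fun ω => ?_)
    simp

/-- The first-order condition up to a finite time. -/
lemma first_order_condition_at (hT : 0 < T) (hδ : 0 ≤ δ)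
    (hr : ScalarL2 P 𝓕 δ r) (hg : ScalarL2 P 𝓕 δ g) (hM : Martingale M 𝓕 P)
    (hM2 : ∀ t, MemLp (M t) 2 P)
    (hback : ∀ᵐ ω ∂P, ∀ t, r t ω = r ⊥ ω + (M t ω - M ⊥ ω) + ∫ s in Iic t, (g s ω + δ * r s ω))
    (hη : ScalarL2 P 𝓕 δ η) (hψ : ScalarL2 P 𝓕 δ fun t ω => ∫ s in Iic t, η s ω)
    (τ : Horizon T) :
    ∫ ω, (∫ t in Iic τ, Real.exp (-δ * t) * (η t ω * r t ω + (∫ s in Iic t, η s ω) * g t ω)) ∂P =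
      ∫ ω, Real.exp (-δ * τ) * ((∫ s in Iic τ, η s ω) * r τ ω) ∂P := by
  have hh : ScalarL2 P 𝓕 δ fun t ω => g t ω + δ * r t ω := hg.add (hr.const_mul δ)
  -- `M` is only adapted, while Fubini needs joint measurability. The martingale `r` minus its drift
  -- is progressive and replaces `M` from here on.
  obtain ⟨hN, hN2, hr2⟩ := martingale_of_backward hT hr hh hM hM2 hback
  have hNp : IsStronglyProgressive 𝓕 fun t ω => r t ω - ∫ s in Iic t, (g s ω + δ * r s ω) :=
    hr.1.sub (progressive_primitive hh.1)
  -- This process is the time derivative of the discounted direction `e^{-δt} ∫_0^t η`, as `hE`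
  -- confirms.
  have hχ : ScalarL2 P 𝓕 δ fun t ω =>
      Real.exp (-δ * t) * (η t ω - δ * ∫ s in Iic t, η s ω) := by
    refine (hη.sub (hψ.const_mul δ)).mul_bounded (w := fun t => Real.exp (-δ * t))
      (by fun_prop) (C := 1) fun t => ?_
    rw [abs_of_pos (Real.exp_pos _), Real.exp_le_one_iff]
    nlinarith [t.2.1]
  have hE : ∀ᵐ ω ∂P, ∀ t : Horizon T, Real.exp (-δ * t) * (∫ s in Iic t, η s ω) =
      ∫ s in Iic t, Real.exp (-δ * s) * (η s ω - δ * ∫ u in Iic s, η u ω) := by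
    filter_upwards [hη.ae_integrableOn] with ω hω t
    have hd : ∀ u ∈ Icc (0 : ℝ) t, HasDerivAt (fun x : ℝ => Real.exp (-δ * x))
        (-δ * Real.exp (-δ * u)) u := fun u _ => by
      have := ((hasDerivAt_id u).const_mul (-δ)).exp
      simpa [mul_comm] using this
    have hc : ContinuousOn (fun u : ℝ => -δ * Real.exp (-δ * u)) (Icc (0 : ℝ) t) := by fun_prop
    have h := (absolutelyContinuous_mul t (p := fun u : Horizon T => -δ * Real.exp (-δ * u))
      (q := fun s => η s ω) (f := fun s : Horizon T => Real.exp (-δ * s))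
      (g := fun s => ∫ u in Iic s, η u ω) (f0 := 1) (g0 := 0)
      (integrableOn_Iic_of_continuousOn t hc) (hω t) (fun s hs => by
        rw [integral_Iic_deriv (w := fun x : ℝ => Real.exp (-δ * x))
          (w' := fun u : ℝ => -δ * Real.exp (-δ * u)) s
          (fun u hu => hd u ⟨hu.1, hu.2.trans hs⟩)
          (hc.mono (Icc_subset_Icc_right hs))]
        simp) (fun s _ => by simp)).1
    rw [h, mul_zero, zero_add]
    refine setIntegral_congr_fun measurableSet_Iic fun s _ => ?_
    ring
  have hχN : Integrable (fun p : Horizon T × Ω =>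
      Real.exp (-δ * p.1) * (η p.1 p.2 - δ * ∫ s in Iic p.1, η s p.2) *
        (r p.1 p.2 - ∫ s in Iic p.1, (g s p.2 + δ * r s p.2)))
      (((volume : Measure (Horizon T)).restrict (Iic τ)).prod P) :=
    (hχ.memLp_Iic τ).integrable_mul (martingale_memLp_Iic hN hN2 hNp τ)
  have hmart := martingale_integral_mul_primitive hN hN2 hNp hχ τ
  have hEN : Integrable (fun ω => (r τ ω - ∫ s in Iic τ, (g s ω + δ * r s ω)) *
      ∫ s in Iic τ, Real.exp (-δ * s) * (η s ω - δ * ∫ u in Iic s, η u ω)) P :=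
    (hN2 τ).integrable_mul (hχ.memLp_primitive τ)
  have hED : Integrable (fun ω => (∫ s in Iic τ, (g s ω + δ * r s ω)) *
      ∫ s in Iic τ, Real.exp (-δ * s) * (η s ω - δ * ∫ u in Iic s, η u ω)) P :=
    (hh.memLp_primitive τ).integrable_mul (hχ.memLp_primitive τ)
  -- Write `r = N + D` with drift part `D`. The `D` contribution is an exact derivative, that of `D
  -- e^{-δt} ψ`, with the `δr` in the drift compensating the derivative of the discount factor. The
  -- `N` contribution becomes the boundary term for `N` after taking expectations, by `hmart`.
  have hpath : ∀ᵐ ω ∂P,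
      (∫ t in Iic τ, Real.exp (-δ * t) * (η t ω * r t ω + (∫ s in Iic t, η s ω) * g t ω)) =
      (∫ s in Iic τ, Real.exp (-δ * s) * (η s ω - δ * ∫ u in Iic s, η u ω) *
        (r s ω - ∫ u in Iic s, (g u ω + δ * r u ω))) +
      (∫ s in Iic τ, (g s ω + δ * r s ω)) *
        ∫ s in Iic τ, Real.exp (-δ * s) * (η s ω - δ * ∫ u in Iic s, η u ω) := by
    filter_upwards [hE, hχN.prod_left_ae, hχ.ae_integrableOn, hh.ae_integrableOn]
      with ω h1 h2 h3 h4
    obtain ⟨h5, h6⟩ := absolutelyContinuous_mul τ (h4 τ) (h3 τ)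
      (f := fun t => ∫ s in Iic t, (g s ω + δ * r s ω))
      (g := fun t : Horizon T => Real.exp (-δ * t) * (∫ s in Iic t, η s ω)) (f0 := 0) (g0 := 0)
      (fun s _ => by simp) (fun s _ => by rw [h1 s, zero_add])
    rw [← h1 τ, h5, mul_zero, zero_add, ← integral_add h2 h6]
    refine setIntegral_congr_fun measurableSet_Iic fun s _ => ?_
    ring
  rw [integral_congr_ae hpath]
  have hi : Integrable (fun ω => ∫ s in Iic τ,
      Real.exp (-δ * s) * (η s ω - δ * ∫ u in Iic s, η u ω) *
        (r s ω - ∫ u in Iic s, (g u ω + δ * r u ω))) P := hχN.integral_prod_right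
  rw [integral_add hi hED, ← hmart, ← integral_add hEN hED]
  refine integral_congr_ae ?_
  filter_upwards [hE] with ω h1
  rw [← h1 τ]; ring

/-- The first-order condition: a solution of the backward equation is orthogonal to all
admissible directions. -/
lemma first_order_condition (hT : 0 < T) (hδ : 0 ≤ δ)
    (hr : ScalarL2 P 𝓕 δ r) (hg : ScalarL2 P 𝓕 δ g) (hM : Martingale M 𝓕 P)
    (hM2 : ∀ t, MemLp (M t) 2 P)
    (hback : ∀ᵐ ω ∂P, ∀ t, r t ω = r ⊥ ω + (M t ω - M ⊥ ω) + ∫ s in Iic t, (g s ω + δ * r s ω))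
    (hterm : ∀ t : Horizon T, ENNReal.ofReal t = T → ∀ᵐ ω ∂P, r t ω = 0)
    (hη : ScalarL2 P 𝓕 δ η) (hψ : ScalarL2 P 𝓕 δ fun t ω => ∫ s in Iic t, η s ω) :
    ∫ p : Horizon T × Ω, Real.exp (-δ * p.1) *
      (η p.1 p.2 * r p.1 p.2 + (∫ s in Iic p.1, η s p.2) * g p.1 p.2)
        ∂((volume : Measure (Horizon T)).prod P) = 0 := by
  have hk : Integrable (fun p : Horizon T × Ω => Real.exp (-δ * p.1) *
      (η p.1 p.2 * r p.1 p.2 + (∫ s in Iic p.1, η s p.2) * g p.1 p.2))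
      ((volume : Measure (Horizon T)).prod P) := by
    refine ((hη.integrable_mul hr).add (hψ.integrable_mul hg)).congr (.of_forall fun p => ?_)
    simp only [Pi.add_apply]; ring
  have hv : Integrable (fun p : Horizon T × Ω => Real.exp (-δ * p.1) *
      ((∫ s in Iic p.1, η s p.2) * r p.1 p.2)) ((volume : Measure (Horizon T)).prod P) :=
    hψ.integrable_mul hr
  rw [integral_prod _ hk]
  have h : ∀ τ : Horizon T, ∫ t in Iic τ, (∫ ω, Real.exp (-δ * t) *
      (η t ω * r t ω + (∫ s in Iic t, η s ω) * g t ω) ∂P) =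
      ∫ ω, Real.exp (-δ * τ) * ((∫ s in Iic τ, η s ω) * r τ ω) ∂P := fun τ => by
    rw [← first_order_condition_at hT hδ hr hg hM hM2 hback hη hψ τ]
    refine integral_integral_swap ?_
    have := hk.restrict (s := Iic τ ×ˢ univ)
    rwa [← Measure.prod_restrict, Measure.restrict_univ] at this
  -- For `T = ∞` the boundary term, as a function of its endpoint, is integrable, being the product
  -- of two discounted square integrable processes. For finite `T` the endpoint is attained and the
  -- terminal condition kills it.
  by_cases hTop : T = ∞
  · subst hTop
    exact integral_eq_zero_of_primitive hk.integral_prod_left hv.integral_prod_left h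
  · let τ : Horizon T := ⟨T.toReal, ENNReal.toReal_nonneg, ENNReal.ofReal_toReal_le⟩
    have hτ : Iic τ = univ := eq_univ_of_forall fun t => by
      have := (ENNReal.ofReal_le_iff_le_toReal hTop).1 t.2.2
      exact this
    have h1 := h τ
    rw [hτ, Measure.restrict_univ] at h1
    rw [h1]
    refine integral_eq_zero_of_ae ?_
    filter_upwards [hterm τ (ENNReal.ofReal_toReal hTop)] with ω hω
    simp [hω]

end FirstOrder

/-! ### Exponential kernels -/

section Kernel

/-- The total mass of the two-sided exponential kernel. -/
def kernelMass (ε : ℝ) : ℝ≥0∞ := ∫⁻ x : ℝ, ENNReal.ofReal (Real.exp (-(ε * |x|)))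

lemma kernelMass_lt_top {ε : ℝ} (hε : 0 < ε) : kernelMass ε < ∞ := by
  have hint : Integrable fun x : ℝ => Real.exp (-(ε * |x|)) := by
    -- The constant comes from `e^{ε|x|} ≥ 1 + ε²x²/2`: multiplying by `1 + 2/ε²` gives at least `1
    -- + x²`.
    refine ((integrable_inv_one_add_sq).const_mul (1 + 2 / ε ^ 2)).mono
      (by fun_prop) (.of_forall fun x => ?_)
    rw [Real.norm_of_nonneg (Real.exp_nonneg _), Real.norm_of_nonneg (by positivity),
      Real.exp_neg, ← div_eq_mul_inv, inv_le_comm₀ (Real.exp_pos _) (by positivity), inv_div,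
      div_le_iff₀ (by positivity)]
    have h := Real.quadratic_le_exp_of_nonneg (x := ε * |x|) (by positivity)
    have h2 : 1 + ε ^ 2 * x ^ 2 / 2 ≤ Real.exp (ε * |x|) := by
      rw [mul_pow, sq_abs] at h
      have : 0 ≤ ε * |x| := by positivity
      linarith
    calc 1 + x ^ 2 ≤ (1 + ε ^ 2 * x ^ 2 / 2) * (1 + 2 / ε ^ 2) := by
          have : (1 + ε ^ 2 * x ^ 2 / 2) * (1 + 2 / ε ^ 2) =
              1 + x ^ 2 + ε ^ 2 * x ^ 2 / 2 + 2 / ε ^ 2 := by field_simp; ring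
          rw [this]
          have h3 : 0 ≤ ε ^ 2 * x ^ 2 / 2 := by positivity
          have h4 : 0 ≤ 2 / ε ^ 2 := by positivity
          linarith
      _ ≤ _ := by gcongr
  have := hint.lintegral_lt_top
  simpa [kernelMass] using this

variable {T : ℝ≥0∞}

/-- The two-sided exponential kernel on the time set. -/
def expKernel (ε : ℝ) (t s : Horizon T) : ℝ≥0∞ :=
  ENNReal.ofReal (Real.exp (-(ε * |(s : ℝ) - t|)))

lemma expKernel_symm (ε : ℝ) (t s : Horizon T) : expKernel ε t s = expKernel ε s t := by
  simp only [expKernel, abs_sub_comm]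

lemma measurable_expKernel (ε : ℝ) :
    Measurable fun p : Horizon T × Horizon T => expKernel ε p.1 p.2 := by
  unfold expKernel
  fun_prop

lemma lintegral_horizon_le (f : ℝ → ℝ≥0∞) : ∫⁻ s : Horizon T, f s ≤ ∫⁻ x, f x := by
  rw [← (measurableEmbedding_val T).lintegral_map, map_val_volume]
  exact setLIntegral_le_lintegral _ _

lemma lintegral_expKernel_le (ε : ℝ) (t : Horizon T) :
    ∫⁻ s, expKernel ε t s ≤ kernelMass ε := by
  refine (lintegral_horizon_le fun x => ENNReal.ofReal (Real.exp (-(ε * |x - t|)))).trans ?_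
  exact (lintegral_sub_right_eq_self (fun x => ENNReal.ofReal (Real.exp (-(ε * |x|)))) (t : ℝ)).le

/-- Cauchy-Schwarz with the kernel split into two square roots; the square root is again an
exponential kernel, of rate `ε / 2`. -/
lemma lintegral_expKernel_mul_sq_le (ε : ℝ) {f : Horizon T → ℝ≥0∞} (hf : Measurable f)
    (t : Horizon T) : (∫⁻ s, expKernel ε t s * f s) ^ 2 ≤
      kernelMass ε * ∫⁻ s, expKernel ε t s * f s ^ 2 := by
  have hsq : ∀ s, expKernel ε t s = expKernel (ε / 2) t s ^ 2 := fun s => by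
    rw [expKernel, expKernel, ← ENNReal.ofReal_pow (Real.exp_nonneg _), ← Real.exp_nat_mul]
    congr 2; push_cast; ring
  have hm : Measurable fun s => expKernel (ε / 2) t s :=
    (measurable_expKernel _).comp measurable_prodMk_left
  have e : ∀ s, expKernel ε t s * f s = expKernel (ε / 2) t s * (expKernel (ε / 2) t s * f s) :=
    fun s => by rw [hsq]; ring
  simp only [e]
  refine (lintegral_mul_sq_le hm.aemeasurable (hm.mul hf).aemeasurable).trans ?_
  gcongr ?_ * ?_
  · simp only [← hsq]
    exact lintegral_expKernel_le ε t
  · refine le_of_eq (lintegral_congr fun s => ?_)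
    rw [Pi.mul_apply, hsq, mul_pow]

/-- Young's inequality for the exponential kernel. -/
lemma lintegral_expKernel_sq_le (ε : ℝ) {f : Horizon T → ℝ≥0∞} (hf : Measurable f) :
    ∫⁻ t, (∫⁻ s, expKernel ε t s * f s) ^ 2 ≤ kernelMass ε * (kernelMass ε * ∫⁻ s, f s ^ 2) := by
  have hm : Measurable fun p : Horizon T × Horizon T => expKernel ε p.1 p.2 * f p.2 ^ 2 :=
    (measurable_expKernel ε).mul ((hf.comp measurable_snd).pow_const 2)
  calc _ ≤ ∫⁻ t, kernelMass ε * ∫⁻ s, expKernel ε t s * f s ^ 2 :=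
        lintegral_mono fun t => lintegral_expKernel_mul_sq_le ε hf t
    _ = kernelMass ε * ∫⁻ s, (∫⁻ t, expKernel ε t s) * f s ^ 2 := by
        rw [lintegral_const_mul _ hm.lintegral_prod_right', lintegral_lintegral_swap hm.aemeasurable]
        congr 1
        refine lintegral_congr fun s => ?_
        exact lintegral_mul_const (f := fun t => expKernel ε t s) (f s ^ 2)
          ((measurable_expKernel ε).comp measurable_prodMk_right)
    _ ≤ _ := by
        gcongr
        rw [← lintegral_const_mul _ (hf.pow_const 2)]
        gcongr with s
        simp only [expKernel_symm ε _ s]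
        exact lintegral_expKernel_le ε s

lemma expKernel_le_one {ε : ℝ} (hε : 0 ≤ ε) (t s : Horizon T) : expKernel ε t s ≤ 1 := by
  rw [expKernel, ← ENNReal.ofReal_one]
  refine ENNReal.ofReal_le_ofReal (Real.exp_le_one_iff.2 ?_)
  have : 0 ≤ ε * |(s : ℝ) - t| := by positivity
  linarith

lemma lintegral_expKernel_mul_lt_top {ε : ℝ} (hε : 0 < ε) {f : Horizon T → ℝ≥0∞}
    (hf : Measurable f) (hf2 : ∫⁻ s, f s ^ 2 < ∞) (t : Horizon T) :
    ∫⁻ s, expKernel ε t s * f s < ∞ := by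
  have h : (∫⁻ s, expKernel ε t s * f s) ^ 2 < ∞ := by
    refine (lintegral_expKernel_mul_sq_le ε hf t).trans_lt
      (ENNReal.mul_lt_top (kernelMass_lt_top hε) (lt_of_le_of_lt ?_ hf2))
    refine lintegral_mono fun s => ?_
    exact mul_le_of_le_one_left (zero_le) (expKernel_le_one hε.le t s)
  exact (ENNReal.pow_lt_top_iff.1 h).resolve_right (by norm_num)

end Kernel

/-! ### The scalar feedback equation -/

/-- The feedback coefficient `F` of the scalar problem with coefficient `b`: a solution of the
Riccati equation together with a solution `m` of `m' = -F m` that is dominated by exponentials. -/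
structure IsFeedback (T : ℝ≥0∞) (δ b : ℝ) (F m : ℝ → ℝ) (ε C : ℝ) : Prop where
  pos : ∀ t, 0 < m t
  deriv_m : ∀ t, HasDerivAt m (-F t * m t) t
  riccati : ∀ t, HasDerivAt F (F t ^ 2 + δ * F t - b) t
  rate_pos : 0 < ε
  decay : ∀ s t : Horizon T, s ≤ t →
    Real.exp (-(δ / 2) * (t - s)) * m t ≤ C * Real.exp (-(ε * (t - s))) * m s
  bound : ∀ t : Horizon T, |F t| ≤ C
  terminal : ∀ t : Horizon T, ENNReal.ofReal t = T → F t = 0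

section Feedback

variable {T : ℝ≥0∞} {δ b : ℝ} {F m : ℝ → ℝ} {ε C : ℝ}

lemma IsFeedback.bound_nonneg (h : IsFeedback T δ b F m ε C) : 0 ≤ C :=
  (abs_nonneg _).trans (h.bound ⊥)

lemma IsFeedback.continuous_m (h : IsFeedback T δ b F m ε C) : Continuous m :=
  continuous_iff_continuousAt.2 fun t => (h.deriv_m t).continuousAt

lemma IsFeedback.continuous_F (h : IsFeedback T δ b F m ε C) : Continuous F :=
  continuous_iff_continuousAt.2 fun t => (h.riccati t).continuousAt

variable {Ω : Type*} [mΩ : MeasurableSpace Ω] {P : Measure Ω} [IsProbabilityMeasure P]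
  {𝓕 : Filtration (Horizon T) mΩ} {ξ x : Horizon T → Ω → ℝ}

/-- A progressively measurable version of the scalar signal. -/
def IsScalarSignal (P : Measure Ω) (𝓕 : Filtration (Horizon T) mΩ) (δ b : ℝ) (m : ℝ → ℝ)
    (ξ x : Horizon T → Ω → ℝ) : Prop :=
  IsStronglyProgressive 𝓕 x ∧ ∀ t : Horizon T, ∀ᵐ ω ∂P,
    x t ω = (Real.exp (δ * t) / m t) *
      (P[fun ω' => ∫ s in Ici t, b * Real.exp (-δ * s) * m s * ξ s ω' | 𝓕 t]) ω

/-- The position generated by the feedback rule. -/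
def feedbackPosition (m : ℝ → ℝ) (x : Horizon T → Ω → ℝ) : Horizon T → Ω → ℝ :=
  fun t ω => m t * ∫ s in Iic t, (m s)⁻¹ * x s ω

lemma ScalarL2.measurable_discounted (hξ : IsStronglyProgressive 𝓕 ξ) :
    Measurable fun p : Horizon T × Ω => ‖Real.exp (-(δ / 2) * p.1) * ξ p.1 p.2‖ₑ :=
  ((measurable_exp_time _).mul (progressive_stronglyMeasurable hξ).measurable).enorm

lemma ScalarL2.lintegral_lt_top (hξ : ScalarL2 P 𝓕 δ ξ) :
    ∫⁻ ω, (∫⁻ t : Horizon T, ‖Real.exp (-(δ / 2) * t) * ξ t ω‖ₑ ^ 2) ∂P < ∞ := by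
  have h := (memLp_two_iff_lintegral (discounted_aestronglyMeasurable hξ.1)).1 hξ.2
  rwa [lintegral_prod_symm' _ ((ScalarL2.measurable_discounted hξ.1).pow_const 2)] at h

/-- The integrand of the signal is dominated by the exponential kernel. -/
lemma IsFeedback.enorm_signal_le (h : IsFeedback T δ b F m ε C) (hb : 0 ≤ b) {t s : Horizon T}
    (hts : t ≤ s) (y : ℝ) :
    ‖Real.exp (δ / 2 * t) / m t * (b * Real.exp (-δ * s) * m s * y)‖ₑ ≤
      ENNReal.ofReal (b * C) * (expKernel ε t s * ‖Real.exp (-(δ / 2) * s) * y‖ₑ) := by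
  have hd := h.decay t s hts
  have hts' : (t : ℝ) ≤ s := hts
  rw [expKernel, abs_of_nonneg (by linarith : (0 : ℝ) ≤ s - t), Real.enorm_eq_ofReal_abs,
    Real.enorm_eq_ofReal_abs, ← ENNReal.ofReal_mul (Real.exp_nonneg _),
    ← ENNReal.ofReal_mul (mul_nonneg hb h.bound_nonneg)]
  refine ENNReal.ofReal_le_ofReal ?_
  have e1 : Real.exp (δ / 2 * t) / m t * (b * Real.exp (-δ * s) * m s * y) =
      b * ((Real.exp (-(δ / 2) * (s - t)) * m s) / m t) * (Real.exp (-(δ / 2) * s) * y) := by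
    have : Real.exp (δ / 2 * t) * Real.exp (-δ * s) =
        Real.exp (-(δ / 2) * (s - t)) * Real.exp (-(δ / 2) * s) := by
      rw [← Real.exp_add, ← Real.exp_add]; congr 1; ring
    calc _ = (Real.exp (δ / 2 * t) * Real.exp (-δ * s)) * (b * m s * y / m t) := by ring
      _ = _ := by rw [this]; ring
  rw [e1, abs_mul, abs_of_nonneg (mul_nonneg hb (div_nonneg (mul_nonneg (Real.exp_nonneg _)
    (h.pos s).le) (h.pos t).le))]
  rw [mul_assoc b C, mul_assoc b, ← mul_assoc C]
  refine mul_le_mul_of_nonneg_left ?_ hb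
  refine mul_le_mul_of_nonneg_right ?_ (abs_nonneg _)
  rwa [div_le_iff₀ (h.pos t)]

/-- The integrand of the position is dominated by the exponential kernel. -/
lemma IsFeedback.enorm_position_le (h : IsFeedback T δ b F m ε C) {s t : Horizon T}
    (hst : s ≤ t) (y : ℝ) :
    ‖Real.exp (-(δ / 2) * t) * m t * ((m s)⁻¹ * y)‖ₑ ≤
      ENNReal.ofReal C * (expKernel ε t s * ‖Real.exp (-(δ / 2) * s) * y‖ₑ) := by
  have hd := h.decay s t hst
  have hst' : (s : ℝ) ≤ t := hst
  rw [expKernel, abs_of_nonpos (by linarith : (s : ℝ) - t ≤ 0), Real.enorm_eq_ofReal_abs,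
    Real.enorm_eq_ofReal_abs, ← ENNReal.ofReal_mul (Real.exp_nonneg _),
    ← ENNReal.ofReal_mul h.bound_nonneg]
  refine ENNReal.ofReal_le_ofReal ?_
  have e1 : Real.exp (-(δ / 2) * t) * m t * ((m s)⁻¹ * y) =
      ((Real.exp (-(δ / 2) * (t - s)) * m t) / m s) * (Real.exp (-(δ / 2) * s) * y) := by
    have : Real.exp (-(δ / 2) * t) =
        Real.exp (-(δ / 2) * (t - s)) * Real.exp (-(δ / 2) * s) := by
      rw [← Real.exp_add]; congr 1; ring
    rw [this]; field_simp
  rw [e1, abs_mul, abs_of_nonneg (div_nonneg (mul_nonneg (Real.exp_nonneg _)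
    (h.pos t).le) (h.pos s).le)]
  rw [← mul_assoc]
  refine mul_le_mul_of_nonneg_right ?_ (abs_nonneg _)
  rw [div_le_iff₀ (h.pos s), neg_sub]
  exact hd

/-- Path by path, the discounted position is dominated by the exponential kernel applied to the
discounted signal. Young's inequality then bounds it in `L²(dt)`, uniformly in the path, and
expectations follow. -/
lemma IsFeedback.position_scalarL2 (h : IsFeedback T δ b F m ε C) (hx : ScalarL2 P 𝓕 δ x) :
    ScalarL2 P 𝓕 δ (feedbackPosition m x) := by
  have hinv : Measurable fun t : ℝ => (m t)⁻¹ := h.continuous_m.measurable.inv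
  have hp : IsStronglyProgressive 𝓕 (feedbackPosition m x) :=
    (progressive_time h.continuous_m.measurable).mul
      (progressive_primitive ((progressive_time hinv).mul hx.1))
  refine ⟨hp, (memLp_two_iff_lintegral (discounted_aestronglyMeasurable hp)).2 ?_⟩
  rw [lintegral_prod_symm' _ ((ScalarL2.measurable_discounted hp).pow_const 2)]
  have hmf : ∀ ω, Measurable fun s : Horizon T => ‖Real.exp (-(δ / 2) * s) * x s ω‖ₑ :=
    fun ω => (ScalarL2.measurable_discounted hx.1).comp measurable_prodMk_right
  have hb : ∀ ω (t : Horizon T), ‖Real.exp (-(δ / 2) * t) * feedbackPosition m x t ω‖ₑ ^ 2 ≤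
      ENNReal.ofReal C ^ 2 *
        (∫⁻ s, expKernel ε t s * ‖Real.exp (-(δ / 2) * s) * x s ω‖ₑ) ^ 2 := by
    intro ω t
    rw [← mul_pow]
    refine pow_le_pow_left₀ (zero_le) ?_ 2
    have hm2 : Measurable fun s : Horizon T =>
        expKernel ε t s * ‖Real.exp (-(δ / 2) * s) * x s ω‖ₑ :=
      ((measurable_expKernel ε).comp measurable_prodMk_left).mul (hmf ω)
    rw [feedbackPosition, ← mul_assoc, ← integral_const_mul, ← lintegral_const_mul _ hm2]
    refine (enorm_integral_le_lintegral_enorm _).trans ?_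
    refine (setLIntegral_mono ((hm2.const_mul _)) fun s hs =>
      h.enorm_position_le hs (x s ω)).trans (setLIntegral_le_lintegral _ _)
  calc _ ≤ ∫⁻ ω, (ENNReal.ofReal C ^ 2 * (kernelMass ε * (kernelMass ε *
        ∫⁻ s : Horizon T, ‖Real.exp (-(δ / 2) * s) * x s ω‖ₑ ^ 2))) ∂P := by
        refine lintegral_mono fun ω => (lintegral_mono (hb ω)).trans ?_
        rw [lintegral_const_mul' _ _ (by finiteness)]
        gcongr
        exact lintegral_expKernel_sq_le ε (hmf ω)
    _ = ENNReal.ofReal C ^ 2 * (kernelMass ε * (kernelMass ε *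
        ∫⁻ ω, (∫⁻ s : Horizon T, ‖Real.exp (-(δ / 2) * s) * x s ω‖ₑ ^ 2) ∂P)) := by
        have hk := kernelMass_lt_top h.rate_pos
        rw [lintegral_const_mul' _ _ (by finiteness), lintegral_const_mul' _ _ hk.ne,
          lintegral_const_mul' _ _ hk.ne]
    _ < ∞ := by
        have hk := kernelMass_lt_top h.rate_pos
        have := hx.lintegral_lt_top
        finiteness

/-- Almost surely, the discounted signal integrand is integrable. -/
lemma IsFeedback.ae_integrable_signal (h : IsFeedback T δ b F m ε C) (hb : 0 ≤ b)
    (hξ : ScalarL2 P 𝓕 δ ξ) :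
    ∀ᵐ ω ∂P, Integrable fun s : Horizon T => b * Real.exp (-δ * s) * m s * ξ s ω := by
  have hmf : ∀ ω, Measurable fun s : Horizon T => ‖Real.exp (-(δ / 2) * s) * ξ s ω‖ₑ :=
    fun ω => (ScalarL2.measurable_discounted hξ.1).comp measurable_prodMk_right
  have hlt := ae_lt_top ((ScalarL2.measurable_discounted (δ := δ) hξ.1).pow_const
    2).lintegral_prod_left' hξ.lintegral_lt_top.ne
  filter_upwards [hlt] with ω hω
  have hme : Measurable fun s : Horizon T => b * Real.exp (-δ * s) * m s * ξ s ω := by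
    have h1 : Measurable fun s : Horizon T => ξ s ω :=
      (progressive_stronglyMeasurable hξ.1).measurable.comp measurable_prodMk_right
    have h2 : Measurable fun s : Horizon T => m s := h.continuous_m.measurable.comp measurable_val
    have h3 : Measurable fun s : Horizon T => b * Real.exp (-δ * s) := by fun_prop
    exact (h3.mul h2).mul h1
  -- The kernel bound is applied at time zero, from which every time lies in the future.
  have hi : Integrable fun s : Horizon T => Real.exp (δ / 2 * (⊥ : Horizon T)) / m (⊥ : Horizon T)
      * (b * Real.exp (-δ * s) * m s * ξ s ω) := by
    refine ⟨(hme.const_mul _).aestronglyMeasurable, ?_⟩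
    refine (lintegral_mono fun s => h.enorm_signal_le hb (bot_le : ⊥ ≤ s) (ξ s ω)).trans_lt ?_
    rw [lintegral_const_mul' _ _ (by finiteness)]
    exact ENNReal.mul_lt_top (by finiteness)
      (lintegral_expKernel_mul_lt_top h.rate_pos (hmf ω) hω ⊥)
  refine (hi.const_mul (m (⊥ : Horizon T) / Real.exp (δ / 2 * (⊥ : Horizon T)))).congr
    (.of_forall fun s => ?_)
  have := (h.pos (⊥ : Horizon T)).ne'
  have := (Real.exp_pos (δ / 2 * (⊥ : Horizon T))).ne'
  field_simp

lemma IsFeedback.progressive_integrand (h : IsFeedback T δ b F m ε C)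
    (hξ : IsStronglyProgressive 𝓕 ξ) :
    IsStronglyProgressive 𝓕 fun s ω => b * Real.exp (-δ * s) * m s * ξ s ω :=
  (progressive_time (w := fun s => b * Real.exp (-δ * s) * m s)
    ((by fun_prop : Measurable fun s : ℝ => b * Real.exp (-δ * s)).mul
      h.continuous_m.measurable)).mul hξ

/-- The discounted future signal at time `t`, bounded by a kernel integral. -/
lemma IsFeedback.enorm_future_le (h : IsFeedback T δ b F m ε C) (hb : 0 ≤ b)
    (hξ : IsStronglyProgressive 𝓕 ξ) (t : Horizon T) (ω : Ω) :
    ‖Real.exp (δ / 2 * t) / m t * ∫ s in Ici t, b * Real.exp (-δ * s) * m s * ξ s ω‖ₑ ^ 2 ≤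
      ENNReal.ofReal (b * C) ^ 2 *
        (∫⁻ s, expKernel ε t s * ‖Real.exp (-(δ / 2) * s) * ξ s ω‖ₑ) ^ 2 := by
  have hmf : Measurable fun s : Horizon T => ‖Real.exp (-(δ / 2) * s) * ξ s ω‖ₑ :=
    (ScalarL2.measurable_discounted hξ).comp measurable_prodMk_right
  rw [← mul_pow]
  refine pow_le_pow_left₀ (zero_le) ?_ 2
  have hm2 : Measurable fun s : Horizon T =>
      expKernel ε t s * ‖Real.exp (-(δ / 2) * s) * ξ s ω‖ₑ :=
    ((measurable_expKernel ε).comp measurable_prodMk_left).mul hmf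
  rw [← integral_const_mul, ← lintegral_const_mul _ hm2]
  refine (enorm_integral_le_lintegral_enorm _).trans ?_
  exact (setLIntegral_mono ((hm2.const_mul _)) fun s hs =>
    h.enorm_signal_le hb hs (ξ s ω)).trans (setLIntegral_le_lintegral _ _)

lemma measurable_kernel_integral (hξ : IsStronglyProgressive 𝓕 ξ) :
    Measurable fun p : Horizon T × Ω =>
      ∫⁻ s, expKernel ε p.1 s * ‖Real.exp (-(δ / 2) * s) * ξ s p.2‖ₑ := by
  have hk : Measurable fun z : (Horizon T × Ω) × Horizon T => (z.1.1, z.2) :=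
    (measurable_fst.comp measurable_fst).prodMk measurable_snd
  have hg : Measurable fun z : (Horizon T × Ω) × Horizon T => (z.2, z.1.2) :=
    measurable_snd.prodMk (measurable_snd.comp measurable_fst)
  have h1 := (measurable_expKernel ε).comp hk
  have h2 := (ScalarL2.measurable_discounted (δ := δ) hξ).comp hg
  exact (h1.mul h2).lintegral_prod_right'

lemma IsFeedback.stronglyMeasurable_future (h : IsFeedback T δ b F m ε C)
    (hξ : IsStronglyProgressive 𝓕 ξ) :
    StronglyMeasurable fun p : Horizon T × Ω =>
      ∫ s in Ici p.1, b * Real.exp (-δ * s) * m s * ξ s p.2 := by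
  have h1 := progressive_stronglyMeasurable (h.progressive_integrand hξ)
  have hg : Measurable fun z : (Horizon T × Ω) × Horizon T => (z.2, z.1.2) :=
    measurable_snd.prodMk (measurable_snd.comp measurable_fst)
  have h2 := h1.comp_measurable hg
  have hA : MeasurableSet {z : (Horizon T × Ω) × Horizon T | z.1.1 ≤ z.2} :=
    measurableSet_le (measurable_fst.comp measurable_fst) measurable_snd
  convert (h2.indicator hA).integral_prod_right' (ν := volume) using 1
  ext p
  rw [← integral_indicator measurableSet_Ici]
  rfl

/-- The bound integrated over time puts the signal into `L²_δ`. The bound at each fixed time makes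
the future integral square integrable there, so its conditional expectation is meaningful at every
`t` and not just almost every `t`. -/
lemma IsFeedback.lintegral_kernel_lt_top (h : IsFeedback T δ b F m ε C)
    (hξ : ScalarL2 P 𝓕 δ ξ) :
    ∫⁻ t, (∫⁻ ω, (∫⁻ s, expKernel ε t s * ‖Real.exp (-(δ / 2) * s) * ξ s ω‖ₑ) ^ 2 ∂P) < ∞ ∧
    ∀ t, ∫⁻ ω, (∫⁻ s, expKernel ε t s * ‖Real.exp (-(δ / 2) * s) * ξ s ω‖ₑ) ^ 2 ∂P < ∞ := by
  have hk := kernelMass_lt_top h.rate_pos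
  have hfin := hξ.lintegral_lt_top
  have hmf : ∀ ω, Measurable fun s : Horizon T => ‖Real.exp (-(δ / 2) * s) * ξ s ω‖ₑ :=
    fun ω => (ScalarL2.measurable_discounted hξ.1).comp measurable_prodMk_right
  constructor
  · rw [lintegral_lintegral_swap
      ((measurable_kernel_integral hξ.1).pow_const 2).aemeasurable]
    calc _ ≤ ∫⁻ ω, (kernelMass ε * (kernelMass ε *
          ∫⁻ s : Horizon T, ‖Real.exp (-(δ / 2) * s) * ξ s ω‖ₑ ^ 2)) ∂P :=
          lintegral_mono fun ω => lintegral_expKernel_sq_le ε (hmf ω)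
      _ < ∞ := by
          rw [lintegral_const_mul' _ _ hk.ne, lintegral_const_mul' _ _ hk.ne]
          finiteness
  · intro t
    calc _ ≤ ∫⁻ ω, (kernelMass ε *
          ∫⁻ s : Horizon T, ‖Real.exp (-(δ / 2) * s) * ξ s ω‖ₑ ^ 2) ∂P := by
          refine lintegral_mono fun ω => (lintegral_expKernel_mul_sq_le ε (hmf ω) t).trans ?_
          gcongr with s
          exact mul_le_of_le_one_left (zero_le) (expKernel_le_one h.rate_pos.le t s)
      _ < ∞ := by
          rw [lintegral_const_mul' _ _ hk.ne]
          finiteness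

lemma IsFeedback.memLp_future (h : IsFeedback T δ b F m ε C) (hb : 0 ≤ b)
    (hξ : ScalarL2 P 𝓕 δ ξ) (t : Horizon T) :
    MemLp (fun ω => ∫ s in Ici t, b * Real.exp (-δ * s) * m s * ξ s ω) 2 P := by
  have hm : AEStronglyMeasurable (fun ω => Real.exp (δ / 2 * t) / m t *
      ∫ s in Ici t, b * Real.exp (-δ * s) * m s * ξ s ω) P :=
    (((h.stronglyMeasurable_future hξ.1).comp_measurable
      (measurable_prodMk_left (x := t))).const_mul _).aestronglyMeasurable
  have h1 : MemLp (fun ω => Real.exp (δ / 2 * t) / m t *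
      ∫ s in Ici t, b * Real.exp (-δ * s) * m s * ξ s ω) 2 P := by
    rw [memLp_two_iff_lintegral hm]
    refine (lintegral_mono (h.enorm_future_le hb hξ.1 t)).trans_lt ?_
    rw [lintegral_const_mul' _ _ (by finiteness)]
    have := (h.lintegral_kernel_lt_top hξ).2 t
    finiteness
  refine (h1.const_mul (m t / Real.exp (δ / 2 * t))).ae_eq (.of_forall fun ω => ?_)
  have := (h.pos t).ne'
  have := (Real.exp_pos (δ / 2 * t)).ne'
  field_simp

/-- Every version of the signal is discounted square integrable. -/
lemma IsFeedback.signal_scalarL2 (h : IsFeedback T δ b F m ε C) (hb : 0 ≤ b)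
    (hξ : ScalarL2 P 𝓕 δ ξ) (hx : IsScalarSignal P 𝓕 δ b m ξ x) : ScalarL2 P 𝓕 δ x := by
  refine ⟨hx.1, (memLp_two_iff_lintegral (discounted_aestronglyMeasurable hx.1)).2 ?_⟩
  rw [lintegral_prod _ ((ScalarL2.measurable_discounted hx.1).pow_const 2).aemeasurable]
  have key : ∀ t : Horizon T, ∫⁻ ω, ‖Real.exp (-(δ / 2) * t) * x t ω‖ₑ ^ 2 ∂P ≤
      ENNReal.ofReal (b * C) ^ 2 * ∫⁻ ω, (∫⁻ s, expKernel ε t s *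
        ‖Real.exp (-(δ / 2) * s) * ξ s ω‖ₑ) ^ 2 ∂P := by
    intro t
    set Y : Ω → ℝ := fun ω => ∫ s in Ici t, b * Real.exp (-δ * s) * m s * ξ s ω with hY
    have hYm := h.memLp_future hb hξ t
    have e1 : ∫⁻ ω, ‖Real.exp (-(δ / 2) * t) * x t ω‖ₑ ^ 2 ∂P =
        ‖Real.exp (δ / 2 * t) / m t‖ₑ ^ 2 * ∫⁻ ω, ‖(P[Y | 𝓕 t]) ω‖ₑ ^ 2 ∂P := by
      rw [← lintegral_const_mul' _ _ (by finiteness)]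
      refine lintegral_congr_ae ?_
      filter_upwards [hx.2 t] with ω hω
      rw [hω, ← mul_pow, ← enorm_mul]
      congr 2
      rw [← mul_assoc, ← mul_div_assoc, ← Real.exp_add]
      congr 3; ring
    -- Conditional expectation contracts `L²`, so the estimate for the future integral passes to the
    -- signal.
    have e2 : ∫⁻ ω, ‖(P[Y | 𝓕 t]) ω‖ₑ ^ 2 ∂P ≤ ∫⁻ ω, ‖Y ω‖ₑ ^ 2 ∂P := by
      have := eLpNorm_condExp_le_eLpNorm (m := 𝓕 t) (μ := P) Y (p := 2) (by norm_num)
      rw [eLpNorm_eq_lintegral_rpow_enorm_toReal two_ne_zero ENNReal.ofNat_ne_top,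
        eLpNorm_eq_lintegral_rpow_enorm_toReal two_ne_zero ENNReal.ofNat_ne_top,
        ENNReal.rpow_le_rpow_iff (by norm_num)] at this
      have e : ∀ y : ℝ≥0∞, y ^ (2 : ℝ) = y ^ 2 := fun y => by
        rw [← ENNReal.rpow_natCast]; norm_num
      simpa only [ENNReal.toReal_ofNat, e] using this
    rw [e1]
    calc _ ≤ ‖Real.exp (δ / 2 * t) / m t‖ₑ ^ 2 * ∫⁻ ω, ‖Y ω‖ₑ ^ 2 ∂P := by gcongr
      _ = ∫⁻ ω, ‖Real.exp (δ / 2 * t) / m t * Y ω‖ₑ ^ 2 ∂P := by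
          rw [← lintegral_const_mul' _ _ (by finiteness)]
          simp only [enorm_mul, mul_pow]
      _ ≤ _ := by
          rw [← lintegral_const_mul' _ _ (by finiteness)]
          exact lintegral_mono (h.enorm_future_le hb hξ.1 t)
  refine (lintegral_mono key).trans_lt ?_
  rw [lintegral_const_mul' _ _ (by finiteness)]
  have := (h.lintegral_kernel_lt_top hξ).1
  finiteness

end Feedback

/-! ### Solving the scalar equation by feedback -/

section ScalarSolution

variable {T : ℝ≥0∞} {δ b : ℝ} {F m : ℝ → ℝ} {ε C : ℝ}
  {Ω : Type*} [mΩ : MeasurableSpace Ω] {P : Measure Ω}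
  {𝓕 : Filtration (Horizon T) mΩ} {ξ x : Horizon T → Ω → ℝ}

/-- At the final time the future is a single point, hence null, so the signal vanishes; the feedback
coefficient vanishes there by `IsFeedback.terminal`. -/
lemma IsFeedback.terminal_rate (h : IsFeedback T δ b F m ε C)
    (hx : IsScalarSignal P 𝓕 δ b m ξ x) {t : Horizon T} (ht : ENNReal.ofReal t = T) :
    ∀ᵐ ω ∂P, x t ω - F t * feedbackPosition m x t ω = 0 := by
  have hIci : Ici t = {t} := by
    ext s
    refine ⟨fun hs => le_antisymm ?_ hs, fun hs => by rw [mem_singleton_iff.1 hs]; exact self_mem_Ici⟩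
    exact (ENNReal.ofReal_le_ofReal_iff t.2.1).1 (s.2.2.trans ht.ge)
  filter_upwards [hx.2 t] with ω hω
  rw [hω, h.terminal t ht, hIci]
  have : (fun ω' => ∫ s in ({t} : Set (Horizon T)), b * Real.exp (-δ * s) * m s * ξ s ω') =
      (0 : Ω → ℝ) := by
    ext ω'; simp
  rw [this, condExp_zero]
  simp

lemma integral_eq_Iic_add_Ici {q : Horizon T → ℝ} (hq : Integrable q) (t : Horizon T) :
    ∫ s, q s = (∫ s in Iic t, q s) + ∫ s in Ici t, q s := by
  rw [integral_Ici_eq_integral_Ioi, ← compl_Iic, integral_add_compl measurableSet_Iic hq]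

variable [IsProbabilityMeasure P]

/-- The conditional expectation of the total signal splits into past and future. -/
lemma IsFeedback.condExp_total (h : IsFeedback T δ b F m ε C) (hb : 0 ≤ b)
    (hξ : ScalarL2 P 𝓕 δ ξ) (t : Horizon T) :
    P[fun ω => ∫ s : Horizon T, b * Real.exp (-δ * s) * m s * ξ s ω | 𝓕 t] =ᵐ[P]
      fun ω => (∫ s in Iic t, b * Real.exp (-δ * s) * m s * ξ s ω) +
        (P[fun ω => ∫ s in Ici t, b * Real.exp (-δ * s) * m s * ξ s ω | 𝓕 t]) ω := by
  have hp := h.progressive_integrand hξ.1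
  have hH : StronglyMeasurable[𝓕 t]
      fun ω => ∫ s in Iic t, b * Real.exp (-δ * s) * m s * ξ s ω :=
    (progressive_primitive hp).stronglyAdapted t
  have hY := (h.memLp_future hb hξ t).integrable one_le_two
  have hZ : Integrable (fun ω => ∫ s : Horizon T, b * Real.exp (-δ * s) * m s * ξ s ω) P := by
    have := (h.memLp_future hb hξ ⊥).integrable one_le_two
    simpa using this
  have hsplit : ∀ᵐ ω ∂P, ∫ s : Horizon T, b * Real.exp (-δ * s) * m s * ξ s ω =
      (∫ s in Iic t, b * Real.exp (-δ * s) * m s * ξ s ω) +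
      ∫ s in Ici t, b * Real.exp (-δ * s) * m s * ξ s ω := by
    filter_upwards [h.ae_integrable_signal hb hξ] with ω hω
    exact integral_eq_Iic_add_Ici hω t
  have hHi : Integrable (fun ω => ∫ s in Iic t, b * Real.exp (-δ * s) * m s * ξ s ω) P := by
    refine (hZ.sub hY).congr ?_
    filter_upwards [hsplit] with ω hω
    simp only [Pi.sub_apply]
    rw [hω]; ring
  refine (condExp_congr_ae hsplit).trans ((condExp_add hHi hY (𝓕 t)).trans ?_)
  rw [condExp_of_stronglyMeasurable (𝓕.le t) hH hHi]
  rfl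

lemma IsFeedback.memLp_total (h : IsFeedback T δ b F m ε C) (hb : 0 ≤ b)
    (hξ : ScalarL2 P 𝓕 δ ξ) :
    MemLp (fun ω => ∫ s : Horizon T, b * Real.exp (-δ * s) * m s * ξ s ω) 2 P := by
  simpa using h.memLp_future hb hξ ⊥

/-- The conditional expectation of a future integral is that of the total integral minus the past.
The former has a progressive version as a closed martingale, and the past is a progressive
primitive. -/
lemma IsFeedback.exists_signal (h : IsFeedback T δ b F m ε C) (hb : 0 ≤ b)
    (hξ : ScalarL2 P 𝓕 δ ξ) : ∃ x, IsScalarSignal P 𝓕 δ b m ξ x := by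
  obtain ⟨N, hN, hN'⟩ := exists_progressive_condExp 𝓕 (h.memLp_total hb hξ)
  have hw : Measurable fun t : ℝ => Real.exp (δ * t) / m t :=
    (by fun_prop : Measurable fun t : ℝ => Real.exp (δ * t)).div h.continuous_m.measurable
  refine ⟨fun t ω => Real.exp (δ * t) / m t *
    (N t ω - ∫ s in Iic t, b * Real.exp (-δ * s) * m s * ξ s ω),
    (progressive_time hw).mul (hN.sub (progressive_primitive (h.progressive_integrand hξ.1))),
    fun t => ?_⟩
  filter_upwards [hN' t, h.condExp_total hb hξ t] with ω h1 h2
  rw [h1, h2, add_sub_cancel_left]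

/-- The martingale part `x / a + H` of the signal. -/
lemma IsFeedback.martingale_signal (h : IsFeedback T δ b F m ε C) (hb : 0 ≤ b)
    (hξ : ScalarL2 P 𝓕 δ ξ) (hx : IsScalarSignal P 𝓕 δ b m ξ x) :
    ∃ N : Horizon T → Ω → ℝ, Martingale N 𝓕 P ∧ (∀ t, MemLp (N t) 2 P) ∧
      IsStronglyProgressive 𝓕 N ∧ ∀ t ω, x t ω = Real.exp (δ * t) / m t *
        (N t ω - ∫ s in Iic t, b * Real.exp (-δ * s) * m s * ξ s ω) := by
  have hw : Measurable fun t : ℝ => m t / Real.exp (δ * t) :=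
    h.continuous_m.measurable.div (by fun_prop : Measurable fun t : ℝ => Real.exp (δ * t))
  -- `N` is read off from the given version `x` instead of being a chosen version of the closed
  -- martingale. The relation between `x` and `N` then holds at every `(t, ω)`, and `N` inherits
  -- progressive measurability.
  set N : Horizon T → Ω → ℝ := fun t ω => m t / Real.exp (δ * t) * x t ω +
    ∫ s in Iic t, b * Real.exp (-δ * s) * m s * ξ s ω with hNdef
  have hNp : IsStronglyProgressive 𝓕 N := ((progressive_time hw).mul hx.1).add
    (progressive_primitive (h.progressive_integrand hξ.1))
  have hN : ∀ t, N t =ᵐ[P]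
      P[fun ω => ∫ s : Horizon T, b * Real.exp (-δ * s) * m s * ξ s ω | 𝓕 t] := by
    intro t
    filter_upwards [hx.2 t, h.condExp_total hb hξ t] with ω h1 h2
    have := (h.pos t).ne'
    have := (Real.exp_pos (δ * t)).ne'
    rw [h2, hNdef]
    simp only
    rw [h1]
    field_simp
    ring
  refine ⟨N, ⟨hNp.stronglyAdapted, fun s t hst => ?_⟩, fun t => ?_, hNp, fun t ω => ?_⟩
  · exact (condExp_congr_ae (hN t)).trans
      ((condExp_condExp_of_le (𝓕.mono hst) (𝓕.le t)).trans (hN s).symm)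
  · exact ((h.memLp_total hb hξ).condExp (by norm_num)).ae_eq (hN t).symm
  · have := (h.pos t).ne'
    have := (Real.exp_pos (δ * t)).ne'
    simp only [hNdef]
    field_simp
    ring

lemma IsFeedback.ae_integrableOn_inv_mul (h : IsFeedback T δ b F m ε C)
    (hx : ScalarL2 P 𝓕 δ x) :
    ∀ᵐ ω ∂P, ∀ t : Horizon T, IntegrableOn (fun s : Horizon T => (m s)⁻¹ * x s ω) (Iic t) := by
  filter_upwards [hx.ae_integrableOn] with ω hω t
  have hinv : Continuous fun u : ℝ => (m u)⁻¹ := h.continuous_m.inv₀ fun u => (h.pos u).ne'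
  obtain ⟨K, hK⟩ := (isCompact_Icc (a := (0 : ℝ)) (b := t)).exists_bound_of_continuousOn
    hinv.continuousOn
  refine Integrable.bdd_mul (c := K) (hω t)
    (hinv.measurable.comp measurable_val).aestronglyMeasurable ?_
  filter_upwards [ae_restrict_mem measurableSet_Iic] with s hs using hK s ⟨s.2.1, hs⟩

/-- The position of the feedback rule is the primitive of the feedback rate. -/
lemma IsFeedback.position_eq (h : IsFeedback T δ b F m ε C) (hx : ScalarL2 P 𝓕 δ x) :
    ∀ᵐ ω ∂P, ∀ t : Horizon T, feedbackPosition m x t ω =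
      ∫ s in Iic t, (x s ω - F s * feedbackPosition m x s ω) := by
  filter_upwards [h.ae_integrableOn_inv_mul hx] with ω hω t
  have hc : Continuous fun u : ℝ => -F u * m u := h.continuous_F.neg.mul h.continuous_m
  have h1 := (absolutelyContinuous_mul t (p := fun u : Horizon T => -F u * m u)
    (q := fun s : Horizon T => (m s)⁻¹ * x s ω) (f := fun s : Horizon T => m s)
    (g := fun s => ∫ u in Iic s, (m u)⁻¹ * x u ω) (f0 := m 0) (g0 := 0)
    (integrableOn_Iic_of_continuousOn t hc.continuousOn) (hω t) (fun s _ => by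
      rw [integral_Iic_deriv (w := m) (w' := fun u => -F u * m u) s (fun u _ => h.deriv_m u)
        hc.continuousOn]
      ring) (fun s _ => by simp)).1
  rw [feedbackPosition, h1, mul_zero, zero_add]
  refine setIntegral_congr_fun measurableSet_Iic fun s _ => ?_
  have := (h.pos s).ne'
  simp only [feedbackPosition]
  field_simp
  ring

lemma IsFeedback.rate_scalarL2 (h : IsFeedback T δ b F m ε C) (hx : ScalarL2 P 𝓕 δ x) :
    ScalarL2 P 𝓕 δ fun t ω => x t ω - F t * feedbackPosition m x t ω :=
  hx.sub ((h.position_scalarL2 hx).mul_bounded h.continuous_F.measurable h.bound)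

/-- Write `x = a (N - H)` with `a = e^{δt}/m`, `a' = (δ + F) a` and `H` the past of the signal
integral. Differentiating `x - Fφ`, with the Riccati equation for `F'` and `φ' = x - Fφ`, all finite
variation terms combine to `b(φ - ξ) + δφ'`. What is left is `∫ a dN`, which is a martingale in its
integrated-by-parts form. -/
lemma IsFeedback.martingale_solution (h : IsFeedback T δ b F m ε C) (hb : 0 ≤ b)
    (hξ : ScalarL2 P 𝓕 δ ξ) (hx : IsScalarSignal P 𝓕 δ b m ξ x) :
    Martingale (fun (t : Horizon T) ω => x t ω - F t * feedbackPosition m x t ω -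
      ∫ s in Iic t, (b * (feedbackPosition m x s ω - ξ s ω) +
        δ * (x s ω - F s * feedbackPosition m x s ω))) 𝓕 P ∧
    ∀ t : Horizon T, MemLp (fun ω => x t ω - F t * feedbackPosition m x t ω -
      ∫ s in Iic t, (b * (feedbackPosition m x s ω - ξ s ω) +
        δ * (x s ω - F s * feedbackPosition m x s ω))) 2 P := by
  obtain ⟨N, hN, hN2, hNp, hxN⟩ := h.martingale_signal hb hξ hx
  have hx2 := h.signal_scalarL2 hb hξ hx
  have hφ := h.position_scalarL2 hx2
  have hr := h.rate_scalarL2 hx2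
  have hdr : ScalarL2 P 𝓕 δ fun s ω => b * (feedbackPosition m x s ω - ξ s ω) +
      δ * (x s ω - F s * feedbackPosition m x s ω) :=
    ((hφ.sub hξ).const_mul b).add (hr.const_mul δ)
  have hcm := h.continuous_m
  have hcF := h.continuous_F
  set a : ℝ → ℝ := fun t => Real.exp (δ * t) / m t with ha
  have hda : ∀ t, HasDerivAt a ((δ + F t) * a t) t := by
    intro t
    have h1 : HasDerivAt (fun t : ℝ => Real.exp (δ * t)) (δ * Real.exp (δ * t)) t := by
      have := ((hasDerivAt_id t).const_mul δ).exp
      simpa [mul_comm] using this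
    have h2 := h1.div (h.deriv_m t) (h.pos t).ne'
    refine h2.congr_deriv ?_
    have := (h.pos t).ne'
    simp only [ha]
    field_simp
    ring
  have hca : Continuous a := continuous_iff_continuousAt.2 fun t => (hda t).continuousAt
  have hca' : Continuous fun t => (δ + F t) * a t := (continuous_const.add hcF).mul hca
  have hcF' : Continuous fun t => F t ^ 2 + δ * F t - b := by fun_prop
  obtain ⟨hK, hK2⟩ := martingale_deterministic_integral hN hN2 hNp (w := a)
    (w' := fun t => (δ + F t) * a t) (fun t => hda t) hca'
  have hpath : ∀ᵐ ω ∂P, ∀ t : Horizon T, x t ω - F t * feedbackPosition m x t ω -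
      ∫ s in Iic t, (b * (feedbackPosition m x s ω - ξ s ω) +
        δ * (x s ω - F s * feedbackPosition m x s ω)) =
      a t * N t ω - ∫ s in Iic t, (δ + F s) * a s * N s ω := by
    filter_upwards [hdr.ae_integrableOn, hr.ae_integrableOn, h.ae_integrable_signal hb hξ,
      h.position_eq hx2] with ω h1 h2 h3 h4 t
    have e1 := absolutelyContinuous_mul t (p := fun u : Horizon T => (δ + F u) * a u)
      (q := fun s : Horizon T => b * Real.exp (-δ * s) * m s * ξ s ω)
      (f := fun s : Horizon T => a s)
      (g := fun t => ∫ s in Iic t, b * Real.exp (-δ * s) * m s * ξ s ω) (f0 := a 0) (g0 := 0)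
      (integrableOn_Iic_of_continuousOn t hca'.continuousOn) h3.integrableOn (fun s _ => by
        rw [integral_Iic_deriv (w := a) (w' := fun u => (δ + F u) * a u) s (fun u _ => hda u)
          hca'.continuousOn]
        ring) (fun s _ => by simp)
    have e2 := absolutelyContinuous_mul t (p := fun u : Horizon T => F u ^ 2 + δ * F u - b)
      (q := fun s => x s ω - F s * feedbackPosition m x s ω) (f := fun s : Horizon T => F s)
      (g := fun s => feedbackPosition m x s ω) (f0 := F 0) (g0 := 0)
      (integrableOn_Iic_of_continuousOn t hcF'.continuousOn) (h2 t) (fun s _ => by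
        rw [integral_Iic_deriv (w := F) (w' := fun u => F u ^ 2 + δ * F u - b) s
          (fun u _ => h.riccati u) hcF'.continuousOn]
        ring) (fun s _ => by rw [h4 s, zero_add])
    have hxt : x t ω - F t * feedbackPosition m x t ω = a t * N t ω -
        a t * (∫ s in Iic t, b * Real.exp (-δ * s) * m s * ξ s ω) -
        F t * feedbackPosition m x t ω := by
      rw [hxN t ω]; ring
    have hsum : IntegrableOn (fun s : Horizon T =>
        ((F s ^ 2 + δ * F s - b) * feedbackPosition m x s ω +
          F s * (x s ω - F s * feedbackPosition m x s ω)) +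
        (b * (feedbackPosition m x s ω - ξ s ω) +
          δ * (x s ω - F s * feedbackPosition m x s ω))) (Iic t) := e2.2.add (h1 t)
    rw [hxt, e1.1, e2.1, mul_zero, mul_zero, zero_add, zero_add, sub_sub, sub_sub, sub_right_inj,
      ← integral_add e2.2 (h1 t), ← integral_add e1.2 hsum]
    refine setIntegral_congr_fun measurableSet_Iic fun s _ => ?_
    -- The prefactor cancels the weights in the density of `H`, leaving exactly the source term of
    -- the backward equation.
    have hac : a s * (b * Real.exp (-δ * s) * m s * ξ s ω) = b * ξ s ω := by
      have := (h.pos s).ne'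
      have h6 : Real.exp (δ * s) * Real.exp (-δ * s) = 1 := by
        rw [← Real.exp_add]; simp
      simp only [ha]
      calc _ = (Real.exp (δ * s) * Real.exp (-δ * s)) * (b * ξ s ω) * (m s / m s) := by ring
        _ = _ := by rw [h6, div_self this]; ring
    rw [hac]
    have hxs : a s * N s ω = x s ω +
        a s * ∫ s in Iic s, b * Real.exp (-δ * s) * m s * ξ s ω := by
      rw [hxN s ω]; ring
    rw [mul_assoc (δ + F s) (a s) (N s ω), hxs]
    ring
  have hprog : IsStronglyProgressive 𝓕 fun (t : Horizon T) ω =>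
      x t ω - F t * feedbackPosition m x t ω -
      ∫ s in Iic t, (b * (feedbackPosition m x s ω - ξ s ω) +
        δ * (x s ω - F s * feedbackPosition m x s ω)) :=
    hr.1.sub (progressive_primitive hdr.1)
  have hae : ∀ t : Horizon T, (fun ω => x t ω - F t * feedbackPosition m x t ω -
      ∫ s in Iic t, (b * (feedbackPosition m x s ω - ξ s ω) +
        δ * (x s ω - F s * feedbackPosition m x s ω))) =ᵐ[P]
      fun ω => a t * N t ω - ∫ s in Iic t, (δ + F s) * a s * N s ω := fun t => by
    filter_upwards [hpath] with ω hω using hω t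
  refine ⟨⟨hprog.stronglyAdapted, fun s t hst => ?_⟩, fun t => (hK2 t).ae_eq (hae t).symm⟩
  exact (condExp_congr_ae (hae t)).trans ((hK.2 s t hst).trans (hae s).symm)

end ScalarSolution

/-! ### Scalar feedback coefficients for the two horizons -/

section Coefficients

variable {δ b : ℝ}

/-- The square root of the shifted scalar coefficient. -/
def scalarRoot (δ b : ℝ) : ℝ := √(b + δ ^ 2 / 4)

lemma scalarRoot_sq (hb : 0 < b) : scalarRoot δ b ^ 2 = b + δ ^ 2 / 4 :=
  Real.sq_sqrt (by positivity)

lemma lt_scalarRoot (hb : 0 < b) : δ / 2 < scalarRoot δ b := by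
  refine Real.lt_sqrt_of_sq_lt ?_
  nlinarith

lemma scalarRoot_pos (hb : 0 < b) : 0 < scalarRoot δ b :=
  Real.sqrt_pos.2 (by positivity)

/-- With `k = √(b + δ²/4)`, the constant `k - δ/2` is the positive root of `F² + δF - b`.
Discounting by `δ/2` turns the decay rate `k - δ/2` of `m` into `k`, which is the rate of the
kernel. -/
lemma isFeedback_infinite (hb : 0 < b) :
    ∃ ε C, IsFeedback ∞ δ b (fun _ => scalarRoot δ b - δ / 2)
      (fun t => Real.exp (-(scalarRoot δ b - δ / 2) * t)) ε C := by
  refine ⟨scalarRoot δ b, max 1 |scalarRoot δ b - δ / 2|, fun t => Real.exp_pos _, fun t => ?_,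
    fun t => ?_, scalarRoot_pos hb, fun s t _ => ?_, fun t => le_max_right _ _,
    fun t ht => absurd ht ENNReal.ofReal_ne_top⟩
  · have := ((hasDerivAt_id t).const_mul (-(scalarRoot δ b - δ / 2))).exp
    simpa [mul_comm] using this
  · refine (hasDerivAt_const t _).congr_deriv ?_
    have := scalarRoot_sq (δ := δ) hb
    nlinarith
  · rw [← Real.exp_add, mul_assoc, ← Real.exp_add]
    have : -(δ / 2) * ((t : ℝ) - s) + -(scalarRoot δ b - δ / 2) * t =
        -(scalarRoot δ b * (t - s)) + -(scalarRoot δ b - δ / 2) * s := by ring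
    rw [this]
    exact le_mul_of_one_le_left (Real.exp_nonneg _) (le_max_left _ _)

/-- The scalar version of `Δ G - (δ/2) G'`. -/
def scalarWeight (δ b T t : ℝ) : ℝ :=
  (b + δ ^ 2 / 4) * Real.cosh (scalarRoot δ b * (T - t)) +
    δ / 2 * (scalarRoot δ b * Real.sinh (scalarRoot δ b * (T - t)))

/-- The scalar version of `F`. -/
def scalarF (δ b T t : ℝ) : ℝ :=
  b * (scalarRoot δ b * Real.sinh (scalarRoot δ b * (T - t))) / scalarWeight δ b T t

lemma scalarWeight_pos (hδ : 0 ≤ δ) (hb : 0 < b) (T t : ℝ) : 0 < scalarWeight δ b T t := by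
  have hk := scalarRoot_pos (δ := δ) hb
  have hlt := lt_scalarRoot (δ := δ) hb
  rw [scalarWeight, ← scalarRoot_sq hb]
  set y := scalarRoot δ b * (T - t)
  have h1 : |Real.sinh y| < Real.cosh y := by
    rw [abs_lt]
    constructor
    · have := Real.exp_pos y
      rw [← Real.cosh_add_sinh] at this
      linarith
    · exact Real.sinh_lt_cosh y
  have h2 := neg_abs_le (Real.sinh y)
  have h3 : 0 < scalarRoot δ b * Real.cosh y + δ / 2 * Real.sinh y := by
    have hc := Real.cosh_pos y
    nlinarith [abs_nonneg (Real.sinh y)]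
  nlinarith

lemma hasDerivAt_cosh_time (k T t : ℝ) :
    HasDerivAt (fun u => Real.cosh (k * (T - u))) (-(k * Real.sinh (k * (T - t)))) t := by
  have h : HasDerivAt (fun u : ℝ => k * (T - u)) (k * -1) t :=
    ((hasDerivAt_id t).const_sub T).const_mul k
  refine h.cosh.congr_deriv ?_
  ring

lemma hasDerivAt_sinh_time (k T t : ℝ) :
    HasDerivAt (fun u => Real.sinh (k * (T - u))) (-(k * Real.cosh (k * (T - t)))) t := by
  have h : HasDerivAt (fun u : ℝ => k * (T - u)) (k * -1) t :=
    ((hasDerivAt_id t).const_sub T).const_mul k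
  refine h.sinh.congr_deriv ?_
  ring

lemma hasDerivAt_scalarWeight (T t : ℝ) :
    HasDerivAt (scalarWeight δ b T)
      (-((b + δ ^ 2 / 4) * (scalarRoot δ b * Real.sinh (scalarRoot δ b * (T - t)))) -
        δ / 2 * (scalarRoot δ b ^ 2 * Real.cosh (scalarRoot δ b * (T - t)))) t := by
  have h1 := (hasDerivAt_cosh_time (scalarRoot δ b) T t).const_mul (b + δ ^ 2 / 4)
  have h2 := ((hasDerivAt_sinh_time (scalarRoot δ b) T t).const_mul (scalarRoot δ b)).const_mul
    (δ / 2)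
  refine (h1.add h2).congr_deriv ?_
  ring

lemma isFeedback_finite {T : ℝ≥0∞} (hT : T ≠ ∞) (hδ : 0 ≤ δ) (hb : 0 < b) :
    ∃ ε C, IsFeedback T δ b (scalarF δ b T.toReal)
      (fun t => Real.exp (δ / 2 * t) * scalarWeight δ b T.toReal t) ε C := by
  set T₀ := T.toReal with hT₀
  set m : ℝ → ℝ := fun t => Real.exp (δ / 2 * t) * scalarWeight δ b T₀ t with hm
  have hW := scalarWeight_pos hδ hb T₀
  have hk2 := scalarRoot_sq (δ := δ) hb
  have hpos : ∀ t, 0 < m t := fun t => mul_pos (Real.exp_pos _) (hW t)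
  have hdm : ∀ t, HasDerivAt m (-scalarF δ b T₀ t * m t) t := by
    intro t
    have he : HasDerivAt (fun t : ℝ => Real.exp (δ / 2 * t)) (δ / 2 * Real.exp (δ / 2 * t)) t := by
      have := ((hasDerivAt_id t).const_mul (δ / 2)).exp
      simpa [mul_comm] using this
    refine (he.mul (hasDerivAt_scalarWeight T₀ t)).congr_deriv ?_
    -- The factor `e^{δt/2}` in `m` contributes `(δ/2) W`. Its `cosh` term cancels that of `W'`, and
    -- `k² - δ²/4 = b` leaves only the `sinh` term that defines `F`.
    have hne := (hW t).ne'
    have e1 : -scalarF δ b T₀ t * m t = Real.exp (δ / 2 * t) *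
        (-(b * (scalarRoot δ b * Real.sinh (scalarRoot δ b * (T₀ - t))))) := by
      simp only [scalarF, hm]; field_simp
    rw [e1, scalarWeight, hk2]
    ring
  have hdF : ∀ t, HasDerivAt (scalarF δ b T₀)
      (scalarF δ b T₀ t ^ 2 + δ * scalarF δ b T₀ t - b) t := by
    intro t
    have hne := (hW t).ne'
    have h1 := ((hasDerivAt_sinh_time (scalarRoot δ b) T₀ t).const_mul
      (scalarRoot δ b)).const_mul b
    refine (h1.div (hasDerivAt_scalarWeight T₀ t) hne).congr_deriv ?_
    have e2 : Real.cosh (scalarRoot δ b * (T₀ - t)) = (scalarWeight δ b T₀ t -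
        δ / 2 * (scalarRoot δ b * Real.sinh (scalarRoot δ b * (T₀ - t)))) / (b + δ ^ 2 / 4) := by
      rw [eq_div_iff (by positivity), scalarWeight]; ring
    have e3 : scalarRoot δ b * -(scalarRoot δ b * Real.cosh (scalarRoot δ b * (T₀ - t))) =
        -(scalarWeight δ b T₀ t -
        δ / 2 * (scalarRoot δ b * Real.sinh (scalarRoot δ b * (T₀ - t)))) := by
      rw [scalarWeight, ← hk2]; ring
    have e4 : scalarRoot δ b ^ 2 * Real.cosh (scalarRoot δ b * (T₀ - t)) =
        scalarWeight δ b T₀ t -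
        δ / 2 * (scalarRoot δ b * Real.sinh (scalarRoot δ b * (T₀ - t))) := by
      rw [scalarWeight, ← hk2]; ring
    rw [e3, e4, scalarF]
    generalize scalarRoot δ b * Real.sinh (scalarRoot δ b * (T₀ - t)) = S at *
    generalize scalarWeight δ b T₀ t = W at *
    field_simp
    ring
  have hcm : Continuous m := continuous_iff_continuousAt.2 fun t => (hdm t).continuousAt
  have hcF : Continuous (scalarF δ b T₀) :=
    continuous_iff_continuousAt.2 fun t => (hdF t).continuousAt
  have hmem : ∀ t : Horizon T, (t : ℝ) ∈ Icc 0 T₀ := fun t =>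
    ⟨t.2.1, (ENNReal.ofReal_le_iff_le_toReal hT).1 t.2.2⟩
  obtain ⟨C₁, hC₁⟩ := (isCompact_Icc (a := (0 : ℝ)) (b := T₀)).exists_bound_of_continuousOn
    hcm.continuousOn
  have hcinv : Continuous fun t => (m t)⁻¹ := hcm.inv₀ fun t => (hpos t).ne'
  obtain ⟨C₂, hC₂⟩ := (isCompact_Icc (a := (0 : ℝ)) (b := T₀)).exists_bound_of_continuousOn
    hcinv.continuousOn
  obtain ⟨C₃, hC₃⟩ := (isCompact_Icc (a := (0 : ℝ)) (b := T₀)).exists_bound_of_continuousOn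
    hcF.continuousOn
  -- On a compact horizon the decay bound carries no information about decay: any rate would do,
  -- with `e^{T₀}` absorbing the exponential, `C₁` and `C₂` bounding `m` and its inverse, and `C₃`
  -- bounding `F`.
  refine ⟨1, max (C₁ * C₂ * Real.exp T₀) C₃, hpos, hdm, hdF, one_pos, fun s t hst => ?_,
    fun t => (hC₃ t (hmem t)).trans (le_max_right _ _), fun t ht => ?_⟩
  · have hst' : (s : ℝ) ≤ t := hst
    have h1 : m t ≤ C₁ := (le_abs_self _).trans (hC₁ t (hmem t))
    have h2 : (m s)⁻¹ ≤ C₂ := (le_abs_self _).trans (hC₂ s (hmem s))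
    have h3 : 1 ≤ C₂ * m s := by
      rwa [inv_le_iff_one_le_mul₀ (hpos s)] at h2
    have hC₁0 : 0 ≤ C₁ := (hpos t).le.trans h1
    have h4 : 1 ≤ Real.exp T₀ * Real.exp (-(1 * ((t : ℝ) - s))) := by
      rw [← Real.exp_add]
      refine Real.one_le_exp ?_
      have := (hmem t).2
      have := s.2.1
      linarith
    have h5 : Real.exp (-(δ / 2) * ((t : ℝ) - s)) ≤ 1 := by
      rw [Real.exp_le_one_iff]
      nlinarith
    calc Real.exp (-(δ / 2) * ((t : ℝ) - s)) * m t ≤ 1 * C₁ :=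
          mul_le_mul h5 h1 (hpos t).le zero_le_one
      _ ≤ C₁ * (C₂ * m s) * (Real.exp T₀ * Real.exp (-(1 * ((t : ℝ) - s)))) := by
          rw [one_mul]
          have h6 : C₁ ≤ C₁ * (C₂ * m s) := le_mul_of_one_le_right hC₁0 h3
          exact h6.trans (le_mul_of_one_le_right (hC₁0.trans h6) h4)
      _ = (C₁ * C₂ * Real.exp T₀) * Real.exp (-(1 * ((t : ℝ) - s))) * m s := by ring
      _ ≤ _ := by
          refine mul_le_mul_of_nonneg_right ?_ (hpos s).le
          exact mul_le_mul_of_nonneg_right (le_max_left _ _) (Real.exp_nonneg _)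
  · have : (t : ℝ) = T₀ := by
      have h := congrArg ENNReal.toReal ht
      rwa [ENNReal.toReal_ofReal t.2.1] at h
    simp [scalarF, this]

end Coefficients

/-! ### Simultaneous diagonalization -/

section Diagonalization

variable {d : ℕ}

/-- `B = V diag(b) Vi` with `Vi = V⁻¹` and positive eigenvalues `b`. -/
structure IsDiagonalization (B V Vi : Matrix (Fin d) (Fin d) ℝ) (b : Fin d → ℝ) : Prop where
  mul_inv : V * Vi = 1
  inv_mul : Vi * V = 1
  eq : B = V * diagonal b * Vi
  pos : ∀ i, 0 < b i

/-- `Λ⁻¹Σ` is not symmetric, but conjugating by `Λ^{1/2}` turns `(γ/2) Λ⁻¹Σ` into `Λ^{-1/2} (γ/2) Σ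
Λ^{-1/2}`, which is symmetric positive definite. If `U` is an orthogonal eigenbasis of the latter,
then `V = Λ^{-1/2} U` diagonalizes `B` with inverse `Uᵀ Λ^{1/2}`. -/
lemma exists_diagonalization {σ S L : Matrix (Fin d) (Fin d) ℝ} (hS : S = σ * σᵀ)
    (hSdet : S.det ≠ 0) {lam : Fin d → ℝ} (hlam : ∀ i, 0 < lam i) (hL : L = diagonal lam)
    {γ : ℝ} (hγ : 0 < γ) :
    ∃ V Vi b, IsDiagonalization (coeff γ S L) V Vi b := by
  have hsq : ∀ i, √(lam i) * √(lam i) = lam i := fun i => Real.mul_self_sqrt (hlam i).le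
  have hne : ∀ i, √(lam i) ≠ 0 := fun i => (Real.sqrt_pos.2 (hlam i)).ne'
  set H : Matrix (Fin d) (Fin d) ℝ := diagonal fun i => √(lam i) with hH
  set Hi : Matrix (Fin d) (Fin d) ℝ := diagonal fun i => (√(lam i))⁻¹ with hHi
  have hHH : Hi * H = 1 := by simp [hH, hHi, hne]
  have hHH' : H * Hi = 1 := by simp [hH, hHi, hne]
  have hLi : L⁻¹ = Hi * Hi := by
    refine inv_eq_right_inv ?_
    rw [hL, hHi, diagonal_mul_diagonal, diagonal_mul_diagonal, ← diagonal_one]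
    congr 1
    ext i
    have := hne i
    nth_rewrite 1 [← hsq i]
    field_simp
  have hSp : S.PosDef := by
    have h1 : S.PosSemidef := by
      rw [hS, ← conjTranspose_eq_transpose_of_trivial]
      exact posSemidef_self_mul_conjTranspose σ
    exact h1.posDef_iff_isUnit.2 ((isUnit_iff_isUnit_det S).2 (isUnit_iff_ne_zero.2 hSdet))
  have hK : (Hi * ((γ / 2) • S) * Hi).PosDef := by
    have h1 : ((γ / 2) • S).PosDef := hSp.smul (half_pos hγ)
    have h2 := h1.conjTranspose_mul_mul_same (B := Hi) (by
      intro v w hvw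
      have := congrArg (fun z => H *ᵥ z) hvw
      simpa [mulVec_mulVec, hHH'] using this)
    have h3 : Hiᴴ = Hi := by rw [hHi, diagonal_conjTranspose]; rfl
    rwa [h3] at h2
  set U := hK.1.eigenvectorUnitary
  have hU1 : (U : Matrix (Fin d) (Fin d) ℝ) * star (U : Matrix (Fin d) (Fin d) ℝ) = 1 :=
    Unitary.coe_mul_star_self U
  have hU2 : star (U : Matrix (Fin d) (Fin d) ℝ) * (U : Matrix (Fin d) (Fin d) ℝ) = 1 :=
    Unitary.coe_star_mul_self U
  have hspec := hK.1.spectral_theorem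
  rw [Unitary.conjStarAlgAut_apply] at hspec
  refine ⟨Hi * U, star (U : Matrix (Fin d) (Fin d) ℝ) * H, hK.1.eigenvalues, ?_, ?_, ?_,
    hK.eigenvalues_pos⟩
  · rw [Matrix.mul_assoc, ← Matrix.mul_assoc (U : Matrix (Fin d) (Fin d) ℝ), hU1,
      Matrix.one_mul, hHH]
  · rw [Matrix.mul_assoc, ← Matrix.mul_assoc H, hHH', Matrix.one_mul, hU2]
  · have hspec' : Hi * ((γ / 2) • S) * Hi = (U : Matrix (Fin d) (Fin d) ℝ) *
        diagonal hK.1.eigenvalues * star (U : Matrix (Fin d) (Fin d) ℝ) := by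
      conv_lhs => rw [hspec]
      rfl
    calc coeff γ S L = Hi * (Hi * ((γ / 2) • S) * Hi) * H := by
          rw [coeff, hLi]
          simp only [Matrix.mul_assoc, hHH, Matrix.mul_one, Matrix.mul_smul]
      _ = Hi * ((U : Matrix (Fin d) (Fin d) ℝ) *
          diagonal hK.1.eigenvalues * star (U : Matrix (Fin d) (Fin d) ℝ)) * H :=
          congrArg (fun Z => Hi * Z * H) hspec'
      _ = _ := by simp only [Matrix.mul_assoc]

/-- The matrix with eigenvalues `f` in the basis `V`. -/
def conjDiag (V Vi : Matrix (Fin d) (Fin d) ℝ) (f : Fin d → ℝ) : Matrix (Fin d) (Fin d) ℝ :=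
  V * diagonal f * Vi

variable {V Vi B : Matrix (Fin d) (Fin d) ℝ} {b : Fin d → ℝ}

/-- First rule of the functional calculus in a fixed eigenbasis. Together with the rules for sums,
scalars, inverses, powers and exponentials, it reduces each explicit matrix formula to an identity
between scalar functions of the eigenvalues. -/
lemma conjDiag_mul (h : Vi * V = 1) (f g : Fin d → ℝ) :
    conjDiag V Vi f * conjDiag V Vi g = conjDiag V Vi (fun i => f i * g i) := by
  rw [conjDiag, conjDiag, conjDiag, ← diagonal_mul_diagonal]
  simp only [Matrix.mul_assoc]
  rw [← Matrix.mul_assoc Vi V, h, Matrix.one_mul]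

lemma conjDiag_one (h : V * Vi = 1) : conjDiag V Vi (fun _ => 1) = 1 := by
  rw [conjDiag, diagonal_one, Matrix.mul_one, h]

lemma conjDiag_add (f g : Fin d → ℝ) :
    conjDiag V Vi f + conjDiag V Vi g = conjDiag V Vi (fun i => f i + g i) := by
  rw [conjDiag, conjDiag, conjDiag, ← diagonal_add, Matrix.mul_add, Matrix.add_mul]

lemma conjDiag_smul (c : ℝ) (f : Fin d → ℝ) :
    c • conjDiag V Vi f = conjDiag V Vi (fun i => c * f i) := by
  have : diagonal (fun i => c * f i) = c • diagonal f := by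
    ext i j; by_cases hij : i = j <;> simp [hij]
  rw [conjDiag, conjDiag, this, Matrix.mul_smul, Matrix.smul_mul]

lemma conjDiag_neg (f : Fin d → ℝ) :
    -conjDiag V Vi f = conjDiag V Vi (fun i => -f i) := by
  simpa using conjDiag_smul (V := V) (Vi := Vi) (-1) f

lemma conjDiag_sub (f g : Fin d → ℝ) :
    conjDiag V Vi f - conjDiag V Vi g = conjDiag V Vi (fun i => f i - g i) := by
  rw [sub_eq_add_neg, conjDiag_neg, conjDiag_add]; rfl

lemma conjDiag_scalar (h : V * Vi = 1) (c : ℝ) :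
    c • (1 : Matrix (Fin d) (Fin d) ℝ) = conjDiag V Vi (fun _ => c) := by
  rw [← conjDiag_one h, conjDiag_smul]; simp

lemma conjDiag_mul_inv (h : V * Vi = 1) (h' : Vi * V = 1) {f : Fin d → ℝ} (hf : ∀ i, f i ≠ 0) :
    conjDiag V Vi f * conjDiag V Vi (fun i => (f i)⁻¹) = 1 := by
  rw [conjDiag_mul h', ← conjDiag_one h]
  congr 1
  ext i
  exact mul_inv_cancel₀ (hf i)

lemma conjDiag_inv (h : V * Vi = 1) (h' : Vi * V = 1) {f : Fin d → ℝ} (hf : ∀ i, f i ≠ 0) :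
    (conjDiag V Vi f)⁻¹ = conjDiag V Vi (fun i => (f i)⁻¹) :=
  inv_eq_right_inv (conjDiag_mul_inv h h' hf)

lemma conjDiag_exp (h : V * Vi = 1) (h' : Vi * V = 1) (f : Fin d → ℝ) :
    NormedSpace.exp (conjDiag V Vi f) = conjDiag V Vi (fun i => Real.exp (f i)) := by
  have hinv : V⁻¹ = Vi := inv_eq_right_inv h
  have hu : IsUnit V := ⟨⟨V, Vi, h, h'⟩, rfl⟩
  rw [conjDiag, ← hinv, Matrix.exp_conj V _ hu, Matrix.exp_diagonal, conjDiag]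
  congr 3
  ext i
  rw [Pi.coe_exp, Real.exp_eq_exp_ℝ]

lemma conjDiag_apply (f : Fin d → ℝ) (i j : Fin d) :
    conjDiag V Vi f i j = ∑ l, V i l * f l * Vi l j := by
  simp [conjDiag, Matrix.mul_apply, Matrix.diagonal_apply]

lemma conjDiag_mulVec (f : Fin d → ℝ) (v : Fin d → ℝ) :
    conjDiag V Vi f *ᵥ v = V *ᵥ (fun i => f i * (Vi *ᵥ v) i) := by
  rw [conjDiag, ← mulVec_mulVec, ← mulVec_mulVec]
  congr 1
  ext i
  rw [mulVec_diagonal]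

lemma conjDiag_pow (h : V * Vi = 1) (h' : Vi * V = 1) (f : Fin d → ℝ) (n : ℕ) :
    conjDiag V Vi f ^ n = conjDiag V Vi (fun i => f i ^ n) := by
  induction n with
  | zero => simp [conjDiag_one h]
  | succ n ih => rw [pow_succ, ih, conjDiag_mul h']; rfl

lemma IsDiagonalization.eq_conjDiag (h : IsDiagonalization B V Vi b) : B = conjDiag V Vi b := h.eq

lemma IsDiagonalization.shifted_eq (h : IsDiagonalization B V Vi b) (δ : ℝ) :
    shifted δ B = conjDiag V Vi (fun i => b i + δ ^ 2 / 4) := by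
  rw [shifted, h.eq_conjDiag, conjDiag_scalar h.mul_inv, conjDiag_add]

/-- On an eigenvector of eigenvalue `k²` the series has terms `(k (T - t))^{2n} / (2n)!`, the power
series of `cosh`. -/
lemma IsDiagonalization.G_eq (h : IsDiagonalization B V Vi b) (δ T t : ℝ) :
    G (shifted δ B) T t =
      conjDiag V Vi (fun i => Real.cosh (scalarRoot δ (b i) * (T - t))) := by
  refine HasSum.tsum_eq ?_
  have h1 : HasSum (fun (n : ℕ) (i : Fin d) =>
      (scalarRoot δ (b i) * (T - t)) ^ (2 * n) / ((2 * n).factorial : ℝ))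
      (fun i => Real.cosh (scalarRoot δ (b i) * (T - t))) :=
    Pi.hasSum.2 fun i => Real.hasSum_cosh _
  have h2 := (h1.matrix_diagonal.mul_left V).mul_right Vi
  refine h2.congr_fun ?_
  intro n
  rw [h.shifted_eq, conjDiag_pow h.mul_inv h.inv_mul, conjDiag_smul]
  change _ = conjDiag V Vi _
  congr 1
  ext i
  rw [mul_pow, pow_mul (scalarRoot δ (b i)), scalarRoot_sq (h.pos i)]
  ring

lemma IsDiagonalization.Gdot_eq (h : IsDiagonalization B V Vi b) (δ T t : ℝ) :
    Gdot (shifted δ B) T t = conjDiag V Vi (fun i =>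
      -(scalarRoot δ (b i) * Real.sinh (scalarRoot δ (b i) * (T - t)))) := by
  ext i j
  simp only [Gdot, of_apply, h.G_eq, conjDiag_apply]
  refine HasDerivAt.deriv ?_
  exact HasDerivAt.fun_sum fun l _ =>
    ((hasDerivAt_cosh_time _ T t).const_mul (V i l)).mul_const (Vi l j)

lemma IsDiagonalization.weight_eq (h : IsDiagonalization B V Vi b) (δ T t : ℝ) :
    weight δ B T t = conjDiag V Vi (fun i => scalarWeight δ (b i) T t) := by
  rw [weight, h.G_eq, h.Gdot_eq, h.shifted_eq, conjDiag_mul h.inv_mul, conjDiag_smul, conjDiag_sub]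
  congr 1
  ext i
  simp only [scalarWeight]
  ring

lemma IsDiagonalization.weight_inv (h : IsDiagonalization B V Vi b) {δ : ℝ} (hδ : 0 ≤ δ)
    (T t : ℝ) : (weight δ B T t)⁻¹ = conjDiag V Vi (fun i => (scalarWeight δ (b i) T t)⁻¹) := by
  rw [h.weight_eq, conjDiag_inv h.mul_inv h.inv_mul]
  exact fun i => (scalarWeight_pos hδ (h.pos i) T t).ne'

lemma IsDiagonalization.isUnit_weight (h : IsDiagonalization B V Vi b) {δ : ℝ} (hδ : 0 ≤ δ)
    (T t : ℝ) : IsUnit (weight δ B T t) := by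
  have hne : ∀ i, scalarWeight δ (b i) T t ≠ 0 := fun i => (scalarWeight_pos hδ (h.pos i) T t).ne'
  rw [h.weight_eq]
  refine ⟨⟨_, _, conjDiag_mul_inv h.mul_inv h.inv_mul hne, ?_⟩, rfl⟩
  rw [conjDiag_mul h.inv_mul, ← conjDiag_one h.mul_inv]
  congr 1
  ext i
  exact inv_mul_cancel₀ (hne i)

lemma IsDiagonalization.F_eq (h : IsDiagonalization B V Vi b) {δ : ℝ} (hδ : 0 ≤ δ)
    (T t : ℝ) : F δ B T t = conjDiag V Vi (fun i => scalarF δ (b i) T t) := by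
  rw [F, h.weight_inv hδ, h.Gdot_eq]
  conv_lhs => rw [h.eq_conjDiag]
  rw [conjDiag_mul h.inv_mul, conjDiag_mul h.inv_mul, conjDiag_neg]
  congr 1
  ext i
  simp only [scalarF]
  ring

/-- Because `m' = -F m`, the function `-log m` is a primitive of `F`. -/
lemma integral_feedback {T : ℝ≥0∞} {δ b : ℝ} {F m : ℝ → ℝ} {ε C : ℝ}
    (h : IsFeedback T δ b F m ε C) (s t : ℝ) :
    Real.exp (-∫ u in s..t, F u) = m t * (m s)⁻¹ := by
  have h1 : ∀ u, HasDerivAt (fun u => -Real.log (m u)) (F u) u := fun u => by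
    refine ((h.deriv_m u).log (h.pos u).ne').neg.congr_deriv ?_
    have := (h.pos u).ne'
    field_simp
  rw [intervalIntegral.integral_eq_sub_of_hasDerivAt (fun u _ => h1 u)
    (h.continuous_F.intervalIntegrable _ _)]
  rw [neg_sub, sub_neg_eq_add, neg_add_eq_sub, Real.exp_sub, Real.exp_log (h.pos t),
    Real.exp_log (h.pos s), div_eq_mul_inv]

/-- The matrices `F(u)` share the eigenbasis `V`, so the exponential of their integral is computed
eigenvalue by eigenvalue and no time ordering arises. -/
lemma IsDiagonalization.exp_intF_eq (h : IsDiagonalization B V Vi b) {δ : ℝ} (hδ : 0 ≤ δ)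
    {T : ℝ≥0∞} (hT : T ≠ ∞) (s t : ℝ) :
    NormedSpace.exp (-(intF δ B T.toReal s t)) = conjDiag V Vi (fun i =>
      (Real.exp (δ / 2 * t) * scalarWeight δ (b i) T.toReal t) *
      (Real.exp (δ / 2 * s) * scalarWeight δ (b i) T.toReal s)⁻¹) := by
  have hc : ∀ i, Continuous (scalarF δ (b i) T.toReal) := fun i => by
    obtain ⟨ε, C, hf⟩ := isFeedback_finite hT hδ (h.pos i)
    exact hf.continuous_F
  have h1 : intF δ B T.toReal s t =
      conjDiag V Vi (fun i => ∫ u in s..t, scalarF δ (b i) T.toReal u) := by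
    ext i j
    simp only [intF, of_apply, h.F_eq hδ, conjDiag_apply]
    rw [intervalIntegral.integral_finsetSum]
    · simp only [intervalIntegral.integral_mul_const, intervalIntegral.integral_const_mul]
    · intro l _
      exact ((continuous_const.mul (hc l)).mul continuous_const).intervalIntegrable _ _
  rw [h1, conjDiag_neg, conjDiag_exp h.mul_inv h.inv_mul]
  congr 1
  ext i
  obtain ⟨ε, C, hf⟩ := isFeedback_finite hT hδ (h.pos i)
  exact integral_feedback hf s t

/-- The principal square root of the shifted matrix. -/
lemma IsDiagonalization.isPrincipalSqrt (h : IsDiagonalization B V Vi b) (δ : ℝ) :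
    IsPrincipalSqrt (shifted δ B) (conjDiag V Vi fun i => scalarRoot δ (b i)) := by
  refine ⟨?_, fun z hz => ?_⟩
  · rw [conjDiag_mul h.inv_mul, h.shifted_eq]
    congr 1
    ext i
    rw [← sq, scalarRoot_sq (h.pos i)]
  · by_contra hcon
    have hne : ∀ i, z - (scalarRoot δ (b i) : ℂ) ≠ 0 := by
      intro i hi
      refine hcon ?_
      rw [sub_eq_zero.1 hi]
      exact ⟨by simpa using scalarRoot_pos (h.pos i), by simp⟩
    refine (spectrum.mem_iff.1 hz) ?_
    have e1 : (conjDiag V Vi fun i => scalarRoot δ (b i)).map (algebraMap ℝ ℂ) =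
        V.map (algebraMap ℝ ℂ) * diagonal (fun i => (scalarRoot δ (b i) : ℂ)) *
          Vi.map (algebraMap ℝ ℂ) := by
      rw [conjDiag, Matrix.map_mul, Matrix.map_mul, diagonal_map (by simp)]
      rfl
    have hVV : V.map (algebraMap ℝ ℂ) * Vi.map (algebraMap ℝ ℂ) = 1 := by
      rw [← Matrix.map_mul, h.mul_inv, Matrix.map_one _ (by simp) (by simp)]
    have hVV' : Vi.map (algebraMap ℝ ℂ) * V.map (algebraMap ℝ ℂ) = 1 := by
      rw [← Matrix.map_mul, h.inv_mul, Matrix.map_one _ (by simp) (by simp)]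
    have e2 : (algebraMap ℂ (Matrix (Fin d) (Fin d) ℂ)) z -
        (conjDiag V Vi fun i => scalarRoot δ (b i)).map (algebraMap ℝ ℂ) =
        V.map (algebraMap ℝ ℂ) * diagonal (fun i => z - (scalarRoot δ (b i) : ℂ)) *
          Vi.map (algebraMap ℝ ℂ) := by
      have : diagonal (fun i => z - (scalarRoot δ (b i) : ℂ)) =
          z • (1 : Matrix (Fin d) (Fin d) ℂ) - diagonal (fun i => (scalarRoot δ (b i) : ℂ)) := by
        rw [smul_one_eq_diagonal, diagonal_sub]
      rw [e1, this, Matrix.mul_sub, Matrix.sub_mul, Matrix.mul_smul, Matrix.mul_one,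
        Matrix.smul_mul, hVV, Algebra.algebraMap_eq_smul_one]
    rw [e2]
    have hD : IsUnit (diagonal (fun i => z - (scalarRoot δ (b i) : ℂ))) := by
      rw [isUnit_iff_isUnit_det, det_diagonal, isUnit_iff_ne_zero]
      exact Finset.prod_ne_zero_iff.2 fun i _ => hne i
    exact (IsUnit.mul ⟨⟨_, _, hVV, hVV'⟩, rfl⟩ hD).mul ⟨⟨_, _, hVV', hVV⟩, rfl⟩

/-- All eigenvalues of `R` have positive real part, so `-k` is not one of them; the determinant
carries this from complex back to real matrices. -/
lemma IsPrincipalSqrt.isUnit_add {D R : Matrix (Fin d) (Fin d) ℝ} (h : IsPrincipalSqrt D R)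
    {k : ℝ} (hk : 0 < k) : IsUnit (R + k • (1 : Matrix (Fin d) (Fin d) ℝ)) := by
  have h1 : (-k : ℂ) ∉ spectrum ℂ (R.map (algebraMap ℝ ℂ)) := fun hz => by
    have := (h.2 _ hz).1
    simp at this
    linarith
  have h2 := spectrum.notMem_iff.1 h1
  rw [isUnit_iff_isUnit_det, isUnit_iff_ne_zero] at h2 ⊢
  intro h0
  refine h2 ?_
  have e : (algebraMap ℂ (Matrix (Fin d) (Fin d) ℂ)) (-k) - R.map (algebraMap ℝ ℂ) =
      -((R + k • (1 : Matrix (Fin d) (Fin d) ℝ)).map (algebraMap ℝ ℂ)) := by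
    ext i j
    by_cases hij : i = j
    · subst hij
      simp [Algebra.algebraMap_eq_smul_one]
      ring
    · simp [Algebra.algebraMap_eq_smul_one, hij]
  rw [e, det_neg]
  have : ((R + k • (1 : Matrix (Fin d) (Fin d) ℝ)).map (algebraMap ℝ ℂ)).det =
      algebraMap ℝ ℂ (R + k • (1 : Matrix (Fin d) (Fin d) ℝ)).det :=
    (RingHom.map_det (algebraMap ℝ ℂ) _).symm
  rw [this, h0]
  simp

/-- With `K` the diagonal of scalar roots, `X = RV - VK` solves the Sylvester equation `RX + XK =
0`, because `R²V = VK²`. Its `j`-th column is annihilated by the invertible matrix `R + k_j`, so `X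
= 0`. -/
lemma IsDiagonalization.principalSqrt_unique (h : IsDiagonalization B V Vi b) {δ : ℝ}
    {R : Matrix (Fin d) (Fin d) ℝ} (hR : IsPrincipalSqrt (shifted δ B) R) :
    R = conjDiag V Vi fun i => scalarRoot δ (b i) := by
  set k : Fin d → ℝ := fun i => scalarRoot δ (b i) with hk
  set X := R * V - V * diagonal k with hX
  have hsq : R * R * V = V * (diagonal k * diagonal k) := by
    rw [hR.1, h.shifted_eq, conjDiag, Matrix.mul_assoc, h.inv_mul, Matrix.mul_one,
      diagonal_mul_diagonal]
    congr 2
    ext i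
    rw [hk, ← sq, scalarRoot_sq (h.pos i)]
  have hX0 : R * X + X * diagonal k = 0 := by
    rw [hX, Matrix.mul_sub, Matrix.sub_mul, ← Matrix.mul_assoc R R V, hsq]
    simp only [Matrix.mul_assoc]
    abel
  have hcol : ∀ j, (fun i => X i j) = 0 := by
    intro j
    obtain ⟨u, hu⟩ := hR.isUnit_add (scalarRoot_pos (δ := δ) (h.pos j))
    have h1 : (R + scalarRoot δ (b j) • (1 : Matrix (Fin d) (Fin d) ℝ)) *ᵥ (fun i => X i j) = 0 := by
      rw [add_mulVec, smul_mulVec, one_mulVec]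
      ext i
      have := congrFun (congrFun hX0 i) j
      simp only [Matrix.add_apply, mul_diagonal, Matrix.zero_apply] at this
      simp only [Pi.add_apply, Pi.smul_apply, smul_eq_mul, Pi.zero_apply]
      rw [← this, Matrix.mul_apply, mulVec, dotProduct, hk, mul_comm (X i j)]
    have h2 := congrArg (fun z => (↑u⁻¹ : Matrix (Fin d) (Fin d) ℝ) *ᵥ z) h1
    simpa [← hu, mulVec_mulVec] using h2
  have hXz : X = 0 := by
    ext i j
    exact congrFun (hcol j) i
  have hRV : R * V = V * diagonal k := sub_eq_zero.1 hXz
  calc R = R * V * Vi := by rw [Matrix.mul_assoc, h.mul_inv, Matrix.mul_one]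
    _ = V * diagonal k * Vi := by rw [hRV]

end Diagonalization

/-! ### Vector valued processes -/

section Vector

variable {T : ℝ≥0∞} {d : ℕ} {Ω : Type*} [mΩ : MeasurableSpace Ω]

/-- Multiplication by a matrix as a continuous linear map. -/
def mulVecCLM (A : Matrix (Fin d) (Fin d) ℝ) : (Fin d → ℝ) →L[ℝ] (Fin d → ℝ) :=
  LinearMap.toContinuousLinearMap (Matrix.mulVecLin A)

@[simp] lemma mulVecCLM_apply (A : Matrix (Fin d) (Fin d) ℝ) (v : Fin d → ℝ) :
    mulVecCLM A v = A *ᵥ v := rfl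

lemma integral_mulVec_pi {α : Type*} [MeasurableSpace α] {m : Measure α}
    (A : Matrix (Fin d) (Fin d) ℝ) {f : Fin d → α → ℝ} (hf : ∀ i, Integrable (f i) m) :
    ∫ a, A *ᵥ (fun i => f i a) ∂m = A *ᵥ fun i => ∫ a, f i a ∂m := by
  have h1 : Integrable (fun a i => f i a) m := Integrable.of_eval hf
  have h2 := (mulVecCLM A).integral_comp_comm h1
  simp only [mulVecCLM_apply] at h2
  rw [h2]
  congr 1
  ext i
  exact eval_integral hf i

variable {P : Measure Ω} {𝓕 : Filtration (Horizon T) mΩ} {δ : ℝ}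

lemma ae_prod_of_ae [SFinite P] {p : Ω → Prop} (h : ∀ᵐ ω ∂P, p ω) :
    ∀ᵐ z ∂((volume : Measure (Horizon T)).prod P), p z.2 :=
  Measure.quasiMeasurePreserving_snd.ae h

lemma memL2_add [SFinite P] {X Y : VecProcess T Ω d} (hX : MemL2 P 𝓕 δ X) (hY : MemL2 P 𝓕 δ Y) :
    MemL2 P 𝓕 δ fun t ω => X t ω + Y t ω :=
  memL2_iff_scalar.2 fun i => (memL2_iff_scalar.1 hX i).add (memL2_iff_scalar.1 hY i)

lemma memL2_sub [SFinite P] {X Y : VecProcess T Ω d} (hX : MemL2 P 𝓕 δ X) (hY : MemL2 P 𝓕 δ Y) :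
    MemL2 P 𝓕 δ fun t ω => X t ω - Y t ω :=
  memL2_iff_scalar.2 fun i => (memL2_iff_scalar.1 hX i).sub (memL2_iff_scalar.1 hY i)

lemma memL2_smul [SFinite P] {X : VecProcess T Ω d} (c : ℝ) (hX : MemL2 P 𝓕 δ X) :
    MemL2 P 𝓕 δ fun t ω => c • X t ω :=
  memL2_iff_scalar.2 fun i => (memL2_iff_scalar.1 hX i).const_mul c

lemma scalarL2_mulVec (A : Matrix (Fin d) (Fin d) ℝ) {X : Fin d → Horizon T → Ω → ℝ}
    (hX : ∀ i, ScalarL2 P 𝓕 δ (X i)) (i : Fin d) :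
    ScalarL2 P 𝓕 δ fun t ω => (A *ᵥ fun j => X j t ω) i :=
  scalarL2_sum Finset.univ fun j _ => (hX j).const_mul (A i j)

lemma memL2_mulVec_pi [SFinite P] (A : Matrix (Fin d) (Fin d) ℝ) {X : Fin d → Horizon T → Ω → ℝ}
    (hX : ∀ i, ScalarL2 P 𝓕 δ (X i)) : MemL2 P 𝓕 δ fun t ω => A *ᵥ fun j => X j t ω :=
  memL2_iff_scalar.2 fun i => scalarL2_mulVec A hX i

lemma memL2_mulVec [SFinite P] (A : Matrix (Fin d) (Fin d) ℝ) {X : VecProcess T Ω d}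
    (hX : MemL2 P 𝓕 δ X) : MemL2 P 𝓕 δ fun t ω => A *ᵥ X t ω :=
  memL2_mulVec_pi A (memL2_iff_scalar.1 hX)

lemma memL2_congr_ae [SFinite P] {X Y : VecProcess T Ω d} (hX : MemL2 P 𝓕 δ X)
    (hY : IsStronglyProgressive 𝓕 Y)
    (h : ∀ᵐ p ∂((volume : Measure (Horizon T)).prod P), X p.1 p.2 = Y p.1 p.2) :
    MemL2 P 𝓕 δ Y := by
  refine memL2_iff_scalar.2 fun i => (memL2_iff_scalar.1 hX i).congr_ae
    (progressive_pi_iff.1 hY i) ?_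
  filter_upwards [h] with p hp
  rw [hp]

lemma MemL2.ae_integrableOn [IsFiniteMeasure P] {X : VecProcess T Ω d} (hX : MemL2 P 𝓕 δ X) :
    ∀ᵐ ω ∂P, ∀ t, IntegrableOn (fun s => X s ω) (Iic t) := by
  filter_upwards [ae_all_iff.2 fun i => (memL2_iff_scalar.1 hX i).ae_integrableOn] with ω hω t
  exact Integrable.of_eval fun i => hω i t

lemma MemL2.integrable_dotProduct [SFinite P] {X Y : VecProcess T Ω d} (hX : MemL2 P 𝓕 δ X)
    (hY : MemL2 P 𝓕 δ Y) :
    Integrable (fun p : Horizon T × Ω => Real.exp (-δ * p.1) * (X p.1 p.2 ⬝ᵥ Y p.1 p.2))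
      ((volume : Measure (Horizon T)).prod P) := by
  simp only [dotProduct, Finset.mul_sum]
  exact integrable_finsetSum _ fun i _ =>
    (memL2_iff_scalar.1 hX i).integrable_mul (memL2_iff_scalar.1 hY i)

lemma condExp_mulVec_pi {m : MeasurableSpace Ω} (A : Matrix (Fin d) (Fin d) ℝ)
    {f : Fin d → Ω → ℝ} (hf : ∀ i, Integrable (f i) P) :
    P[fun ω => A *ᵥ (fun i => f i ω) | m] =ᵐ[P] fun ω => A *ᵥ fun i => (P[f i | m]) ω := by
  have h1 : Integrable (fun ω i => f i ω) P := Integrable.of_eval hf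
  have h2 := (mulVecCLM A).comp_condExp_comm h1 (m := m)
  have h3 : ∀ i, ∀ᵐ ω ∂P, (P[fun ω i => f i ω | m]) ω i = (P[f i | m]) ω := fun i => by
    exact (ContinuousLinearMap.proj (R := ℝ) (φ := fun _ : Fin d => ℝ) i).comp_condExp_comm h1
  filter_upwards [h2, ae_all_iff.2 h3] with ω hω h4
  have h5 : (P[fun ω => A *ᵥ (fun i => f i ω) | m]) ω =
      A *ᵥ (P[fun ω i => f i ω | m]) ω := hω.symm
  rw [h5]
  congr 1
  ext i
  exact h4 i

lemma martingale_mulVec_pi (A : Matrix (Fin d) (Fin d) ℝ) {M : Fin d → Horizon T → Ω → ℝ}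
    [IsFiniteMeasure P] (hM : ∀ i, Martingale (M i) 𝓕 P) :
    Martingale (fun t ω => A *ᵥ fun i => M i t ω) 𝓕 P := by
  refine ⟨fun t => ?_, fun s t hst => ?_⟩
  · exact (mulVecCLM A).continuous.comp_stronglyMeasurable
      (@stronglyMeasurable_of_coordinates Ω (𝓕 t) d (fun ω i => M i t ω) fun i => (hM i).1 t)
  · refine (condExp_mulVec_pi A fun i => (hM i).integrable t).trans ?_
    filter_upwards [ae_all_iff.2 fun i => (hM i).2 s t hst] with ω hω
    congr 1
    ext i
    exact hω i

lemma martingale_eval {M : VecProcess T Ω d} (hM : Martingale M 𝓕 P) (i : Fin d) :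
    Martingale (fun t ω => M t ω i) 𝓕 P := by
  refine ⟨fun t => ?_, fun s t hst => ?_⟩
  · exact (ContinuousLinearMap.proj (R := ℝ) (φ := fun _ : Fin d => ℝ)
      i).continuous.comp_stronglyMeasurable (hM.1 t)
  · have h := (ContinuousLinearMap.proj (R := ℝ) (φ := fun _ : Fin d => ℝ)
      i).comp_condExp_comm (hM.integrable t) (m := 𝓕 s)
    refine h.symm.trans ?_
    filter_upwards [hM.2 s t hst] with ω hω
    simp [hω]

end Vector

/-! ### The solution generated by a signal -/

section SignalSolution

variable {T : ℝ≥0∞} {d : ℕ} {Ω : Type*}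
  {B V Vi : Matrix (Fin d) (Fin d) ℝ} {b : Fin d → ℝ} {Fs ms : Fin d → ℝ → ℝ}
  {ξ x : VecProcess T Ω d}

/-- The position generated by a signal. -/
def modalPosition (V Vi : Matrix (Fin d) (Fin d) ℝ) (ms : Fin d → ℝ → ℝ)
    (x : VecProcess T Ω d) : VecProcess T Ω d :=
  fun t ω => V *ᵥ fun i => feedbackPosition (ms i) (fun t ω => (Vi *ᵥ x t ω) i) t ω

/-- The rate generated by a signal. -/
def modalRate (V Vi : Matrix (Fin d) (Fin d) ℝ) (Fs ms : Fin d → ℝ → ℝ)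
    (x : VecProcess T Ω d) : VecProcess T Ω d :=
  fun t ω => V *ᵥ fun i => (Vi *ᵥ x t ω) i -
    Fs i t * feedbackPosition (ms i) (fun t ω => (Vi *ᵥ x t ω) i) t ω

lemma IsDiagonalization.mulVec_mulVec_inv (h : IsDiagonalization B V Vi b) (v : Fin d → ℝ) :
    V *ᵥ (Vi *ᵥ v) = v := by
  rw [mulVec_mulVec, h.mul_inv, one_mulVec]

lemma IsDiagonalization.inv_mulVec_mulVec (h : IsDiagonalization B V Vi b) (v : Fin d → ℝ) :
    Vi *ᵥ (V *ᵥ v) = v := by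
  rw [mulVec_mulVec, h.inv_mul, one_mulVec]

lemma modalRate_eq (h : IsDiagonalization B V Vi b) (t : Horizon T) (ω : Ω) :
    modalRate V Vi Fs ms x t ω =
      x t ω - conjDiag V Vi (fun i => Fs i t) *ᵥ modalPosition V Vi ms x t ω := by
  rw [conjDiag_mulVec, modalPosition, h.inv_mulVec_mulVec]
  conv_rhs => rw [← h.mulVec_mulVec_inv (x t ω)]
  rw [← mulVec_sub]
  rfl

variable [mΩ : MeasurableSpace Ω] {P : Measure Ω} [IsProbabilityMeasure P]
  {𝓕 : Filtration (Horizon T) mΩ} {δ : ℝ}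

/-- A vector process whose coordinates in the basis `V` are versions of the scalar signals. -/
def IsModalSignal (P : Measure Ω) (𝓕 : Filtration (Horizon T) mΩ) (δ : ℝ)
    (Vi : Matrix (Fin d) (Fin d) ℝ) (b : Fin d → ℝ) (ms : Fin d → ℝ → ℝ)
    (ξ x : VecProcess T Ω d) : Prop :=
  ∀ i, IsScalarSignal P 𝓕 δ (b i) (ms i) (fun t ω => (Vi *ᵥ ξ t ω) i)
    (fun t ω => (Vi *ᵥ x t ω) i)

lemma IsModalSignal.scalarL2 (hfb : ∀ i, ∃ ε C, IsFeedback T δ (b i) (Fs i) (ms i) ε C)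
    (hb : ∀ i, 0 < b i) (hξ : MemL2 P 𝓕 δ ξ) (hx : IsModalSignal P 𝓕 δ Vi b ms ξ x)
    (i : Fin d) : ScalarL2 P 𝓕 δ fun t ω => (Vi *ᵥ x t ω) i := by
  obtain ⟨ε, C, h⟩ := hfb i
  exact h.signal_scalarL2 (hb i).le (memL2_iff_scalar.1 (memL2_mulVec Vi hξ) i) (hx i)

lemma IsModalSignal.memL2 (hd : IsDiagonalization B V Vi b)
    (hfb : ∀ i, ∃ ε C, IsFeedback T δ (b i) (Fs i) (ms i) ε C)
    (hξ : MemL2 P 𝓕 δ ξ) (hx : IsModalSignal P 𝓕 δ Vi b ms ξ x) : MemL2 P 𝓕 δ x := by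
  have h := memL2_mulVec_pi V fun i => hx.scalarL2 hfb hd.pos hξ i
  have e : ∀ t ω, V *ᵥ (fun i => (Vi *ᵥ x t ω) i) = x t ω := fun t ω => hd.mulVec_mulVec_inv _
  simpa only [e] using h

lemma exists_modalSignal (hd : IsDiagonalization B V Vi b)
    (hfb : ∀ i, ∃ ε C, IsFeedback T δ (b i) (Fs i) (ms i) ε C) (hξ : MemL2 P 𝓕 δ ξ) :
    ∃ x, IsModalSignal P 𝓕 δ Vi b ms ξ x := by
  have h : ∀ i, ∃ y, IsScalarSignal P 𝓕 δ (b i) (ms i) (fun t ω => (Vi *ᵥ ξ t ω) i) y := by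
    intro i
    obtain ⟨ε, C, h⟩ := hfb i
    exact h.exists_signal (hd.pos i).le (memL2_iff_scalar.1 (memL2_mulVec Vi hξ) i)
  choose y hy using h
  refine ⟨fun t ω => V *ᵥ fun i => y i t ω, fun i => ?_⟩
  simp only [hd.inv_mulVec_mulVec]
  exact hy i

/-- A signal generates a solution of the forward-backward equation. -/
lemma IsModalSignal.isSolution (hd : IsDiagonalization B V Vi b)
    (hfb : ∀ i, ∃ ε C, IsFeedback T δ (b i) (Fs i) (ms i) ε C)
    (hξ : MemL2 P 𝓕 δ ξ) (hx : IsModalSignal P 𝓕 δ Vi b ms ξ x) :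
    ∃ M, IsSolution P 𝓕 δ B ξ (modalPosition V Vi ms x) (modalRate V Vi Fs ms x) M := by
  have hξi := fun i => memL2_iff_scalar.1 (memL2_mulVec Vi hξ) i
  have hxi := fun i => hx.scalarL2 hfb hd.pos hξ i
  set y : Fin d → Horizon T → Ω → ℝ := fun i t ω => (Vi *ᵥ x t ω) i with hy
  set η : Fin d → Horizon T → Ω → ℝ := fun i t ω => (Vi *ᵥ ξ t ω) i with hη
  set p : Fin d → Horizon T → Ω → ℝ := fun i => feedbackPosition (ms i) (y i) with hp
  set r : Fin d → Horizon T → Ω → ℝ := fun i t ω => y i t ω - Fs i t * p i t ω with hr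
  have hpL : ∀ i, ScalarL2 P 𝓕 δ (p i) := fun i => by
    obtain ⟨ε, C, h⟩ := hfb i
    exact h.position_scalarL2 (hxi i)
  have hrL : ∀ i, ScalarL2 P 𝓕 δ (r i) := fun i => by
    obtain ⟨ε, C, h⟩ := hfb i
    exact h.rate_scalarL2 (hxi i)
  have hdL : ∀ i, ScalarL2 P 𝓕 δ fun s ω => b i * (p i s ω - η i s ω) + δ * r i s ω := fun i =>
    (((hpL i).sub (hξi i)).const_mul _).add ((hrL i).const_mul δ)
  have hMm := fun i => (by
    obtain ⟨ε, C, h⟩ := hfb i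
    exact h.martingale_solution (hd.pos i).le (hξi i) (hx i) :
      Martingale (fun (t : Horizon T) ω => r i t ω -
        ∫ s in Iic t, (b i * (p i s ω - η i s ω) + δ * r i s ω)) 𝓕 P ∧
      ∀ t : Horizon T, MemLp (fun ω => r i t ω -
        ∫ s in Iic t, (b i * (p i s ω - η i s ω) + δ * r i s ω)) 2 P)
  -- The martingale is the rate minus its drift, so its value at time zero is the initial rate and
  -- the backward equation becomes an identity.
  refine ⟨fun t ω => V *ᵥ fun i => r i t ω -
      ∫ s in Iic t, (b i * (p i s ω - η i s ω) + δ * r i s ω),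
    memL2_mulVec_pi V hpL, memL2_mulVec_pi V hrL, martingale_mulVec_pi V fun i => (hMm i).1,
    fun t => ?_, ?_, ?_, ?_, fun t ht => ?_⟩
  · exact (mulVecCLM V).comp_memLp' (MemLp.of_eval fun i => (hMm i).2 t)
  · refine .of_forall fun ω => ?_
    have : (fun i => p i ⊥ ω) = 0 := by
      ext i
      simp [hp, feedbackPosition]
    change V *ᵥ (fun i => p i ⊥ ω) = 0
    rw [this, mulVec_zero]
  · have h1 : ∀ i, ∀ᵐ ω ∂P, ∀ t : Horizon T, p i t ω = ∫ s in Iic t, r i s ω := fun i => by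
      obtain ⟨ε, C, h⟩ := hfb i
      exact h.position_eq (hxi i)
    filter_upwards [ae_all_iff.2 h1, ae_all_iff.2 fun i => (hrL i).ae_integrableOn]
      with ω h2 h3 t
    change V *ᵥ (fun i => p i t ω) = ∫ s in Iic t, V *ᵥ (fun i => r i s ω)
    rw [integral_mulVec_pi V fun i => h3 i t]
    congr 1
    ext i
    exact h2 i t
  · filter_upwards [ae_all_iff.2 fun i => (hdL i).ae_integrableOn] with ω h3 t
    have e1 : ∀ s, B *ᵥ (modalPosition V Vi ms x s ω - ξ s ω) + δ • modalRate V Vi Fs ms x s ω =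
        V *ᵥ (fun i => b i * (p i s ω - η i s ω) + δ * r i s ω) := by
      intro s
      have hξe : ξ s ω = V *ᵥ (fun i => η i s ω) := (hd.mulVec_mulVec_inv _).symm
      have e2 : modalPosition V Vi ms x s ω = V *ᵥ (fun i => p i s ω) := rfl
      have e3 : modalRate V Vi Fs ms x s ω = V *ᵥ (fun i => r i s ω) := rfl
      rw [e2, e3, hξe, ← mulVec_sub, hd.eq_conjDiag, conjDiag_mulVec, hd.inv_mulVec_mulVec,
        ← mulVec_smul, ← mulVec_add]
      rfl
    simp only [e1]
    rw [integral_mulVec_pi V fun i => h3 i t]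
    change V *ᵥ (fun i => r i t ω) = V *ᵥ (fun i => r i ⊥ ω) + _ + _
    rw [← mulVec_sub, ← mulVec_add, ← mulVec_add]
    congr 1
    ext i
    simp only [Pi.add_apply, Pi.sub_apply, setIntegral_Iic_bot]
    ring
  · have h1 : ∀ i, ∀ᵐ ω ∂P, r i t ω = 0 := fun i => by
      obtain ⟨ε, C, h⟩ := hfb i
      exact h.terminal_rate (hx i) ht
    filter_upwards [ae_all_iff.2 h1] with ω hω
    change V *ᵥ (fun i => r i t ω) = 0
    have : (fun i => r i t ω) = 0 := by
      ext i; exact hω i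
    rw [this, mulVec_zero]

end SignalSolution

/-! ### The explicit formulas in modal coordinates -/

section ModalFormulas

variable {T : ℝ≥0∞} {d : ℕ} {Ω : Type*} [mΩ : MeasurableSpace Ω]
  {P : Measure Ω} [IsProbabilityMeasure P] {𝓕 : Filtration (Horizon T) mΩ} {δ : ℝ}
  {B V Vi : Matrix (Fin d) (Fin d) ℝ} {b : Fin d → ℝ} {Fs ms : Fin d → ℝ → ℝ}
  {ξ x : VecProcess T Ω d}

/-- A conditional expectation of a future integral in modal coordinates. -/
lemma condExp_modal (hb : ∀ i, 0 < b i)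
    (hfb : ∀ i, ∃ ε C, IsFeedback T δ (b i) (Fs i) (ms i) ε C) (hinv : Vi * V = 1)
    (hξ : MemL2 P 𝓕 δ ξ) (t : Horizon T) {pre c : Fin d → ℝ} {K : Horizon T → Fin d → ℝ}
    (hK : ∀ s i, K s i = c i * (b i * Real.exp (-δ * s) * ms i s))
    (hpre : ∀ i, pre i * c i = Real.exp (δ * t) / ms i t) :
    ∀ᵐ ω ∂P, conjDiag V Vi pre *ᵥ
        (P[fun ω' => ∫ s in Ici t, conjDiag V Vi (K s) *ᵥ ξ s ω' | 𝓕 t]) ω =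
      V *ᵥ fun i => Real.exp (δ * t) / ms i t *
        (P[fun ω' => ∫ s in Ici t, b i * Real.exp (-δ * s) * ms i s * (Vi *ᵥ ξ s ω') i | 𝓕 t]) ω := by
  have hξi := fun i => memL2_iff_scalar.1 (memL2_mulVec Vi hξ) i
  set Y : Fin d → Ω → ℝ := fun i ω' =>
    ∫ s in Ici t, b i * Real.exp (-δ * s) * ms i s * (Vi *ᵥ ξ s ω') i with hY
  have hYi : ∀ i, Integrable (Y i) P := fun i => by
    obtain ⟨ε, C, h⟩ := hfb i
    exact (h.memLp_future (hb i).le (hξi i) t).integrable one_le_two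
  have hint : ∀ i, ∀ᵐ ω ∂P, Integrable
      fun s : Horizon T => b i * Real.exp (-δ * s) * ms i s * (Vi *ᵥ ξ s ω) i := fun i => by
    obtain ⟨ε, C, h⟩ := hfb i
    exact h.ae_integrable_signal (hb i).le (hξi i)
  have h1 : ∀ᵐ ω ∂P, ∫ s in Ici t, conjDiag V Vi (K s) *ᵥ ξ s ω =
      V *ᵥ fun i => c i * Y i ω := by
    filter_upwards [ae_all_iff.2 hint] with ω hω
    have e : ∀ s, conjDiag V Vi (K s) *ᵥ ξ s ω = V *ᵥ fun i =>
        c i * (b i * Real.exp (-δ * s) * ms i s * (Vi *ᵥ ξ s ω) i) := fun s => by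
      rw [conjDiag_mulVec]
      congr 1
      ext i
      rw [hK, mul_assoc (c i)]
    simp only [e]
    rw [integral_mulVec_pi V fun i => ((hω i).const_mul (c i)).integrableOn]
    simp only [integral_const_mul, hY]
  have h2 := (condExp_congr_ae (m := 𝓕 t) h1).trans
    (condExp_mulVec_pi V fun i => (hYi i).const_mul (c i))
  have h3 : ∀ i, ∀ᵐ ω ∂P, (P[fun ω => c i * Y i ω | 𝓕 t]) ω = c i * (P[Y i | 𝓕 t]) ω :=
    fun i => condExp_smul (c i) (Y i) (𝓕 t)
  filter_upwards [h2, ae_all_iff.2 h3] with ω e1 e2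
  rw [e1, conjDiag_mulVec, mulVec_mulVec, hinv, one_mulVec]
  congr 1
  ext i
  rw [e2, ← mul_assoc, hpre]

/-- A signal given by conditional expectations is a modal signal and conversely. -/
lemma isModalSignal_iff (hd : IsDiagonalization B V Vi b)
    (hfb : ∀ i, ∃ ε C, IsFeedback T δ (b i) (Fs i) (ms i) ε C)
    (hξ : MemL2 P 𝓕 δ ξ) {pre c : Horizon T → Fin d → ℝ} {K : Horizon T → Horizon T → Fin d → ℝ}
    (hK : ∀ t s i, K t s i = c t i * (b i * Real.exp (-δ * s) * ms i s))
    (hpre : ∀ t i, pre t i * c t i = Real.exp (δ * t) / ms i t) :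
    (IsStronglyProgressive 𝓕 x ∧ ∀ t : Horizon T, ∀ᵐ ω ∂P, x t ω = conjDiag V Vi (pre t) *ᵥ
        (P[fun ω' => ∫ s in Ici t, conjDiag V Vi (K t s) *ᵥ ξ s ω' | 𝓕 t]) ω) ↔
      IsModalSignal P 𝓕 δ Vi b ms ξ x := by
  -- The factor `c t` moves constants known at time `t` between the prefactor and the kernel. This
  -- is the only way in which the two explicit signals differ from the normalized scalar one.
  have hc := fun t => condExp_modal hd.pos hfb hd.inv_mul hξ t (hK t) (hpre t)
  constructor
  · rintro ⟨hp, hx⟩ i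
    refine ⟨progressive_pi_iff.1 (progressive_clm (mulVecCLM Vi) hp) i, fun t => ?_⟩
    filter_upwards [hx t, hc t] with ω h1 h2
    rw [h1, h2, hd.inv_mulVec_mulVec]
  · intro h
    have hp : IsStronglyProgressive 𝓕 fun t ω => Vi *ᵥ x t ω := progressive_pi_iff.2 fun i => (h i).1
    refine ⟨?_, fun t => ?_⟩
    · have := progressive_clm (mulVecCLM V) hp
      simpa only [mulVecCLM_apply, hd.mulVec_mulVec_inv] using this
    · filter_upwards [hc t, ae_all_iff.2 fun i => (h i).2 t] with ω h1 h2
      rw [h1, ← hd.mulVec_mulVec_inv (x t ω)]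
      congr 1
      ext i
      exact h2 i

lemma integral_conjDiag_eq_modalPosition
    (hfb : ∀ i, ∃ ε C, IsFeedback T δ (b i) (Fs i) (ms i) ε C) (hx : MemL2 P 𝓕 δ x) :
    ∀ᵐ ω ∂P, ∀ t : Horizon T,
      ∫ s in Iic t, conjDiag V Vi (fun i => ms i t * (ms i s)⁻¹) *ᵥ x s ω =
        modalPosition V Vi ms x t ω := by
  have h : ∀ i, ∀ᵐ ω ∂P, ∀ t : Horizon T,
      IntegrableOn (fun s : Horizon T => (ms i s)⁻¹ * (Vi *ᵥ x s ω) i) (Iic t) := fun i => by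
    obtain ⟨ε, C, h⟩ := hfb i
    exact h.ae_integrableOn_inv_mul (memL2_iff_scalar.1 (memL2_mulVec Vi hx) i)
  filter_upwards [ae_all_iff.2 h] with ω hω t
  simp only [conjDiag_mulVec, mul_assoc]
  rw [integral_mulVec_pi V fun i => (hω i t).const_mul (ms i t)]
  simp only [integral_const_mul]
  rfl

lemma IsDiagonalization.isSignalInfinite_iff (hd : IsDiagonalization B V Vi b)
    (hfb : ∀ i, ∃ ε C, IsFeedback T δ (b i) (Fs i)
      (fun t => Real.exp (-(scalarRoot δ (b i) - δ / 2) * t)) ε C) (hξ : MemL2 P 𝓕 δ ξ) :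
    IsSignalInfinite P 𝓕 δ (conjDiag V Vi fun i => scalarRoot δ (b i)) ξ x ↔
      IsModalSignal P 𝓕 δ Vi b
        (fun i t => Real.exp (-(scalarRoot δ (b i) - δ / 2) * t)) ξ x := by
  -- Here `c` is found by extracting `b e^{-δs} m_s` from the kernel `(k + δ/2) e^{-(k + δ/2)(s -
  -- t)}`. The prefactor then matches because `(k - δ/2)(k + δ/2) = b`.
  rw [← isModalSignal_iff hd hfb hξ
    (pre := fun _ i => scalarRoot δ (b i) - δ / 2)
    (c := fun t i => (scalarRoot δ (b i) + δ / 2) * Real.exp ((scalarRoot δ (b i) + δ / 2) * t) / b i)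
    (K := fun t s i => (scalarRoot δ (b i) + δ / 2) *
      Real.exp (-((s - t) * (scalarRoot δ (b i) + δ / 2))))]
  · rw [IsSignalInfinite]
    simp only [conjDiag_scalar hd.mul_inv, conjDiag_sub, conjDiag_add, conjDiag_smul,
      conjDiag_neg, conjDiag_exp hd.mul_inv hd.inv_mul, conjDiag_mul hd.inv_mul]
  · intro t s i
    have := (hd.pos i).ne'
    have e : Real.exp (-((s - t) * (scalarRoot δ (b i) + δ / 2))) =
        Real.exp ((scalarRoot δ (b i) + δ / 2) * t) *
          (Real.exp (-δ * s) * Real.exp (-(scalarRoot δ (b i) - δ / 2) * s)) := by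
      rw [← Real.exp_add, ← Real.exp_add]; congr 1; ring
    rw [e]
    field_simp
  · intro t i
    have := (hd.pos i).ne'
    have hsq := scalarRoot_sq (δ := δ) (hd.pos i)
    have e : Real.exp (δ * t) / Real.exp (-(scalarRoot δ (b i) - δ / 2) * t) =
        Real.exp ((scalarRoot δ (b i) + δ / 2) * t) := by
      rw [← Real.exp_sub]; congr 1; ring
    have e2 : (scalarRoot δ (b i) - δ / 2) * (scalarRoot δ (b i) + δ / 2) = b i := by
      linear_combination hsq
    rw [e, ← mul_div_assoc, ← mul_assoc, e2, mul_div_cancel_left₀ _ this]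

lemma IsDiagonalization.strategyInfinite_eq (hd : IsDiagonalization B V Vi b)
    (hfb : ∀ i, ∃ ε C, IsFeedback T δ (b i) (Fs i)
      (fun t => Real.exp (-(scalarRoot δ (b i) - δ / 2) * t)) ε C) (hx : MemL2 P 𝓕 δ x) :
    ∀ᵐ ω ∂P, ∀ t, strategyInfinite δ (conjDiag V Vi fun i => scalarRoot δ (b i)) x t ω =
      modalPosition V Vi (fun i t => Real.exp (-(scalarRoot δ (b i) - δ / 2) * t)) x t ω := by
  filter_upwards [integral_conjDiag_eq_modalPosition (V := V) (Vi := Vi) hfb hx] with ω hω t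
  rw [← hω, strategyInfinite]
  refine integral_congr_ae (.of_forall fun s => ?_)
  simp only [conjDiag_scalar hd.mul_inv, conjDiag_sub, conjDiag_smul,
      conjDiag_neg, conjDiag_exp hd.mul_inv hd.inv_mul, ← Real.exp_neg, ← Real.exp_add]
  congr 2
  ext i
  congr 1
  ring

lemma IsDiagonalization.isSignalFinite_iff (hd : IsDiagonalization B V Vi b) (hδ : 0 ≤ δ)
    (hT : T ≠ ∞) (hξ : MemL2 P 𝓕 δ ξ) :
    IsSignalFinite P 𝓕 δ B ξ x ↔ IsModalSignal P 𝓕 δ Vi b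
      (fun i t => Real.exp (δ / 2 * t) * scalarWeight δ (b i) T.toReal t) ξ x := by
  -- Since `m_s = e^{δs/2} W(s)`, the kernel `e^{-(δ/2)(s - t)} W(s) b` equals `e^{δt/2}` times `b
  -- e^{-δs} m_s`, which dictates `c`.
  rw [← isModalSignal_iff hd (fun i => isFeedback_finite hT hδ (hd.pos i)) hξ
    (pre := fun t i => (scalarWeight δ (b i) T.toReal t)⁻¹)
    (c := fun t _ => Real.exp (δ / 2 * t))
    (K := fun t s i => Real.exp (-(δ / 2) * (s - t)) * (scalarWeight δ (b i) T.toReal s * b i))]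
  · have e : ∀ s, weight δ B T.toReal s * B =
        conjDiag V Vi fun i => scalarWeight δ (b i) T.toReal s * b i := fun s => by
      rw [hd.weight_eq]
      conv_lhs => rw [hd.eq_conjDiag]
      rw [conjDiag_mul hd.inv_mul]
    rw [IsSignalFinite]
    simp only [hd.weight_inv hδ, e, ← smul_mulVec, conjDiag_smul]
  · intro t s i
    have e : Real.exp (-(δ / 2) * (s - t)) =
        Real.exp (δ / 2 * t) * (Real.exp (-δ * s) * Real.exp (δ / 2 * s)) := by
      rw [← Real.exp_add, ← Real.exp_add]; congr 1; ring
    rw [e]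
    ring
  · intro t i
    have := (scalarWeight_pos hδ (hd.pos i) T.toReal t).ne'
    have e : Real.exp (δ * t) = Real.exp (δ / 2 * t) * Real.exp (δ / 2 * t) := by
      rw [← Real.exp_add]; congr 1; ring
    have := (Real.exp_pos (δ / 2 * t)).ne'
    rw [e]
    field_simp

lemma IsDiagonalization.strategyFinite_eq (hd : IsDiagonalization B V Vi b) (hδ : 0 ≤ δ)
    (hT : T ≠ ∞) (hx : MemL2 P 𝓕 δ x) :
    ∀ᵐ ω ∂P, ∀ t, strategyFinite δ B x t ω = modalPosition V Vi
      (fun i t => Real.exp (δ / 2 * t) * scalarWeight δ (b i) T.toReal t) x t ω := by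
  filter_upwards [integral_conjDiag_eq_modalPosition (V := V) (Vi := Vi)
    (fun i => isFeedback_finite hT hδ (hd.pos i)) hx] with ω hω t
  rw [← hω, strategyFinite]
  simp only [hd.exp_intF_eq hδ hT]

end ModalFormulas

/-! ### Uniqueness for the forward-backward equation -/

section Uniqueness

variable {T : ℝ≥0∞} {d : ℕ} {Ω : Type*} [mΩ : MeasurableSpace Ω]
  {P : Measure Ω} [IsProbabilityMeasure P] {𝓕 : Filtration (Horizon T) mΩ} {δ : ℝ}
  {B : Matrix (Fin d) (Fin d) ℝ} {ξ φ φ' M ψ ψ' N : VecProcess T Ω d}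

/-- If two solutions have the same rate up to a null set, their positions agree and their rates differ
by the difference of the martingale parts. -/
lemma IsSolution.drift_congr (h : IsSolution P 𝓕 δ B ξ φ φ' M)
    (h' : IsSolution P 𝓕 δ B ξ ψ ψ' N)
    (he : ∀ᵐ p ∂((volume : Measure (Horizon T)).prod P), ψ' p.1 p.2 = φ' p.1 p.2) :
    (∀ᵐ ω ∂P, ∀ t, ψ t ω = φ t ω) ∧
    ∀ᵐ ω ∂P, ∀ t, ψ' t ω - φ' t ω = (ψ' ⊥ ω - φ' ⊥ ω) +
      ((N t ω - M t ω) - (N ⊥ ω - M ⊥ ω)) := by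
  have hpos : ∀ᵐ ω ∂P, ∀ t, ψ t ω = φ t ω := by
    filter_upwards [h.forward, h'.forward, ae_forall_setIntegral_eq he] with ω h1 h2 h3 t
    rw [h1, h2, h3]
  refine ⟨hpos, ?_⟩
  have hdrift : ∀ᵐ p ∂((volume : Measure (Horizon T)).prod P),
      B *ᵥ (ψ p.1 p.2 - ξ p.1 p.2) + δ • ψ' p.1 p.2 =
        B *ᵥ (φ p.1 p.2 - ξ p.1 p.2) + δ • φ' p.1 p.2 := by
    filter_upwards [he, ae_prod_of_ae (T := T) hpos] with p h1 h2
    rw [h1, h2]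
  filter_upwards [h.backward, h'.backward, ae_forall_setIntegral_eq
    (X := fun s ω => B *ᵥ (ψ s ω - ξ s ω) + δ • ψ' s ω)
    (Y := fun s ω => B *ᵥ (φ s ω - ξ s ω) + δ • φ' s ω) hdrift] with ω h1 h2 h3 t
  rw [h1 t, h2 t, h3]
  abel

/-- Solutions whose rates agree almost everywhere agree. -/
lemma IsSolution.unique_of_rate (h : IsSolution P 𝓕 δ B ξ φ φ' M)
    (h' : IsSolution P 𝓕 δ B ξ ψ ψ' N)
    (he : ∀ᵐ p ∂((volume : Measure (Horizon T)).prod P), ψ' p.1 p.2 = φ' p.1 p.2) :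
    (∀ᵐ ω ∂P, ∀ t, ψ t ω = φ t ω) ∧ (∀ t, ∀ᵐ ω ∂P, ψ' t ω = φ' t ω) ∧
    (∀ t, ∀ᵐ ω ∂P, N t ω - N ⊥ ω = M t ω - M ⊥ ω) := by
  obtain ⟨hpos, hD⟩ := h.drift_congr h' he
  have hK : Martingale (N - M) 𝓕 P := h'.martingale.sub h.martingale
  have hae : ∀ᵐ s : Horizon T, ∀ᵐ ω ∂P, ψ' s ω = φ' s ω := Measure.ae_ae_of_ae_prod he
  have hr : ∀ t : Horizon T, ∀ᵐ ω ∂P, ψ' t ω = φ' t ω := by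
    intro t
    -- Before the horizon, a later time `s` at which the rates agree forces the difference of the
    -- martingales at `s` to equal the `𝓕 ⊥`-measurable `D0`. Conditioning on `𝓕 t` gives the same
    -- at `t`, hence equal rates there. At the horizon the terminal condition decides.
    rcases t.2.2.lt_or_eq with ht | ht
    · obtain ⟨s, hts, hs⟩ := exists_gt_of_ae hae ht
      set D0 : Ω → Fin d → ℝ := fun ω => (N ⊥ ω - M ⊥ ω) - (ψ' ⊥ ω - φ' ⊥ ω) with hD0
      have hsm : StronglyMeasurable[𝓕 t] D0 :=
        ((((h'.martingale.stronglyAdapted ⊥).sub (h.martingale.stronglyAdapted ⊥))).sub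
          ((h'.mem_rate.progressive.stronglyAdapted ⊥).sub
            (h.mem_rate.progressive.stronglyAdapted ⊥))).mono (𝓕.mono bot_le)
      have hKs : (N - M) s =ᵐ[P] D0 := by
        filter_upwards [hD, hs] with ω h1 h2
        have h3 := h1 s
        rw [h2, sub_self] at h3
        ext i
        have h4 := congrFun h3 i
        simp only [Pi.zero_apply, Pi.add_apply, Pi.sub_apply, hD0] at h4 ⊢
        linarith
      have hKt : (N - M) t =ᵐ[P] D0 := by
        refine (hK.2 t s hts.le).symm.trans ((condExp_congr_ae hKs).trans ?_)
        rw [condExp_of_stronglyMeasurable (𝓕.le t) hsm ((hK.integrable s).congr hKs)]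
      filter_upwards [hD, hKt] with ω h1 h2
      have h3 := h1 t
      simp only [Pi.sub_apply, hD0] at h2
      rw [h2] at h3
      rw [← sub_eq_zero, h3]
      abel
    · filter_upwards [h.terminal t ht, h'.terminal t ht] with ω h1 h2
      rw [h1, h2]
  refine ⟨hpos, hr, fun t => ?_⟩
  filter_upwards [hD, hr t, hr ⊥] with ω h1 h2 h3
  have h4 := h1 t
  rw [h2, h3, sub_self, sub_self, zero_add] at h4
  rw [← sub_eq_zero, h4]
  abel

end Uniqueness

/-! ### The goal functional -/

section Goal

variable {T : ℝ≥0∞} {d : ℕ} {Ω : Type*} [mΩ : MeasurableSpace Ω]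
  {P : Measure Ω} {𝓕 : Filtration (Horizon T) mΩ} {δ γ : ℝ}
  {S L : Matrix (Fin d) (Fin d) ℝ} {μ ζ : VecProcess T Ω d} {A Q : Horizon T → Ω → ℝ}

/-- The discounted loss of a rate relative to the optimal one. -/
def quadraticLoss (P : Measure Ω) (δ γ : ℝ) (S L : Matrix (Fin d) (Fin d) ℝ)
    (ψ η : VecProcess T Ω d) : ℝ :=
  ∫ p : Horizon T × Ω, Real.exp (-δ * p.1) *
    (γ / 2 * (ψ p.1 p.2 ⬝ᵥ (S *ᵥ ψ p.1 p.2)) + η p.1 p.2 ⬝ᵥ (L *ᵥ η p.1 p.2))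
    ∂((volume : Measure (Horizon T)).prod P)

lemma quadratic_nonneg {lam : Fin d → ℝ} (hS : S.PosSemidef) (hL : L = diagonal lam)
    (hlam : ∀ i, 0 < lam i) (hγ : 0 < γ) (u v : Fin d → ℝ) :
    0 ≤ γ / 2 * (u ⬝ᵥ (S *ᵥ u)) + v ⬝ᵥ (L *ᵥ v) ∧
      (γ / 2 * (u ⬝ᵥ (S *ᵥ u)) + v ⬝ᵥ (L *ᵥ v) = 0 → v = 0) := by
  have h1 : 0 ≤ γ / 2 * (u ⬝ᵥ (S *ᵥ u)) := by
    have := hS.dotProduct_mulVec_nonneg u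
    simp only [star_trivial] at this
    positivity
  have e : v ⬝ᵥ (L *ᵥ v) = ∑ i, lam i * v i ^ 2 := by
    simp only [hL, dotProduct, mulVec_diagonal]
    exact Finset.sum_congr rfl fun i _ => by ring
  have hn : ∀ i ∈ Finset.univ, 0 ≤ lam i * v i ^ 2 := fun i _ =>
    mul_nonneg (hlam i).le (sq_nonneg _)
  have h2 : 0 ≤ v ⬝ᵥ (L *ᵥ v) := e ▸ Finset.sum_nonneg hn
  refine ⟨add_nonneg h1 h2, fun h => ?_⟩
  have h3 : ∑ i, lam i * v i ^ 2 = 0 := by rw [← e]; linarith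
  ext i
  have := (Finset.sum_eq_zero_iff_of_nonneg hn).1 h3 i (Finset.mem_univ i)
  simpa [(hlam i).ne'] using this

lemma quadraticLoss_nonneg {lam : Fin d → ℝ} (hS : S.PosSemidef) (hL : L = diagonal lam)
    (hlam : ∀ i, 0 < lam i) (hγ : 0 < γ) (ψ η : VecProcess T Ω d) :
    0 ≤ quadraticLoss P δ γ S L ψ η :=
  integral_nonneg fun _ => mul_nonneg (Real.exp_nonneg _) (quadratic_nonneg hS hL hlam hγ _ _).1

lemma IsSolution.position_eq {B : Matrix (Fin d) (Fin d) ℝ} {ξ φ φ' M : VecProcess T Ω d}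
    (h : IsSolution P 𝓕 δ B ξ φ φ' M) : ∀ᵐ ω ∂P, ∀ t, position φ' t ω = φ t ω := by
  filter_upwards [h.forward] with ω hω t using (hω t).symm

lemma progressive_position {r : VecProcess T Ω d} (hr : MemL2 P 𝓕 δ r) :
    IsStronglyProgressive 𝓕 (position r) := progressive_primitive hr.progressive

variable [IsProbabilityMeasure P]

/-- Puts the goal on the product space, where integrands can be compared almost everywhere. The
endowment term does not involve the rate and is carried along as a constant. -/
lemma goal_eq_integral_prod (hμ : MemL2 P 𝓕 δ μ) (hζ : MemL2 P 𝓕 δ ζ) {r : VecProcess T Ω d}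
    (hr : Admissible P 𝓕 δ r) :
    Integrable (fun p : Horizon T × Ω => Real.exp (-δ * p.1) *
      (position r p.1 p.2 ⬝ᵥ μ p.1 p.2
        - γ / 2 * ((position r p.1 p.2 + ζ p.1 p.2) ⬝ᵥ (S *ᵥ (position r p.1 p.2 + ζ p.1 p.2)))
        - r p.1 p.2 ⬝ᵥ (L *ᵥ r p.1 p.2))) ((volume : Measure (Horizon T)).prod P) ∧
    goal P δ γ S L μ ζ A Q r = (∫ p : Horizon T × Ω, Real.exp (-δ * p.1) *
      (position r p.1 p.2 ⬝ᵥ μ p.1 p.2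
        - γ / 2 * ((position r p.1 p.2 + ζ p.1 p.2) ⬝ᵥ (S *ᵥ (position r p.1 p.2 + ζ p.1 p.2)))
        - r p.1 p.2 ⬝ᵥ (L *ᵥ r p.1 p.2)) ∂((volume : Measure (Horizon T)).prod P)) +
      ∫ ω, (stieltjesIntegral (fun t => Real.exp (-δ * t)) (fun t => A t ω)
      - γ / 2 * ∫ t, Real.exp (-δ * t) ∂(stieltjesMeasure (fun t => Q t ω))) ∂P := by
  have hpz := memL2_add hr.2 hζ
  have hi : Integrable (fun p : Horizon T × Ω => Real.exp (-δ * p.1) *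
      (position r p.1 p.2 ⬝ᵥ μ p.1 p.2
        - γ / 2 * ((position r p.1 p.2 + ζ p.1 p.2) ⬝ᵥ (S *ᵥ (position r p.1 p.2 + ζ p.1 p.2)))
        - r p.1 p.2 ⬝ᵥ (L *ᵥ r p.1 p.2))) ((volume : Measure (Horizon T)).prod P) := by
    refine (((hr.2.integrable_dotProduct hμ).sub ((hpz.integrable_dotProduct
      (memL2_mulVec S hpz)).const_mul (γ / 2))).sub
      (hr.1.integrable_dotProduct (memL2_mulVec L hr.1))).congr (.of_forall fun p => ?_)
    simp only [Pi.sub_apply]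
    ring
  refine ⟨hi, ?_⟩
  rw [goal, integral_prod_symm _ hi]

/-- The first order condition in vector form. -/
lemma IsSolution.first_order_condition (hT : 0 < T) (hδ : 0 ≤ δ)
    {B : Matrix (Fin d) (Fin d) ℝ} {ξ φ φ' M η : VecProcess T Ω d}
    (hξ : MemL2 P 𝓕 δ ξ) (h : IsSolution P 𝓕 δ B ξ φ φ' M) (hη : Admissible P 𝓕 δ η)
    (lam : Fin d → ℝ) :
    Integrable (fun p : Horizon T × Ω => Real.exp (-δ * p.1) *
      (η p.1 p.2 ⬝ᵥ (diagonal lam *ᵥ φ' p.1 p.2) + position η p.1 p.2 ⬝ᵥ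
        (diagonal lam *ᵥ (B *ᵥ (φ p.1 p.2 - ξ p.1 p.2)))))
      ((volume : Measure (Horizon T)).prod P) ∧
    ∫ p : Horizon T × Ω, Real.exp (-δ * p.1) *
      (η p.1 p.2 ⬝ᵥ (diagonal lam *ᵥ φ' p.1 p.2) + position η p.1 p.2 ⬝ᵥ
        (diagonal lam *ᵥ (B *ᵥ (φ p.1 p.2 - ξ p.1 p.2))))
      ∂((volume : Measure (Horizon T)).prod P) = 0 := by
  have hg : MemL2 P 𝓕 δ fun t ω => B *ᵥ (φ t ω - ξ t ω) := memL2_mulVec B (memL2_sub h.mem_position hξ)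
  have hηi := memL2_iff_scalar.1 hη.1
  have hψi := memL2_iff_scalar.1 hη.2
  have hri := memL2_iff_scalar.1 h.mem_rate
  have hgi := memL2_iff_scalar.1 hg
  -- Taking a coordinate commutes with the integral only on paths where the vector integral exists,
  -- hence almost surely.
  have hcoord : ∀ i, ∀ᵐ ω ∂P, ∀ t : Horizon T, position η t ω i = ∫ s in Iic t, η s ω i := by
    intro i
    filter_upwards [hη.1.ae_integrableOn] with ω hω t
    exact eval_integral (fun j => (hω t).eval j) i
  have hfoc : ∀ i, ∫ p : Horizon T × Ω, Real.exp (-δ * p.1) *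
      (η p.1 p.2 i * φ' p.1 p.2 i + position η p.1 p.2 i * (B *ᵥ (φ p.1 p.2 - ξ p.1 p.2)) i)
      ∂((volume : Measure (Horizon T)).prod P) = 0 := by
    intro i
    have hψ : ScalarL2 P 𝓕 δ fun t ω => ∫ s in Iic t, η s ω i := by
      refine (hψi i).congr_ae (progressive_primitive (hηi i).1) ?_
      filter_upwards [ae_prod_of_ae (T := T) (hcoord i)] with p hp using hp p.1
    have hd : ∀ᵐ ω ∂P, ∀ t, IntegrableOn
        (fun s => B *ᵥ (φ s ω - ξ s ω) + δ • φ' s ω) (Iic t) :=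
      (memL2_add hg (memL2_smul δ h.mem_rate)).ae_integrableOn
    have hback : ∀ᵐ ω ∂P, ∀ t, φ' t ω i = φ' ⊥ ω i + (M t ω i - M ⊥ ω i) +
        ∫ s in Iic t, ((B *ᵥ (φ s ω - ξ s ω)) i + δ * φ' s ω i) := by
      filter_upwards [h.backward, hd] with ω h1 h2 t
      have h3 := congrFun (h1 t) i
      simp only [Pi.add_apply, Pi.sub_apply] at h3
      rw [h3, eval_integral (fun j => (h2 t).eval j) i]
      rfl
    have hz := QuadCost.first_order_condition hT hδ (hri i) (hgi i) (martingale_eval h.martingale i)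
      (fun t => (ContinuousLinearMap.proj (R := ℝ) (φ := fun _ : Fin d => ℝ) i).comp_memLp'
        (h.moments t)) hback (fun t ht => (h.terminal t ht).mono fun ω hω => by rw [hω]; rfl)
      (hηi i) hψ
    refine (integral_congr_ae ?_).trans hz
    filter_upwards [ae_prod_of_ae (T := T) (hcoord i)] with p hp
    rw [hp]
  have e : ∀ p : Horizon T × Ω, Real.exp (-δ * p.1) *
      (η p.1 p.2 ⬝ᵥ (diagonal lam *ᵥ φ' p.1 p.2) + position η p.1 p.2 ⬝ᵥ
        (diagonal lam *ᵥ (B *ᵥ (φ p.1 p.2 - ξ p.1 p.2)))) =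
      ∑ i, lam i * (Real.exp (-δ * p.1) * (η p.1 p.2 i * φ' p.1 p.2 i +
        position η p.1 p.2 i * (B *ᵥ (φ p.1 p.2 - ξ p.1 p.2)) i)) := by
    intro p
    simp only [dotProduct, mulVec_diagonal, ← Finset.sum_add_distrib, Finset.mul_sum]
    exact Finset.sum_congr rfl fun i _ => by ring
  have hi : ∀ i, Integrable (fun p : Horizon T × Ω => lam i * (Real.exp (-δ * p.1) *
      (η p.1 p.2 i * φ' p.1 p.2 i + position η p.1 p.2 i * (B *ᵥ (φ p.1 p.2 - ξ p.1 p.2)) i)))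
      ((volume : Measure (Horizon T)).prod P) := by
    intro i
    refine Integrable.const_mul ?_ _
    refine (((hηi i).integrable_mul (hri i)).add ((hψi i).integrable_mul (hgi i))).congr
      (.of_forall fun p => ?_)
    simp only [Pi.add_apply]
    ring
  simp only [e]
  refine ⟨integrable_finsetSum _ fun i _ => hi i, ?_⟩
  rw [integral_finsetSum _ fun i _ => hi i]
  refine Finset.sum_eq_zero fun i _ => ?_
  rw [integral_const_mul, hfoc, mul_zero]

/-- Completing the square around the solution. -/
lemma goal_integrand_identity {lam : Fin d → ℝ} (hS : Sᵀ = S) (hSdet : S.det ≠ 0)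
    (hL : L = diagonal lam) (hlam : ∀ i, 0 < lam i) (hγ : 0 < γ)
    (m z f f' e e' : Fin d → ℝ) :
    (f + e) ⬝ᵥ m - γ / 2 * ((f + e + z) ⬝ᵥ (S *ᵥ (f + e + z))) - (f' + e') ⬝ᵥ (L *ᵥ (f' + e')) =
      (f ⬝ᵥ m - γ / 2 * ((f + z) ⬝ᵥ (S *ᵥ (f + z))) - f' ⬝ᵥ (L *ᵥ f'))
      - 2 * (e' ⬝ᵥ (L *ᵥ f') + e ⬝ᵥ (L *ᵥ (coeff γ S L *ᵥ (f - (γ⁻¹ • (S⁻¹ *ᵥ m) - z)))))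
      - (γ / 2 * (e ⬝ᵥ (S *ᵥ e)) + e' ⬝ᵥ (L *ᵥ e')) := by
  have hsymm : ∀ (X : Matrix (Fin d) (Fin d) ℝ) (_ : Xᵀ = X) (u v : Fin d → ℝ),
      u ⬝ᵥ (X *ᵥ v) = v ⬝ᵥ (X *ᵥ u) := fun X hX u v => by
    rw [dotProduct_mulVec, ← mulVec_transpose, hX, dotProduct_comm]
  have hLt : Lᵀ = L := by rw [hL, diagonal_transpose]
  have hLu : IsUnit L.det := by
    rw [hL, det_diagonal, isUnit_iff_ne_zero]
    exact Finset.prod_ne_zero_iff.2 fun i _ => (hlam i).ne'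
  -- `ΛB(φ - ξ) = (γ/2) Σ(φ + ζ) - μ/2` is minus half the gradient of the integrand in the position.
  -- This is why `B` and `ξ` are defined as they are.
  have hLB : L *ᵥ (coeff γ S L *ᵥ (f - (γ⁻¹ • (S⁻¹ *ᵥ m) - z))) =
      (γ / 2) • (S *ᵥ (f + z)) - (1 / 2 : ℝ) • m := by
    have h1 : L * coeff γ S L = (γ / 2) • S := by
      rw [coeff, Matrix.mul_smul, ← Matrix.mul_assoc, mul_nonsing_inv _ hLu, Matrix.one_mul]
    have h2 : S *ᵥ (S⁻¹ *ᵥ m) = m := by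
      rw [mulVec_mulVec, mul_nonsing_inv _ (isUnit_iff_ne_zero.2 hSdet), one_mulVec]
    rw [mulVec_mulVec, h1, smul_mulVec, sub_sub_eq_add_sub, mulVec_sub, mulVec_smul, h2, smul_sub,
      smul_smul]
    congr 2
    field_simp
  rw [hLB]
  simp only [mulVec_add, dotProduct_add, add_dotProduct, dotProduct_sub, dotProduct_smul,
    smul_eq_mul]
  rw [hsymm S hS f e, hsymm S hS z e, hsymm L hLt f' e']
  ring

lemma quadraticLoss_integrable {ψ η : VecProcess T Ω d} (hψ : MemL2 P 𝓕 δ ψ)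
    (hη : MemL2 P 𝓕 δ η) :
    Integrable (fun p : Horizon T × Ω => Real.exp (-δ * p.1) *
      (γ / 2 * (ψ p.1 p.2 ⬝ᵥ (S *ᵥ ψ p.1 p.2)) + η p.1 p.2 ⬝ᵥ (L *ᵥ η p.1 p.2)))
      ((volume : Measure (Horizon T)).prod P) := by
  refine (((hψ.integrable_dotProduct (memL2_mulVec S hψ)).const_mul (γ / 2)).add
    (hη.integrable_dotProduct (memL2_mulVec L hη))).congr (.of_forall fun p => ?_)
  simp only [Pi.add_apply]
  ring

lemma eq_zero_of_quadraticLoss {lam : Fin d → ℝ} (hS : S.PosSemidef) (hL : L = diagonal lam)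
    (hlam : ∀ i, 0 < lam i) (hγ : 0 < γ) {ψ η : VecProcess T Ω d} (hψ : MemL2 P 𝓕 δ ψ)
    (hη : MemL2 P 𝓕 δ η) (h : quadraticLoss P δ γ S L ψ η = 0) :
    ∀ᵐ p ∂((volume : Measure (Horizon T)).prod P), η p.1 p.2 = 0 := by
  have h1 := (integral_eq_zero_iff_of_nonneg (fun p => mul_nonneg (Real.exp_nonneg _)
    (quadratic_nonneg hS hL hlam hγ _ _).1) (quadraticLoss_integrable hψ hη)).1 h
  filter_upwards [h1] with p hp
  exact (quadratic_nonneg hS hL hlam hγ _ _).2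
    ((mul_eq_zero.1 hp).resolve_left (Real.exp_pos _).ne')

lemma IsSolution.admissible {B : Matrix (Fin d) (Fin d) ℝ} {ξ φ φ' M : VecProcess T Ω d}
    (h : IsSolution P 𝓕 δ B ξ φ φ' M) : Admissible P 𝓕 δ φ' := by
  refine ⟨h.mem_rate, memL2_congr_ae h.mem_position (progressive_position h.mem_rate) ?_⟩
  filter_upwards [ae_prod_of_ae (T := T) h.position_eq] with p hp using (hp p.1).symm

lemma MemL2.position_sub {r r' : VecProcess T Ω d} (hr : MemL2 P 𝓕 δ r)
    (hr' : MemL2 P 𝓕 δ r') :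
    ∀ᵐ ω ∂P, ∀ t, position (fun t ω => r t ω - r' t ω) t ω = position r t ω - position r' t ω := by
  filter_upwards [hr.ae_integrableOn, hr'.ae_integrableOn] with ω h1 h2 t
  exact integral_sub (h1 t) (h2 t)

lemma Admissible.sub {r r' : VecProcess T Ω d} (hr : Admissible P 𝓕 δ r)
    (hr' : Admissible P 𝓕 δ r') : Admissible P 𝓕 δ fun t ω => r t ω - r' t ω := by
  have h := memL2_sub hr.1 hr'.1
  refine ⟨h, memL2_congr_ae (memL2_sub hr.2 hr'.2) (progressive_position h) ?_⟩
  filter_upwards [ae_prod_of_ae (T := T) (hr.1.position_sub hr'.1)] with p hp using (hp p.1).symm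

/-- The goal functional of an admissible rate falls short of that of a solution by the quadratic
loss of the difference. -/
lemma IsSolution.goal_eq (hT : 0 < T) (hδ : 0 ≤ δ) {lam : Fin d → ℝ} (hS : Sᵀ = S)
    (hSdet : S.det ≠ 0) (hL : L = diagonal lam) (hlam : ∀ i, 0 < lam i) (hγ : 0 < γ)
    (hμ : MemL2 P 𝓕 δ μ) (hζ : MemL2 P 𝓕 δ ζ) (hξ : MemL2 P 𝓕 δ (frictionless γ S μ ζ))
    {φ φ' M r : VecProcess T Ω d}
    (h : IsSolution P 𝓕 δ (coeff γ S L) (frictionless γ S μ ζ) φ φ' M)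
    (hr : Admissible P 𝓕 δ r) :
    goal P δ γ S L μ ζ A Q r = goal P δ γ S L μ ζ A Q φ' -
      quadraticLoss P δ γ S L (position fun t ω => r t ω - φ' t ω) fun t ω => r t ω - φ' t ω := by
  have hφ := h.admissible
  have hη := hr.sub hφ
  obtain ⟨i1, e1⟩ := goal_eq_integral_prod (γ := γ) (S := S) (L := L) (A := A) (Q := Q) hμ hζ hr
  obtain ⟨i2, e2⟩ := goal_eq_integral_prod (γ := γ) (S := S) (L := L) (A := A) (Q := Q) hμ hζ hφ
  obtain ⟨i3, e3⟩ := h.first_order_condition hT hδ hξ hη lam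
  have i4 := quadraticLoss_integrable (γ := γ) (S := S) (L := L) hη.2 hη.1
  have key := integral_congr_ae (μ := (volume : Measure (Horizon T)).prod P)
    (f := fun p : Horizon T × Ω => Real.exp (-δ * p.1) *
      (position r p.1 p.2 ⬝ᵥ μ p.1 p.2
        - γ / 2 * ((position r p.1 p.2 + ζ p.1 p.2) ⬝ᵥ (S *ᵥ (position r p.1 p.2 + ζ p.1 p.2)))
        - r p.1 p.2 ⬝ᵥ (L *ᵥ r p.1 p.2)))
    (g := fun p => Real.exp (-δ * p.1) *
      (position φ' p.1 p.2 ⬝ᵥ μ p.1 p.2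
        - γ / 2 * ((position φ' p.1 p.2 + ζ p.1 p.2) ⬝ᵥ (S *ᵥ (position φ' p.1 p.2 + ζ p.1 p.2)))
        - φ' p.1 p.2 ⬝ᵥ (L *ᵥ φ' p.1 p.2))
      - 2 * (Real.exp (-δ * p.1) *
      ((r p.1 p.2 - φ' p.1 p.2) ⬝ᵥ (diagonal lam *ᵥ φ' p.1 p.2) +
        position (fun t ω => r t ω - φ' t ω) p.1 p.2 ⬝ᵥ
        (diagonal lam *ᵥ (coeff γ S L *ᵥ (φ p.1 p.2 - frictionless γ S μ ζ p.1 p.2)))))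
      - Real.exp (-δ * p.1) *
    (γ / 2 * (position (fun t ω => r t ω - φ' t ω) p.1 p.2 ⬝ᵥ
      (S *ᵥ position (fun t ω => r t ω - φ' t ω) p.1 p.2)) +
      (r p.1 p.2 - φ' p.1 p.2) ⬝ᵥ (L *ᵥ (r p.1 p.2 - φ' p.1 p.2)))) (by
    filter_upwards [ae_prod_of_ae (T := T) (hr.1.position_sub hφ.1),
      ae_prod_of_ae (T := T) h.position_eq] with p h1 h2
    have h3 := h1 p.1
    have h4 : position r p.1 p.2 = φ p.1 p.2 + position (fun t ω => r t ω - φ' t ω) p.1 p.2 := by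
      rw [h3, h2, add_sub_cancel]
    have h5 : r p.1 p.2 = φ' p.1 p.2 + (r p.1 p.2 - φ' p.1 p.2) := by rw [add_sub_cancel]
    have := goal_integrand_identity hS hSdet hL hlam hγ (μ p.1 p.2) (ζ p.1 p.2) (φ p.1 p.2)
      (φ' p.1 p.2) (position (fun t ω => r t ω - φ' t ω) p.1 p.2) (r p.1 p.2 - φ' p.1 p.2)
    rw [← h4, ← h5] at this
    rw [this, h2, ← hL, frictionless]
    ring)
  have e4 := integral_sub i2 (i3.const_mul 2)
  rw [integral_const_mul, e3] at e4
  have e5 := key.trans (integral_sub (i2.sub (i3.const_mul 2)) i4)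
  rw [e1, e2, e5, e4, quadraticLoss]
  ring

end Goal

/-! ### Optimality of solutions -/

section Optimality

variable {T : ℝ≥0∞} {d : ℕ} {Ω : Type*} [mΩ : MeasurableSpace Ω]
  {P : Measure Ω} {𝓕 : Filtration (Horizon T) mΩ} {δ γ : ℝ}
  {S L : Matrix (Fin d) (Fin d) ℝ} {lam : Fin d → ℝ} {μ ζ : VecProcess T Ω d}
  {A Q : Horizon T → Ω → ℝ} {φ φ' M ψ ψ' N r x : VecProcess T Ω d}

/-- The standing assumptions on the data of the optimization problem. -/
structure IsModel (P : Measure Ω) (𝓕 : Filtration (Horizon T) mΩ) (δ γ : ℝ)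
    (S L : Matrix (Fin d) (Fin d) ℝ) (lam : Fin d → ℝ) (μ ζ : VecProcess T Ω d) : Prop where
  horizon_pos : 0 < T
  discount_nonneg : 0 ≤ δ
  posSemidef : S.PosSemidef
  det_ne_zero : S.det ≠ 0
  cost_eq : L = diagonal lam
  cost_pos : ∀ i, 0 < lam i
  aversion_pos : 0 < γ
  memL2_return : MemL2 P 𝓕 δ μ
  memL2_exposure : MemL2 P 𝓕 δ ζ

lemma IsModel.memL2_frictionless [SFinite P] (H : IsModel P 𝓕 δ γ S L lam μ ζ) :
    MemL2 P 𝓕 δ (frictionless γ S μ ζ) :=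
  memL2_sub (memL2_smul γ⁻¹ (memL2_mulVec S⁻¹ H.memL2_return)) H.memL2_exposure

variable [IsProbabilityMeasure P]

lemma IsModel.goal_eq (H : IsModel P 𝓕 δ γ S L lam μ ζ)
    (h : IsSolution P 𝓕 δ (coeff γ S L) (frictionless γ S μ ζ) φ φ' M)
    (hr : Admissible P 𝓕 δ r) :
    goal P δ γ S L μ ζ A Q r = goal P δ γ S L μ ζ A Q φ' -
      quadraticLoss P δ γ S L (position fun t ω => r t ω - φ' t ω) fun t ω => r t ω - φ' t ω :=
  h.goal_eq H.horizon_pos H.discount_nonneg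
    (by simpa [IsHermitian, conjTranspose_eq_transpose_of_trivial] using H.posSemidef.1)
    H.det_ne_zero H.cost_eq H.cost_pos H.aversion_pos H.memL2_return H.memL2_exposure
    H.memL2_frictionless hr

/-- An admissible rate is optimal exactly if it agrees with the rate of a given solution. -/
lemma IsModel.isOptimal_iff (H : IsModel P 𝓕 δ γ S L lam μ ζ)
    (h : IsSolution P 𝓕 δ (coeff γ S L) (frictionless γ S μ ζ) φ φ' M)
    (hr : Admissible P 𝓕 δ r) :
    IsOptimal P 𝓕 δ γ S L μ ζ A Q r ↔
      ∀ᵐ p ∂((volume : Measure (Horizon T)).prod P), r p.1 p.2 = φ' p.1 p.2 := by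
  have hle : ∀ r', Admissible P 𝓕 δ r' →
      goal P δ γ S L μ ζ A Q r' ≤ goal P δ γ S L μ ζ A Q φ' := fun r' hr' => by
    rw [H.goal_eq h hr']
    exact sub_le_self _ (quadraticLoss_nonneg H.posSemidef H.cost_eq H.cost_pos H.aversion_pos _ _)
  have hd := hr.sub h.admissible
  constructor
  · intro ho
    have h1 := ho.2 φ' h.admissible
    rw [H.goal_eq h hr] at h1
    have h2 := quadraticLoss_nonneg (P := P) (δ := δ) H.posSemidef H.cost_eq H.cost_pos
      H.aversion_pos (position fun t ω => r t ω - φ' t ω) fun t ω => r t ω - φ' t ω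
    filter_upwards [eq_zero_of_quadraticLoss H.posSemidef H.cost_eq H.cost_pos H.aversion_pos
      hd.2 hd.1 (le_antisymm (by linarith) h2)] with p hp using sub_eq_zero.1 hp
  · intro he
    refine ⟨hr, fun r' hr' => (hle r' hr').trans_eq ?_⟩
    -- Rates that agree almost everywhere also generate indistinguishable positions, so both parts
    -- of the loss vanish.
    have h0 : quadraticLoss P δ γ S L (position fun t ω => r t ω - φ' t ω)
        (fun t ω => r t ω - φ' t ω) = 0 := by
      have hη : ∀ᵐ p ∂((volume : Measure (Horizon T)).prod P),
          (fun t ω => r t ω - φ' t ω) p.1 p.2 = (fun _ _ => 0 : VecProcess T Ω d) p.1 p.2 := by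
        filter_upwards [he] with p hp using sub_eq_zero.2 hp
      have hψ := ae_prod_of_ae (T := T) (ae_forall_setIntegral_eq
        (X := fun t ω => r t ω - φ' t ω) (Y := fun _ _ => 0) hη)
      refine integral_eq_zero_of_ae ?_
      filter_upwards [hη, hψ] with p h1 h2
      have h3 : position (fun t ω => r t ω - φ' t ω) p.1 p.2 = 0 := by
        rw [position, h2, integral_zero]
      have h4 : r p.1 p.2 - φ' p.1 p.2 = 0 := h1
      rw [h3, h4]
      simp
    rw [H.goal_eq h hr, h0, sub_zero]

lemma IsModel.isOptimal_rate (H : IsModel P 𝓕 δ γ S L lam μ ζ)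
    (h : IsSolution P 𝓕 δ (coeff γ S L) (frictionless γ S μ ζ) φ φ' M) :
    IsOptimal P 𝓕 δ γ S L μ ζ A Q φ' :=
  (H.isOptimal_iff h h.admissible).2 (.of_forall fun _ => rfl)

/-- Both rates are optimal, so they agree almost everywhere by strict concavity. The equation does
not see the endowment terms, so the auxiliary problem is taken with `A = Q = 0`. -/
lemma IsModel.solution_unique (H : IsModel P 𝓕 δ γ S L lam μ ζ)
    (h : IsSolution P 𝓕 δ (coeff γ S L) (frictionless γ S μ ζ) φ φ' M)
    (h' : IsSolution P 𝓕 δ (coeff γ S L) (frictionless γ S μ ζ) ψ ψ' N) :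
    (∀ᵐ ω ∂P, ∀ t, ψ t ω = φ t ω) ∧ (∀ t, ∀ᵐ ω ∂P, ψ' t ω = φ' t ω) ∧
    (∀ t, ∀ᵐ ω ∂P, N t ω - N ⊥ ω = M t ω - M ⊥ ω) :=
  h.unique_of_rate h' ((H.isOptimal_iff (A := 0) (Q := 0) h h'.admissible).1 (H.isOptimal_rate h'))

lemma IsModel.position_eq_of_isOptimal (H : IsModel P 𝓕 δ γ S L lam μ ζ)
    (h : IsSolution P 𝓕 δ (coeff γ S L) (frictionless γ S μ ζ) φ φ' M)
    (hr : IsOptimal P 𝓕 δ γ S L μ ζ A Q r) : ∀ᵐ ω ∂P, ∀ t, position r t ω = φ t ω := by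
  filter_upwards [ae_forall_setIntegral_eq ((H.isOptimal_iff h hr.1).1 hr), h.position_eq]
    with ω h1 h2 t
  rw [← h2, position, h1, position]

/-- The optimal position and rate generated by a signal. -/
lemma IsModel.feedback {V Vi : Matrix (Fin d) (Fin d) ℝ} {b : Fin d → ℝ}
    {Fs ms : Fin d → ℝ → ℝ} (H : IsModel P 𝓕 δ γ S L lam μ ζ)
    (hd : IsDiagonalization (coeff γ S L) V Vi b)
    (hfb : ∀ i, ∃ ε C, IsFeedback T δ (b i) (Fs i) (ms i) ε C)
    (hx : IsModalSignal P 𝓕 δ Vi b ms (frictionless γ S μ ζ) x) {str : VecProcess T Ω d}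
    (hstr : ∀ᵐ ω ∂P, ∀ t, str t ω = modalPosition V Vi ms x t ω) :
    (∀ r, IsOptimal P 𝓕 δ γ S L μ ζ A Q r →
      (∀ᵐ ω ∂P, ∀ t, position r t ω = str t ω) ∧
      (∀ᵐ p ∂((volume : Measure (Horizon T)).prod P), r p.1 p.2 = x p.1 p.2 -
        conjDiag V Vi (fun i => Fs i p.1) *ᵥ position r p.1 p.2)) ∧
    (∀ φ φ' M, IsSolution P 𝓕 δ (coeff γ S L) (frictionless γ S μ ζ) φ φ' M →
      (∀ᵐ ω ∂P, ∀ t, φ t ω = str t ω) ∧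
      (∀ t : Horizon T, ∀ᵐ ω ∂P, φ' t ω = x t ω -
        conjDiag V Vi (fun i => Fs i t) *ᵥ φ t ω)) := by
  obtain ⟨N, hN⟩ := hx.isSolution hd hfb H.memL2_frictionless
  refine ⟨fun r hr => ?_, fun φ φ' M h => ?_⟩
  · have hpos := H.position_eq_of_isOptimal hN hr
    constructor
    · filter_upwards [hpos, hstr] with ω h1 h2 t
      rw [h1, h2]
    · filter_upwards [(H.isOptimal_iff hN hr.1).1 hr, ae_prod_of_ae (T := T) hpos] with p h1 h2
      rw [h1, h2, modalRate_eq hd]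
  · obtain ⟨h1, h2, -⟩ := H.solution_unique hN h
    constructor
    · filter_upwards [h1, hstr] with ω h3 h4 t
      rw [h3, h4]
    · intro t
      filter_upwards [h1, h2 t] with ω h3 h4
      rw [h3, h4, modalRate_eq hd]

lemma IsModel.exists_solution {V Vi : Matrix (Fin d) (Fin d) ℝ} {b : Fin d → ℝ}
    (H : IsModel P 𝓕 δ γ S L lam μ ζ) (hd : IsDiagonalization (coeff γ S L) V Vi b) :
    ∃ φ φ' M, IsSolution P 𝓕 δ (coeff γ S L) (frictionless γ S μ ζ) φ φ' M := by
  obtain ⟨Fs, ms, hfb⟩ : ∃ Fs ms : Fin d → ℝ → ℝ,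
      ∀ i, ∃ ε C, IsFeedback T δ (b i) (Fs i) (ms i) ε C := by
    rcases eq_or_ne T ∞ with rfl | hT
    · exact ⟨_, _, fun i => isFeedback_infinite (hd.pos i)⟩
    · exact ⟨_, _, fun i => isFeedback_finite hT H.discount_nonneg (hd.pos i)⟩
  obtain ⟨x, hx⟩ := exists_modalSignal (P := P) (𝓕 := 𝓕) hd hfb H.memL2_frictionless
  obtain ⟨M, hM⟩ := hx.isSolution hd hfb H.memL2_frictionless
  exact ⟨_, _, M, hM⟩

end Optimality

end QuadCost

end

/-! ### Existence, uniqueness and explicit form of the optimal strategy. -/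

theorem lemma4p1 {Ω : Type*} [mΩ : MeasurableSpace Ω] (P : Measure Ω) [IsProbabilityMeasure P]
    {T : ℝ≥0∞} (hT : 0 < T) (𝓕 : Filtration (QuadCost.Horizon T) mΩ)
    {d : ℕ} (δ : ℝ) (hδ : 0 ≤ δ) (hδT : T = ∞ → 0 < δ)
    (σ : Matrix (Fin d) (Fin d) ℝ) (S : Matrix (Fin d) (Fin d) ℝ) (hS : S = σ * σᵀ)
    (hSdet : S.det ≠ 0)
    (lam : Fin d → ℝ) (hlam : ∀ i, 0 < lam i)
    (L : Matrix (Fin d) (Fin d) ℝ) (hL : L = Matrix.diagonal lam)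
    (γ : ℝ) (hγ : 0 < γ)
    (μ ζ : QuadCost.VecProcess T Ω d)
    (hμ : QuadCost.MemL2 P 𝓕 δ μ) (hζ : QuadCost.MemL2 P 𝓕 δ ζ)
    (A Mperp Q : QuadCost.Horizon T → Ω → ℝ)
    (hA : QuadCost.IsFiniteVariationPart P 𝓕 δ A)
    (hM : QuadCost.IsUnhedgeablePart P 𝓕 δ Mperp Q)
    (ξ : QuadCost.VecProcess T Ω d) (hξ : ξ = QuadCost.frictionless γ S μ ζ)
    (B : Matrix (Fin d) (Fin d) ℝ) (hB : B = QuadCost.coeff γ S L) :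
    -- the optimization problem has a unique solution
    (∃ r, QuadCost.IsOptimal P 𝓕 δ γ S L μ ζ A Q r ∧
      ∀ r', QuadCost.IsOptimal P 𝓕 δ γ S L μ ζ A Q r' →
        (∀ᵐ p ∂((volume : Measure (QuadCost.Horizon T)).prod P), r' p.1 p.2 = r p.1 p.2) ∧
        (∀ᵐ ω ∂P, ∀ t, QuadCost.position r' t ω = QuadCost.position r t ω)) ∧
    -- the FBSDE has a unique solution
    (∃ φ φ' M, QuadCost.IsSolution P 𝓕 δ B ξ φ φ' M ∧
      ∀ ψ ψ' N, QuadCost.IsSolution P 𝓕 δ B ξ ψ ψ' N →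
        (∀ᵐ ω ∂P, ∀ t, ψ t ω = φ t ω) ∧
        (∀ t, ∀ᵐ ω ∂P, ψ' t ω = φ' t ω) ∧
        (∀ t, ∀ᵐ ω ∂P, N t ω - N ⊥ ω = M t ω - M ⊥ ω)) ∧
    -- the FBSDE characterizes the optimizer
    (∀ r, QuadCost.Admissible P 𝓕 δ r →
      (QuadCost.IsOptimal P 𝓕 δ γ S L μ ζ A Q r ↔
        ∃ φ φ' M, QuadCost.IsSolution P 𝓕 δ B ξ φ φ' M ∧
          ∀ᵐ p ∂((volume : Measure (QuadCost.Horizon T)).prod P), r p.1 p.2 = φ' p.1 p.2)) ∧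
    -- explicit representation and feedback form, infinite horizon
    (T = ∞ → ∃ R, QuadCost.IsPrincipalSqrt (QuadCost.shifted δ B) R ∧
      (∀ R', QuadCost.IsPrincipalSqrt (QuadCost.shifted δ B) R' → R' = R) ∧
      (∃ x, QuadCost.MemL2 P 𝓕 δ x ∧ QuadCost.IsSignalInfinite P 𝓕 δ R ξ x) ∧
      ∀ x, QuadCost.IsSignalInfinite P 𝓕 δ R ξ x →
        (∀ r, QuadCost.IsOptimal P 𝓕 δ γ S L μ ζ A Q r →
          (∀ᵐ ω ∂P, ∀ t, QuadCost.position r t ω = QuadCost.strategyInfinite δ R x t ω) ∧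
          (∀ᵐ p ∂((volume : Measure (QuadCost.Horizon T)).prod P), r p.1 p.2 = x p.1 p.2 -
            (R - (δ / 2) • (1 : Matrix (Fin d) (Fin d) ℝ)) *ᵥ QuadCost.position r p.1 p.2)) ∧
        (∀ φ φ' M, QuadCost.IsSolution P 𝓕 δ B ξ φ φ' M →
          (∀ᵐ ω ∂P, ∀ t, φ t ω = QuadCost.strategyInfinite δ R x t ω) ∧
          (∀ t, ∀ᵐ ω ∂P, φ' t ω = x t ω -
            (R - (δ / 2) • (1 : Matrix (Fin d) (Fin d) ℝ)) *ᵥ φ t ω))) ∧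
    -- explicit representation and feedback form, finite horizon
    (T < ∞ → (∀ t : QuadCost.Horizon T, IsUnit (QuadCost.weight δ B T.toReal t)) ∧
      (∃ x, QuadCost.MemL2 P 𝓕 δ x ∧ QuadCost.IsSignalFinite P 𝓕 δ B ξ x) ∧
      ∀ x, QuadCost.IsSignalFinite P 𝓕 δ B ξ x →
        (∀ r, QuadCost.IsOptimal P 𝓕 δ γ S L μ ζ A Q r →
          (∀ᵐ ω ∂P, ∀ t, QuadCost.position r t ω = QuadCost.strategyFinite δ B x t ω) ∧
          (∀ᵐ p ∂((volume : Measure (QuadCost.Horizon T)).prod P), r p.1 p.2 = x p.1 p.2 -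
            QuadCost.F δ B T.toReal p.1 *ᵥ QuadCost.position r p.1 p.2)) ∧
        (∀ φ φ' M, QuadCost.IsSolution P 𝓕 δ B ξ φ φ' M →
          (∀ᵐ ω ∂P, ∀ t, φ t ω = QuadCost.strategyFinite δ B x t ω) ∧
          (∀ t : QuadCost.Horizon T, ∀ᵐ ω ∂P, φ' t ω = x t ω -
            QuadCost.F δ B T.toReal t *ᵥ φ t ω))) := by
  have H : QuadCost.IsModel P 𝓕 δ γ S L lam μ ζ :=
    ⟨hT, hδ, by simpa [hS] using posSemidef_self_mul_conjTranspose σ, hSdet, hL, hlam, hγ, hμ, hζ⟩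
  subst hξ hB
  obtain ⟨V, Vi, b, hd⟩ := QuadCost.exists_diagonalization hS hSdet hlam hL hγ
  obtain ⟨φ, φ', M, h⟩ := H.exists_solution hd
  refine ⟨⟨φ', H.isOptimal_rate h, fun r' hr' => ⟨(H.isOptimal_iff h hr'.1).1 hr', ?_⟩⟩,
    ⟨φ, φ', M, h, fun ψ ψ' N h' => H.solution_unique h h'⟩,
    fun r hr => ⟨fun ho => ⟨φ, φ', M, h, (H.isOptimal_iff h hr).1 ho⟩, ?_⟩, ?_, ?_⟩
  · filter_upwards [H.position_eq_of_isOptimal h hr', h.position_eq] with ω h1 h2 t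
    rw [h1, h2]
  · rintro ⟨ψ, ψ', N, h', he⟩
    exact (H.isOptimal_iff h' hr).2 he
  · rintro rfl
    have hfb := fun i => QuadCost.isFeedback_infinite (δ := δ) (hd.pos i)
    have hR : (QuadCost.conjDiag V Vi fun i => QuadCost.scalarRoot δ (b i)) -
        (δ / 2) • (1 : Matrix (Fin d) (Fin d) ℝ) =
        QuadCost.conjDiag V Vi fun i => QuadCost.scalarRoot δ (b i) - δ / 2 := by
      rw [QuadCost.conjDiag_scalar hd.mul_inv, QuadCost.conjDiag_sub]
    refine ⟨_, hd.isPrincipalSqrt δ, fun R' hR' => hd.principalSqrt_unique hR', ?_, fun x hx => ?_⟩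
    · obtain ⟨x, hx⟩ := QuadCost.exists_modalSignal (P := P) (𝓕 := 𝓕) hd hfb H.memL2_frictionless
      exact ⟨x, hx.memL2 hd hfb H.memL2_frictionless,
        (hd.isSignalInfinite_iff hfb H.memL2_frictionless).2 hx⟩
    · have hx' := (hd.isSignalInfinite_iff hfb H.memL2_frictionless).1 hx
      rw [hR]
      exact H.feedback hd hfb hx'
        (hd.strategyInfinite_eq hfb (hx'.memL2 hd hfb H.memL2_frictionless))
  · intro hT'
    have hfb := fun i => QuadCost.isFeedback_finite hT'.ne hδ (hd.pos i)
    refine ⟨fun t => hd.isUnit_weight hδ _ _, ?_, fun x hx => ?_⟩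
    · obtain ⟨x, hx⟩ := QuadCost.exists_modalSignal (P := P) (𝓕 := 𝓕) hd hfb H.memL2_frictionless
      exact ⟨x, hx.memL2 hd hfb H.memL2_frictionless,
        (hd.isSignalFinite_iff hδ hT'.ne H.memL2_frictionless).2 hx⟩
    · have hx' := (hd.isSignalFinite_iff hδ hT'.ne H.memL2_frictionless).1 hx
      simp only [hd.F_eq hδ]
      exact H.feedback hd hfb hx'
        (hd.strategyFinite_eq hδ hT'.ne (hx'.memL2 hd hfb H.memL2_frictionless))
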